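/- **Setting.** Let $M$ be a (Hausdorff, finite-dimensional) smooth manifold and let $(E,[\cdot,\cdot],\rho)$ be a Lie algebroid of finite rank over $M$ with projection $\tau:E\to M$: $\rho:E\to TM$ is a vector bundle map over the identity, $[\cdot,\cdot]$ is a Lie bracket on $\Gamma(E)$, and $[X,fY]=f[X,Y]+\rho(X)(f)\,Y$. Assume that $E$ is *regular*, i.e. $\rho$ has constant rank. All objects are smooth. In local coordinates $(x^i)$ on $M$ and a local frame $(e_\alpha)$ of $E$, write $\rho(e_\alpha)=\rho^i_\alpha\,\partial/\partial x^i$, $[e_\alpha,e_\beta]=C^\gamma_{\alpha\beta}e_\gamma$, and $(x^i,y^\alpha)$ for the coordinates on $E$. For a map $f:N\to M$ the prolongation $\mathcal L^fE$ has fibre $\{(b,v)\in E_{f(p)}\times T_pN:\rho(b)=Tf(v)\}$ at $p\in N$. We use $\mathcal L^{\tau}E\to E$ and $\mathcal L^{\tau^*}E\to E^*$, where $\tau^*:E^*\to M$. The bundle $\mathcal L^\tau E$ is a Lie algebroid over $E$ with anchor $\rho^\tau(b,v)=v$ and the bracket of the sections $Z_1=(\sum_i h_i\,X_i\circ\tau,\,X')$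 and $Z_2=(\sum_j s_j\,Y_j\circ\tau,\,Y')$, with $X_i,Y_j\in\Gamma(E)$, $h_i,s_j$ functions on $E$ and $X',Y'$ vector fields on $E$, given by $$[Z_1,Z_2]=\Big(\sum_{i,j} h_is_j\,[X_i,Y_j]\circ\tau+\sum_j X'(s_j)\,Y_j\circ\tau-\sum_i Y'(h_i)\,X_i\circ\tau,\ [X',Y']\Big).$$ For a section $\Theta$ of $(\mathcal L^\tau E)^*$, $d^{\mathcal L^\tau E}\Theta(Z_1,Z_2)=\rho^\tau(Z_1)(\Theta(Z_2))-\rho^\tau(Z_2)(\Theta(Z_1))-\Theta([Z_1,Z_2])$. The frame $\tilde T_\alpha=(e_\alpha,\rho^i_\alpha\partial/\partial x^i)$, $\tilde V_\alpha=(0,\partial/\partial y^\alpha)$ of $\mathcal L^\tau E$ has dual frame $\tilde T^\alpha,\tilde V^\alpha$. A *SODE section* is a section $\Gamma$ of $\mathcal L^\tau E\to E$ with $S(\Gamma)=\Delta$, where $S(b,v)=(0,b^v_a)$, $\Delta(a)=(0,a^v_a)$ and $b^v_a=\frac{d}{dt}\big|_{t=0}(a+tb)$; locally $\Gamma=y^\alpha\tilde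 T_\alpha+\Gamma^\alpha\tilde V_\alpha$. A function $L$ on an open set $U\subseteq E$ *solves the inverse problem* for $\Gamma$ on $U$ if it is regular, i.e. $(\partial^2L/\partial y^\alpha\partial y^\beta)$ is nondegenerate on $U$, and there is a nondegenerate field of bilinear forms $(g_{\alpha\beta}(x,y))$ on the fibres of $E$, over $U$, such that $$g_{\alpha\beta}(\dot y^\alpha-\Gamma^\alpha)=\frac{d}{dt}\Big(\frac{\partial L}{\partial y^\beta}\Big)-\rho^i_\beta\frac{\partial L}{\partial x^i}+C^\gamma_{\beta\nu}y^\nu\frac{\partial L}{\partial y^\gamma}$$ holds identically in $(x,y)\in U$ and $\dot y$, with $\dot x^i=\rho^i_\alpha y^\alpha$. The section $\Gamma$ is *variational* if every point of $E$ has an open neighbourhood on which some $L$ solves the inverse problem for $\Gamma$. Let $W\subseteq E$ be open and let $F:W\to E^*$ be a local diffeomorphism over the identity of $M$, locally $(x^i,y^\alpha)\mapsto(x^i,F_\alpha(x,y))$. Put $\Theta_{\Gamma,F}=A_E\circ\mathcal LF\circ\Gamma$, a section of $(\mathcal L^\tau E)^*$ over $W$. Here $\mathcal LF(b,v)=(b,TF(v))$,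 and $A_E:\mathcal L^{\tau^*}E\to(\mathcal L^\tau E)^*$ is the Tulczyjew isomorphism: if $b=z^\beta e_\beta$ and if $v$ is a tangent vector to $E^*$ at $\varphi=y_\gamma e^\gamma$ with fibre components $v_\alpha$, then $A_E(b,v)=(v_\alpha+C^\gamma_{\alpha\beta}y_\gamma z^\beta)\tilde T^\alpha+y_\alpha\tilde V^\alpha$ at the point $b\in E$. Locally $$\Theta_{\Gamma,F}=\Big(\frac{\partial F_\alpha}{\partial x^i}\rho^i_\beta y^\beta+\frac{\partial F_\alpha}{\partial y^\beta}\Gamma^\beta+C^\gamma_{\alpha\beta}F_\gamma y^\beta\Big)\tilde T^\alpha+F_\alpha\tilde V^\alpha .$$ Consider the two conditions $$(\ast)\qquad d^{\mathcal L^\tau E}\Theta_{\Gamma,F}=0\ \text{ on } W,\qquad \Theta_{\Gamma,F}(Z)=0\ \text{ for all sections } Z \text{ of } \operatorname{Ker}(\rho^\tau)\text{ over open subsets of }W.$$ **Theorem.** Let $\Gamma$ be a SODE section on a regular Lie algebroid $E$. 1. $\Gamma$ is variational if and only if every point of $E$ has an open neighbourhood $W$ and a local diffeomorphism $F:W\to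 E^*$ over $M$ satisfying $(\ast)$. 2. For every open $W\subseteq E$ (in particular $W=E$): if there is a function $L$ on $W$ which solves the inverse problem for $\Gamma$ on $W$, then there is a local diffeomorphism $F:W\to E^*$ over $M$ satisfying $(\ast)$. 3. For every open $W\subseteq E$ (in particular $W=E$) and every local diffeomorphism $F:W\to E^*$ over $M$: $F$ satisfies $(\ast)$ if and only if every point of $W$ has an open neighbourhood $U\subseteq W$ with a function $L$ on $U$ which solves the inverse problem for $\Gamma$ on $U$ and whose Legendre transformation $\partial L/\partial y^\alpha$ equals $F$ on $U$. -/

import Mathlib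

open Bundle Set
open scoped Manifold ContDiff Topology

noncomputable section

/-! ### Vector bundles: sections, total spaces, duals

Throughout, `M` is a smooth manifold modelled on the finite-dimensional space `EM`, and `E` is a
smooth vector bundle over `M` with finite-dimensional model fibre `F`. -/

section Bundles

variable (EM : Type*) [NormedAddCommGroup EM] [NormedSpace ℝ EM]
  {M : Type*} [TopologicalSpace M] [ChartedSpace EM M]
  (F : Type*) [NormedAddCommGroup F] [NormedSpace ℝ F]
  (E : M → Type*) [TopologicalSpace (TotalSpace F E)] [∀ x, TopologicalSpace (E x)]

/-- The model with corners of the manifold `E` (total space of the bundle). -/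
abbrev totModel : ModelWithCorners ℝ (EM × F) (ModelProd EM F) := 𝓘(ℝ, EM).prod 𝓘(ℝ, F)

/-- Smooth global sections `Γ(E)`. -/
abbrev Sec [FiberBundle F E] := ContMDiffSection 𝓘(ℝ, EM) F ∞ E

variable [∀ x, AddCommGroup (E x)] [∀ x, Module ℝ (E x)]

/-- The fibres of the dual bundle `E*`. -/
abbrev DualFib (x : M) : Type _ := E x →L[ℝ] ℝ

/-- The total space of the dual bundle `E*`. -/
abbrev DualTot : Type _ := TotalSpace (F →L[ℝ] ℝ) (DualFib E)

end Bundles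

section Extension

variable {EM : Type*} [NormedAddCommGroup EM] [NormedSpace ℝ EM] [FiniteDimensional ℝ EM]
  {M : Type*} [TopologicalSpace M] [ChartedSpace EM M] [IsManifold 𝓘(ℝ, EM) ∞ M] [T2Space M]
  {F : Type*} [NormedAddCommGroup F] [NormedSpace ℝ F]
  {E : M → Type*} [TopologicalSpace (TotalSpace F E)] [∀ x, TopologicalSpace (E x)]
  [∀ x, AddCommGroup (E x)] [∀ x, Module ℝ (E x)]
  [FiberBundle F E] [VectorBundle ℝ F E] [ContMDiffVectorBundle ∞ F E 𝓘(ℝ, EM)]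

variable (EM F) in
/-- Every vector of a smooth vector bundle is the value of a global smooth section. -/
theorem exists_section_through (x : M) (b : E x) : ∃ s : Sec EM F E, s x = b := by
  obtain ⟨u, hu, hs⟩ := FiberBundle.exists_contMDiffOn_extend (k := ∞) 𝓘(ℝ, EM) F b
  obtain ⟨f, -, hf⟩ := (SmoothBumpFunction.nhds_basis_tsupport (I := 𝓘(ℝ, EM)) x).mem_iff.1
    (interior_mem_nhds.2 hu)
  · refine ⟨⟨fun y => f y • FiberBundle.extend F b y, ?_⟩, ?_⟩
    · exact ContMDiffOn.smul_section_of_tsupport (u := interior u) (s := FiberBundle.extend F b)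
        f.contMDiff.contMDiffOn isOpen_interior hf (hs.mono interior_subset)
    · change f x • FiberBundle.extend F b x = b
      simp

variable (EM F E) in
/-- A choice, linear in `b ∈ E_x`, of global smooth sections with value `b` at `x`. -/
theorem exists_linear_sections (x : M) :
    ∃ σ : E x →ₗ[ℝ] Sec EM F E, ∀ b, σ b x = b := by
  let ev : Sec EM F E →ₗ[ℝ] E x :=
    { toFun := fun s => s x, map_add' := fun _ _ => rfl, map_smul' := fun _ _ => rfl }
  obtain ⟨σ, hσ⟩ := ev.exists_rightInverse_of_surjective
    (LinearMap.range_eq_top.2 (exists_section_through EM F x))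
  exact ⟨σ, fun b => LinearMap.congr_fun hσ b⟩

variable (EM F E) in
/-- A section of `E` with value `b` at `x`, depending linearly on `b`. -/
def secThrough (x : M) : E x →ₗ[ℝ] Sec EM F E :=
  Classical.choose (exists_linear_sections EM F E x)

theorem secThrough_apply (x : M) (b : E x) : secThrough EM F E x b x = b :=
  Classical.choose_spec (exists_linear_sections EM F E x) b

end Extension

/-! ### Vertical lifts and fibre derivatives -/

section Vertical

variable {EM : Type*} [NormedAddCommGroup EM] [NormedSpace ℝ EM]
  {M : Type*} [TopologicalSpace M] [ChartedSpace EM M]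
  {F : Type*} [NormedAddCommGroup F] [NormedSpace ℝ F]
  {E : M → Type*} [TopologicalSpace (TotalSpace F E)] [∀ x, TopologicalSpace (E x)]
  [∀ x, AddCommGroup (E x)] [∀ x, Module ℝ (E x)]
  [FiberBundle F E] [VectorBundle ℝ F E]

/-- The derivative at `a` of a function `f` on `E` in the fibre direction `b`,
`d/dt f(a + t b)` at `t = 0`; in local coordinates, `b^α ∂f/∂y^α`. -/
def fibreDeriv (f : TotalSpace F E → ℝ) (a : TotalSpace F E) (b : E a.proj) : ℝ :=
  deriv (fun t : ℝ => f ⟨a.proj, a.2 + t • b⟩) 0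

/-- The fibre Hessian of `f`; in local coordinates, `b^α c^β ∂²f/∂y^α∂y^β`. -/
def fibreHessian (f : TotalSpace F E → ℝ) (a : TotalSpace F E) (b c : E a.proj) : ℝ :=
  deriv (fun t : ℝ => fibreDeriv f ⟨a.proj, a.2 + t • b⟩ c) 0

/-- The velocity at `t = 0` of the curve `t ↦ a + t b`. -/
def vertVelocity (a : TotalSpace F E) (b : E a.proj) : TangentSpace (totModel EM F) a :=
  (mfderiv 𝓘(ℝ, ℝ) (totModel EM F)
    (fun t : ℝ => (⟨a.proj, a.2 + t • b⟩ : TotalSpace F E)) 0 (1 : ℝ) : EM × F)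

/-- The curve `t ↦ a + t b` is differentiable at `t = 0`; read in the trivialization at the base
point, its velocity is `(0, b)`. -/
theorem hasMFDerivAt_fibreLine (a : TotalSpace F E) (b : E a.proj) :
    HasMFDerivAt 𝓘(ℝ, ℝ) (totModel EM F)
      (fun t : ℝ => (⟨a.proj, a.2 + t • b⟩ : TotalSpace F E)) 0
      (ContinuousLinearMap.toSpanSingleton ℝ (((0 : EM),
        (trivializationAt F E a.proj).continuousLinearEquivAt ℝ a.proj
          (mem_baseSet_trivializationAt F E a.proj) b) : EM × F)) := by
  set e := (trivializationAt F E a.proj).continuousLinearEquivAt ℝ a.proj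
    (mem_baseSet_trivializationAt F E a.proj) with he
  have het : ∀ c : E a.proj, ((trivializationAt F E a.proj) ⟨a.proj, c⟩).2 = e c := by
    intro c
    rw [he, Trivialization.continuousLinearEquivAt_apply]
  have hd : HasFDerivAt (fun t : ℝ => ((extChartAt 𝓘(ℝ, EM) a.proj a.proj, e a.2 + t • e b) :
      EM × F)) (ContinuousLinearMap.toSpanSingleton ℝ (((0 : EM), e b) : EM × F)) 0 := by
    have h1 : HasDerivAt (fun t : ℝ => ((extChartAt 𝓘(ℝ, EM) a.proj a.proj, e a.2 + t • e b) :
        EM × F)) ((0 : EM), e b) 0 := by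
      refine (hasDerivAt_const _ _).prodMk ?_
      simpa using ((hasDerivAt_id (0 : ℝ)).smul_const (e b)).const_add (e a.2)
    simpa using h1.hasFDerivAt
  refine ⟨?_, ?_⟩
  · rw [FiberBundle.continuousAt_totalSpace]
    refine ⟨continuousAt_const, ?_⟩
    simp only [het, map_add, map_smul]
    fun_prop
  · have hw : writtenInExtChartAt 𝓘(ℝ, ℝ) (totModel EM F) (0 : ℝ)
        (fun t : ℝ => (⟨a.proj, a.2 + t • b⟩ : TotalSpace F E)) =
        fun t : ℝ => (extChartAt 𝓘(ℝ, EM) a.proj a.proj, e a.2 + t • e b) := by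
      funext t
      change extChartAt (totModel EM F) (⟨a.proj, a.2 + (0 : ℝ) • b⟩ : TotalSpace F E)
        ⟨a.proj, a.2 + t • b⟩ = _
      rw [FiberBundle.extChartAt]
      refine Prod.ext ?_ ?_
      · change extChartAt 𝓘(ℝ, EM) a.proj
          ((trivializationAt F E a.proj) ⟨a.proj, a.2 + t • b⟩).1 = _
        rw [Trivialization.coe_fst' (x := (⟨a.proj, a.2 + t • b⟩ : TotalSpace F E)) _
          (mem_baseSet_trivializationAt F E a.proj)]
      · change ((trivializationAt F E a.proj) ⟨a.proj, a.2 + t • b⟩).2 = _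
        rw [het, map_add, map_smul]
    rw [hw]
    exact hd.hasFDerivWithinAt

theorem vertVelocity_eq (a : TotalSpace F E) (b : E a.proj) :
    vertVelocity (EM := EM) a b = ((0 : EM),
      (trivializationAt F E a.proj).continuousLinearEquivAt ℝ a.proj
        (mem_baseSet_trivializationAt F E a.proj) b) := by
  unfold vertVelocity
  rw [(hasMFDerivAt_fibreLine a b).mfderiv]
  exact one_smul ℝ (((0 : EM), _) : EM × F)

/-- The vertical lift `b ↦ b_a^v` of the fibre through `a` into `T_a E`. -/
def vertLift (a : TotalSpace F E) : E a.proj →ₗ[ℝ] TangentSpace (totModel EM F) a where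
  toFun b := vertVelocity a b
  map_add' b c := by
    simp only [vertVelocity_eq, map_add]
    exact Prod.ext (add_zero (0 : EM)).symm rfl
  map_smul' r b := by
    simp only [vertVelocity_eq, map_smul]
    exact Prod.ext (smul_zero r).symm rfl

theorem vertLift_injective (a : TotalSpace F E) :
    Function.Injective (vertLift (EM := EM) a) := by
  intro b c h
  have h' : vertVelocity (EM := EM) a b = vertVelocity (EM := EM) a c := h
  rw [vertVelocity_eq, vertVelocity_eq] at h'
  have h'' := congrArg (fun p : EM × F => p.2) h'
  exact ((trivializationAt F E a.proj).continuousLinearEquivAt ℝ a.proj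
    (mem_baseSet_trivializationAt F E a.proj)).injective h''

theorem mfderiv_proj_vertLift (a : TotalSpace F E) (b : E a.proj) :
    mfderiv (totModel EM F) 𝓘(ℝ, EM) (TotalSpace.proj : TotalSpace F E → M) a
      (vertLift a b) = 0 := by
  have h1 := hasMFDerivAt_fibreLine (EM := EM) a b
  have key : ∀ p : TotalSpace F E, p = a →
      (mfderiv (totModel EM F) 𝓘(ℝ, EM) (TotalSpace.proj : TotalSpace F E → M) p : EM × F →L[ℝ] EM)
        = mfderiv (totModel EM F) 𝓘(ℝ, EM) (TotalSpace.proj : TotalSpace F E → M) a := by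
    rintro p rfl; rfl
  have h2 : MDifferentiableAt (totModel EM F) 𝓘(ℝ, EM)
      (TotalSpace.proj : TotalSpace F E → M) (⟨a.proj, a.2 + (0 : ℝ) • b⟩ : TotalSpace F E) :=
    (contMDiff_proj E (n := 1)).mdifferentiableAt one_ne_zero
  have h3 := h2.hasMFDerivAt.comp (0 : ℝ) h1
  have h4 := h3.mfderiv
  have h5 : mfderiv 𝓘(ℝ, ℝ) 𝓘(ℝ, EM) ((TotalSpace.proj : TotalSpace F E → M) ∘
      fun t : ℝ => (⟨a.proj, a.2 + t • b⟩ : TotalSpace F E)) 0 = 0 := mfderiv_const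
  rw [h5] at h4
  have h6 := key ⟨a.proj, a.2 + (0 : ℝ) • b⟩ (by cases a; simp)
  have h7 := congrArg (fun l : ℝ →L[ℝ] EM => l 1) h4
  have h8 : vertLift (EM := EM) a b = ((0 : EM),
      (trivializationAt F E a.proj).continuousLinearEquivAt ℝ a.proj
        (mem_baseSet_trivializationAt F E a.proj) b) := vertVelocity_eq a b
  rw [h8]
  refine (congrArg (fun l : EM × F →L[ℝ] EM => l ((0 : EM),
      (trivializationAt F E a.proj).continuousLinearEquivAt ℝ a.proj
        (mem_baseSet_trivializationAt F E a.proj) b)) h6).symm.trans ?_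
  refine Eq.trans ?_ h7.symm
  change _ = (mfderiv (totModel EM F) 𝓘(ℝ, EM) (TotalSpace.proj : TotalSpace F E → M)
    (⟨a.proj, a.2 + (0 : ℝ) • b⟩ : TotalSpace F E) : EM × F →L[ℝ] EM) ((1 : ℝ) • (((0 : EM), _) : EM × F))
  rw [one_smul]
  rfl

/-- The function `β ↦ ⟨β, X⟩` on `E*` given by a section `X` of `E` is smooth. -/
theorem contMDiff_linearFun (X : Sec EM F E) :
    ContMDiff (totModel EM (F →L[ℝ] ℝ)) 𝓘(ℝ, ℝ) ∞ (fun β : DualTot F E => β.2 (X β.proj)) := by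
  intro β
  have h1 : ContMDiffAt (totModel EM (F →L[ℝ] ℝ)) (totModel EM (F →L[ℝ] ℝ)) ∞
      (fun β : DualTot F E => TotalSpace.mk' (F →L[ℝ] ℝ)
        (E := fun x : M => (E x →L[ℝ] Bundle.Trivial M ℝ x)) β.proj β.2) β := contMDiffAt_id
  have h2 : ContMDiffAt (totModel EM (F →L[ℝ] ℝ)) (totModel EM F) ∞
      (fun β : DualTot F E => TotalSpace.mk' F β.proj (X β.proj)) β :=
    (X.contMDiff.comp (contMDiff_proj (DualFib E))).contMDiffAt
  have h3 := ContMDiffAt.clm_bundle_apply (E₂ := Bundle.Trivial M ℝ) h1 h2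
  exact (contMDiffAt_totalSpace.1 h3).2

end Vertical

/-! ### Lie algebroids -/

/-- The derivative `v(f)` of a function `f` at `p` along the tangent vector `v`. -/
def dirDeriv {EN HN N : Type*} [NormedAddCommGroup EN] [NormedSpace ℝ EN] [TopologicalSpace HN]
    (J : ModelWithCorners ℝ EN HN) [TopologicalSpace N] [ChartedSpace HN N] (f : N → ℝ) (p : N)
    (v : TangentSpace J p) : ℝ :=
  mfderiv J 𝓘(ℝ, ℝ) f p v

section Algebroid

/-- A Lie algebroid structure on the smooth vector bundle `E → M`: a bundle map `ρ : E → TM` over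
the identity (the anchor) and a Lie bracket on `Γ(E)` such that
`[X, f Y] = f [X, Y] + ρ(X)(f) Y`. -/
structure LieAlgebroid (EM : Type*) [NormedAddCommGroup EM] [NormedSpace ℝ EM]
    {M : Type*} [TopologicalSpace M] [ChartedSpace EM M] [IsManifold 𝓘(ℝ, EM) ∞ M]
    (F : Type*) [NormedAddCommGroup F] [NormedSpace ℝ F]
    (E : M → Type*) [TopologicalSpace (TotalSpace F E)] [∀ x, TopologicalSpace (E x)]
    [∀ x, AddCommGroup (E x)] [∀ x, Module ℝ (E x)]
    [FiberBundle F E] [VectorBundle ℝ F E] where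
  anchor : ∀ x : M, E x →ₗ[ℝ] TangentSpace 𝓘(ℝ, EM) x
  contMDiff_anchor : ContMDiff (totModel EM F) 𝓘(ℝ, EM).tangent ∞
    (fun a : TotalSpace F E => (⟨a.proj, anchor a.proj a.2⟩ : TangentBundle 𝓘(ℝ, EM) M))
  bracket : Sec EM F E →ₗ[ℝ] Sec EM F E →ₗ[ℝ] Sec EM F E
  bracket_self : ∀ X, bracket X X = 0
  jacobi : ∀ X Y Z,
    bracket X (bracket Y Z) + bracket Y (bracket Z X) + bracket Z (bracket X Y) = 0
  leibniz : ∀ (f : M → ℝ), ContMDiff 𝓘(ℝ, EM) 𝓘(ℝ, ℝ) ∞ f → ∀ X Y fY : Sec EM F E,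
    (∀ x, fY x = f x • Y x) → ∀ x, bracket X fY x =
      f x • bracket X Y x + dirDeriv 𝓘(ℝ, EM) f x (anchor x (X x)) • Y x

variable {EM : Type*} [NormedAddCommGroup EM] [NormedSpace ℝ EM]
  {M : Type*} [TopologicalSpace M] [ChartedSpace EM M] [IsManifold 𝓘(ℝ, EM) ∞ M]
  {F : Type*} [NormedAddCommGroup F] [NormedSpace ℝ F]
  {E : M → Type*} [TopologicalSpace (TotalSpace F E)] [∀ x, TopologicalSpace (E x)]
  [∀ x, AddCommGroup (E x)] [∀ x, Module ℝ (E x)]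
  [FiberBundle F E] [VectorBundle ℝ F E]

namespace LieAlgebroid

variable [ContMDiffVectorBundle ∞ F E 𝓘(ℝ, EM)] (A : LieAlgebroid EM F E)

/-- The anchor has constant rank. -/
def IsRegular : Prop :=
  ∃ q : ℕ, ∀ x : M, Module.finrank ℝ (LinearMap.range (A.anchor x)) = q

/-- The fibre at `p` of the prolongation `𝓛^f E` of `E` over `f : N → M`:
pairs `(b, v)` with `b` in `E` over `f p`, `v` in `T_p N` and `ρ(b) = T f (v)`. -/
def prol {EN HN N : Type*} [NormedAddCommGroup EN] [NormedSpace ℝ EN] [TopologicalSpace HN]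
    (J : ModelWithCorners ℝ EN HN) [TopologicalSpace N] [ChartedSpace HN N] (f : N → M) (p : N) :
    Submodule ℝ (E (f p) × TangentSpace J p) where
  carrier := {z | A.anchor (f p) z.1 = mfderiv J 𝓘(ℝ, EM) f p z.2}
  add_mem' := by
    intro z w (hz : _ = _) (hw : _ = _)
    change A.anchor (f p) (z.1 + w.1) = mfderiv J 𝓘(ℝ, EM) f p (z.2 + w.2)
    rw [map_add, map_add, hz, hw]
  zero_mem' := by
    change A.anchor (f p) 0 = mfderiv J 𝓘(ℝ, EM) f p 0
    rw [map_zero, map_zero]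
  smul_mem' := by
    intro r z (hz : _ = _)
    change A.anchor (f p) (r • z.1) = mfderiv J 𝓘(ℝ, EM) f p (r • z.2)
    rw [map_smul, map_smul, hz]

/-- The fibre at `a` of `𝓛^τ E`, the prolongation of `E` over its own projection `τ : E → M`. -/
abbrev prolE (a : TotalSpace F E) :
    Submodule ℝ (E a.proj × TangentSpace (totModel EM F) a) :=
  A.prol (totModel EM F) (TotalSpace.proj : TotalSpace F E → M) a

/-- The first component `b` of the element `(b, v)` of `𝓛^τ E`. -/
abbrev baseVec {a : TotalSpace F E} (z : A.prolE a) : E a.proj := z.1.1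

/-- The anchor `ρ^τ (b, v) = v` of `𝓛^τ E`. -/
abbrev prolAnchor {a : TotalSpace F E} (z : A.prolE a) : TangentSpace (totModel EM F) a := z.1.2

/-- The section `Z` of `𝓛^τ E` (not assumed continuous) is smooth on the set `V`. -/
def SmoothOn (Z : ∀ a : TotalSpace F E, A.prolE a) (V : Set (TotalSpace F E)) : Prop :=
  ContMDiffOn (totModel EM F) (totModel EM F) ∞
      (fun a : TotalSpace F E => (⟨a.proj, A.baseVec (Z a)⟩ : TotalSpace F E)) V ∧
    ContMDiffOn (totModel EM F) (totModel EM F).tangent ∞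
      (fun a : TotalSpace F E =>
        (⟨a, A.prolAnchor (Z a)⟩ : TangentBundle (totModel EM F) (TotalSpace F E))) V

/-- On the open set `V`, the section `Z₃` of `𝓛^τ E` is the Lie bracket of `Z₁` and `Z₂`.
Writing `Z₁ = (∑ hᵢ (Xᵢ ∘ τ), X')` and `Z₂ = (∑ sⱼ (Yⱼ ∘ τ), Y')` with `Xᵢ, Yⱼ ∈ Γ(E)`,
it is `(∑ hᵢ sⱼ ([Xᵢ, Yⱼ] ∘ τ) + ∑ X'(sⱼ) (Yⱼ ∘ τ) - ∑ Y'(hᵢ) (Xᵢ ∘ τ), [X', Y'])`. -/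
def IsProlBracket (V : Set (TotalSpace F E)) (Z₁ Z₂ Z₃ : ∀ a : TotalSpace F E, A.prolE a) : Prop :=
  ∃ (k l : ℕ) (h : Fin k → TotalSpace F E → ℝ) (X : Fin k → Sec EM F E)
    (s : Fin l → TotalSpace F E → ℝ) (Y : Fin l → Sec EM F E),
    (∀ i, ContMDiffOn (totModel EM F) 𝓘(ℝ, ℝ) ∞ (h i) V) ∧
    (∀ j, ContMDiffOn (totModel EM F) 𝓘(ℝ, ℝ) ∞ (s j) V) ∧
    (∀ a ∈ V, A.baseVec (Z₁ a) = ∑ i, h i a • X i a.proj) ∧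
    (∀ a ∈ V, A.baseVec (Z₂ a) = ∑ j, s j a • Y j a.proj) ∧
    ∀ a ∈ V,
      A.baseVec (Z₃ a) =
        ∑ i, ∑ j, (h i a * s j a) • A.bracket (X i) (Y j) a.proj
        + ∑ j, dirDeriv (totModel EM F) (s j) a (A.prolAnchor (Z₁ a)) • Y j a.proj
        - ∑ i, dirDeriv (totModel EM F) (h i) a (A.prolAnchor (Z₂ a)) • X i a.proj ∧
      A.prolAnchor (Z₃ a) =
        VectorField.mlieBracket (totModel EM F)
          (fun a' => A.prolAnchor (Z₁ a')) (fun a' => A.prolAnchor (Z₂ a')) a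

/-- The section `Θ` of `(𝓛^τ E)*` satisfies `d^{𝓛^τ E} Θ = 0` on the open set `W`, where
`dΘ(Z₁, Z₂) = ρ^τ(Z₁)(Θ(Z₂)) - ρ^τ(Z₂)(Θ(Z₁)) - Θ([Z₁, Z₂])` for local sections `Z₁, Z₂`. -/
def IsClosedOn (Θ : ∀ a : TotalSpace F E, Module.Dual ℝ (A.prolE a))
    (W : Set (TotalSpace F E)) : Prop :=
  ∀ V : Set (TotalSpace F E), IsOpen V → V ⊆ W →
    ∀ Z₁ Z₂ Z₃ : ∀ a : TotalSpace F E, A.prolE a,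
      A.SmoothOn Z₁ V → A.SmoothOn Z₂ V → A.IsProlBracket V Z₁ Z₂ Z₃ →
      ∀ a ∈ V,
        dirDeriv (totModel EM F) (fun a' => Θ a' (Z₂ a')) a (A.prolAnchor (Z₁ a))
          - dirDeriv (totModel EM F) (fun a' => Θ a' (Z₁ a')) a (A.prolAnchor (Z₂ a))
          - Θ a (Z₃ a) = 0

/-- `Θ(Z) = 0` on `W` for all (local) sections `Z` of `Ker ρ^τ`. -/
def VanishesOnKer (Θ : ∀ a : TotalSpace F E, Module.Dual ℝ (A.prolE a))
    (W : Set (TotalSpace F E)) : Prop :=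
  ∀ V : Set (TotalSpace F E), IsOpen V → V ⊆ W →
    ∀ Z : ∀ a : TotalSpace F E, A.prolE a, A.SmoothOn Z V →
      (∀ a ∈ V, A.prolAnchor (Z a) = 0) → ∀ a ∈ V, Θ a (Z a) = 0

/-! ### SODE sections -/

/-- The vertical endomorphism `S(b, v) = (0, b_a^v)` of `𝓛^τ E`. -/
def vertEndo (a : TotalSpace F E) (z : A.prolE a) : A.prolE a :=
  ⟨(0, vertLift a (A.baseVec z)), by
    change A.anchor a.proj 0 = mfderiv _ _ _ a (vertLift a (A.baseVec z))
    rw [mfderiv_proj_vertLift, map_zero]⟩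

/-- The Euler section `Δ(a) = (0, a_a^v)` of `𝓛^τ E`. -/
def eulerSection (a : TotalSpace F E) : A.prolE a :=
  ⟨(0, vertLift a a.2), by
    change A.anchor a.proj 0 = mfderiv _ _ _ a (vertLift a a.2)
    rw [mfderiv_proj_vertLift, map_zero]⟩

/-- A SODE section: a smooth section `Γ` of `𝓛^τ E → E` with `S(Γ) = Δ`. -/
structure SODE where
  toFun : ∀ a : TotalSpace F E, A.prolE a
  smooth : A.SmoothOn toFun univ
  vertEndo_eq : ∀ a, A.vertEndo a (toFun a) = A.eulerSection a

variable {A} in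
theorem SODE.baseVec_eq (Γ : A.SODE) (a : TotalSpace F E) : A.baseVec (Γ.toFun a) = a.2 :=
  vertLift_injective (EM := EM) a
    (congrArg (fun z : A.prolE a => z.1.2) (Γ.vertEndo_eq a))

/-- The SODE field `ρ^τ(Γ)`, a vector field on `E`. -/
def SODE.field {A : LieAlgebroid EM F E} (Γ : A.SODE) (a : TotalSpace F E) :
    TangentSpace (totModel EM F) a := A.prolAnchor (Γ.toFun a)

/-! ### The Euler-Lagrange operator and variational SODE sections -/

/-- The Euler-Lagrange expression of `L` at `a ∈ E`, with `v ∈ T_a E` standing for `(ẋ, ẏ)`: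
`v(⟨FL, X⟩) - ρ(X)(L ∘ Y) + ⟨FL(a), [X, Y]⟩`, for sections `X` and `Y` of `E` with
`Y(τ(a)) = a`, where `FL` is the fibre derivative of `L`. For a local frame `e_α`, `X = e_β` and
`Y = y^ν e_ν` with constant `y^ν`, the three terms are `d/dt (∂L/∂y^β)`, `ρ^i_β ∂L/∂x^i` and
`C^γ_{βν} y^ν ∂L/∂y^γ`. When `T τ(v) = ρ(a)`, the value depends on `X` and `Y`
only through `X(τ(a))`. -/
def eulerLagrange (L : TotalSpace F E → ℝ) (a : TotalSpace F E)
    (v : TangentSpace (totModel EM F) a) (X Y : Sec EM F E) : ℝ :=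
  dirDeriv (totModel EM F) (fun a' => fibreDeriv L a' (X a'.proj)) a v
    - dirDeriv 𝓘(ℝ, EM) (fun x => L ⟨x, Y x⟩) a.proj (A.anchor a.proj (X a.proj))
    + fibreDeriv L a (A.bracket X Y a.proj)

/-- `L` is a regular Lagrangian on the open set `U` which solves the inverse problem for `Γ` there:
for some nondegenerate multipliers `g`,
`g_{αβ} (ẏ^α - Γ^α) = d/dt (∂L/∂y^β) - ρ^i_β ∂L/∂x^i + C^γ_{βν} y^ν ∂L/∂y^γ`
identically in `(x, y) ∈ U` and `ẏ`, with `ẋ^i = ρ^i_α y^α`. Here `(ẋ, ẏ)` is the vector `v`, and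
`u` is the vector with components `ẏ^α - Γ^α`. -/
structure SolvesInverseProblem {A : LieAlgebroid EM F E} (Γ : A.SODE)
    (U : Set (TotalSpace F E)) (L : TotalSpace F E → ℝ) : Prop where
  smooth : ContMDiffOn (totModel EM F) 𝓘(ℝ, ℝ) ∞ L U
  regular : ∀ a ∈ U, ∀ b : E a.proj, (∀ c : E a.proj, fibreHessian L a b c = 0) → b = 0
  multipliers : ∃ g : ∀ a : TotalSpace F E, LinearMap.BilinForm ℝ (E a.proj),
    (∀ a ∈ U, (g a).Nondegenerate) ∧
    ∀ a ∈ U, ∀ (v : TangentSpace (totModel EM F) a) (u : E a.proj),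
      v - Γ.field a = vertLift a u →
      ∀ X Y : Sec EM F E, Y a.proj = a.2 →
        g a u (X a.proj) = A.eulerLagrange L a v X Y

/-- `Γ` is variational: around every point of `E` the inverse problem has a regular solution. -/
def SODE.IsVariational {A : LieAlgebroid EM F E} (Γ : A.SODE) : Prop :=
  ∀ a : TotalSpace F E, ∃ U : Set (TotalSpace F E), IsOpen U ∧ a ∈ U ∧
    ∃ L : TotalSpace F E → ℝ, SolvesInverseProblem Γ U L

/-! ### The Tulczyjew map and the section `Θ_{Γ,F}` -/

/-- The fibre at `p ∈ E*` of `𝓛^{τ*} E`, the prolongation of `E` over `τ* : E* → M`. -/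
abbrev prolDual (p : DualTot F E) :
    Submodule ℝ (E p.proj × TangentSpace (totModel EM (F →L[ℝ] ℝ)) p) :=
  A.prol (totModel EM (F →L[ℝ] ℝ)) (TotalSpace.proj : DualTot F E → M) p

/-- The map `E → E*` over the identity of `M` given by a family of covectors. -/
abbrev toDualMap (G : ∀ a : TotalSpace F E, DualFib E a.proj) (a : TotalSpace F E) : DualTot F E :=
  ⟨a.proj, G a⟩

/-- The map `𝓛G (b, v) = (b, T G (v))` from `𝓛^τ E` to `𝓛^{τ*} E`, at a point `a` where the
map `G : E → E*` over `M` is differentiable. -/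
def prolMap (G : ∀ a : TotalSpace F E, DualFib E a.proj) (a : TotalSpace F E)
    (hG : MDifferentiableAt (totModel EM F) (totModel EM (F →L[ℝ] ℝ)) (toDualMap (F := F) G) a)
    (z : A.prolE a) : A.prolDual (toDualMap (F := F) G a) :=
  ⟨(A.baseVec z, mfderiv (totModel EM F) (totModel EM (F →L[ℝ] ℝ)) (toDualMap (F := F) G) a
      (A.prolAnchor z)), by
    have hz : A.anchor a.proj (A.baseVec z) =
      mfderiv (totModel EM F) 𝓘(ℝ, EM) (TotalSpace.proj : TotalSpace F E → M) a
        (A.prolAnchor z) := z.2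
    have hp : MDifferentiableAt (totModel EM (F →L[ℝ] ℝ)) 𝓘(ℝ, EM)
        (TotalSpace.proj : DualTot F E → M) (toDualMap (F := F) G a) :=
      (contMDiff_proj (DualFib E) (n := 1)).mdifferentiableAt one_ne_zero
    have hc := mfderiv_comp a hp hG
    change A.anchor a.proj (A.baseVec z) = mfderiv (totModel EM (F →L[ℝ] ℝ)) 𝓘(ℝ, EM)
      (TotalSpace.proj : DualTot F E → M) (toDualMap (F := F) G a)
        (mfderiv (totModel EM F) (totModel EM (F →L[ℝ] ℝ)) (toDualMap (F := F) G) a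
          (A.prolAnchor z))
    rw [hz]
    exact congrArg (fun l : EM × F →L[ℝ] EM => l (A.prolAnchor z)) hc⟩

section Tulczyjew

variable [FiniteDimensional ℝ EM] [T2Space M]

/-- The Tulczyjew isomorphism `A_E : 𝓛^{τ*} E → (𝓛^τ E)*`. It sends the element `(b, v)` of
`𝓛^{τ*} E` at `φ ∈ E*_x`, where `b = a`, to the linear form on the fibre of `𝓛^τ E` at `a` with
`⟨A_E(b, v), (c, w)⟩ = v(⟨·, X⟩) + φ([X, Y](x)) + w(⟨θ, ·⟩) - ρ(c)(⟨θ, Y⟩)`,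
where `X, Y ∈ Γ(E)` and `θ ∈ Γ(E*)` are any sections through `c`, `b` and `φ`, and `⟨·, X⟩` and
`⟨θ, ·⟩` are the linear functions on `E*` and `E`. For `X, Y, θ` with constant
components in a local frame, the form is `(v_α + C^γ_{αβ} φ_γ b^β) c^α + φ_α w^α`. -/
def tulczyjew (a : TotalSpace F E) (φ : DualFib E a.proj)
    (z : A.prolDual (⟨a.proj, φ⟩ : DualTot F E)) (_hz : z.1.1 = a.2) :
    Module.Dual ℝ (A.prolE a) where
  toFun q :=
    let X := secThrough EM F E a.proj (A.baseVec q)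
    let Y := secThrough EM F E a.proj z.1.1
    let θ := secThrough EM (F →L[ℝ] ℝ) (DualFib E) a.proj φ
    dirDeriv (totModel EM (F →L[ℝ] ℝ)) (fun β : DualTot F E => β.2 (X β.proj)) ⟨a.proj, φ⟩ z.1.2
      + φ (A.bracket X Y a.proj)
      + (dirDeriv (totModel EM F) (fun e : TotalSpace F E => θ e.proj e.2) a (A.prolAnchor q)
        - dirDeriv 𝓘(ℝ, EM) (fun x => θ x (Y x)) a.proj (A.anchor a.proj (A.baseVec q)))
  map_add' q r := by
    have hlin : ∀ X : Sec EM F E, MDifferentiableAt (totModel EM (F →L[ℝ] ℝ)) 𝓘(ℝ, ℝ)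
        (fun β : DualTot F E => β.2 (X β.proj)) (⟨a.proj, φ⟩ : DualTot F E) := fun X =>
      (contMDiff_linearFun X).contMDiffAt.mdifferentiableAt (by simp)
    have h1 := mfderiv_add (hlin (secThrough EM F E a.proj (A.baseVec q)))
      (hlin (secThrough EM F E a.proj (A.baseVec r)))
    have h2 : (fun β : DualTot F E =>
        β.2 ((secThrough EM F E a.proj (A.baseVec q + A.baseVec r)) β.proj)) =
        (fun β : DualTot F E => β.2 ((secThrough EM F E a.proj (A.baseVec q)) β.proj)) +
        (fun β : DualTot F E => β.2 ((secThrough EM F E a.proj (A.baseVec r)) β.proj)) := by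
      funext β
      rw [map_add, ContMDiffSection.coe_add]
      exact map_add β.2 _ _
    have h3 : dirDeriv (totModel EM (F →L[ℝ] ℝ)) (fun β : DualTot F E =>
        β.2 ((secThrough EM F E a.proj (A.baseVec q + A.baseVec r)) β.proj)) ⟨a.proj, φ⟩ z.1.2 =
        dirDeriv (totModel EM (F →L[ℝ] ℝ)) (fun β : DualTot F E =>
          β.2 ((secThrough EM F E a.proj (A.baseVec q)) β.proj)) ⟨a.proj, φ⟩ z.1.2 +
        dirDeriv (totModel EM (F →L[ℝ] ℝ)) (fun β : DualTot F E =>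
          β.2 ((secThrough EM F E a.proj (A.baseVec r)) β.proj)) ⟨a.proj, φ⟩ z.1.2 := by
      rw [h2]
      exact congrArg (fun l : EM × (F →L[ℝ] ℝ) →L[ℝ] ℝ => l z.1.2) h1
    have h4 : φ (A.bracket (secThrough EM F E a.proj (A.baseVec q + A.baseVec r))
        (secThrough EM F E a.proj z.1.1) a.proj) =
        φ (A.bracket (secThrough EM F E a.proj (A.baseVec q))
          (secThrough EM F E a.proj z.1.1) a.proj) +
        φ (A.bracket (secThrough EM F E a.proj (A.baseVec r))
          (secThrough EM F E a.proj z.1.1) a.proj) := by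
      rw [map_add, map_add, LinearMap.add_apply, ContMDiffSection.coe_add]
      exact map_add φ _ _
    have hb : A.baseVec (q + r) = A.baseVec q + A.baseVec r := rfl
    have ha : A.prolAnchor (q + r) = A.prolAnchor q + A.prolAnchor r := rfl
    have h5 : ∀ f : TotalSpace F E → ℝ, dirDeriv (totModel EM F) f a
        (A.prolAnchor q + A.prolAnchor r) = dirDeriv (totModel EM F) f a (A.prolAnchor q) +
          dirDeriv (totModel EM F) f a (A.prolAnchor r) := fun f =>
      map_add (mfderiv (totModel EM F) 𝓘(ℝ, ℝ) f a) _ _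
    have h6 : ∀ f : M → ℝ, dirDeriv 𝓘(ℝ, EM) f a.proj
        (A.anchor a.proj (A.baseVec q + A.baseVec r)) =
        dirDeriv 𝓘(ℝ, EM) f a.proj (A.anchor a.proj (A.baseVec q)) +
          dirDeriv 𝓘(ℝ, EM) f a.proj (A.anchor a.proj (A.baseVec r)) := fun f => by
      rw [map_add]
      exact map_add (mfderiv 𝓘(ℝ, EM) 𝓘(ℝ, ℝ) f a.proj) _ _
    dsimp only
    rw [hb, ha, h3, h4, h5, h6]
    ring
  map_smul' t q := by
    have hlin : MDifferentiableAt (totModel EM (F →L[ℝ] ℝ)) 𝓘(ℝ, ℝ)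
        (fun β : DualTot F E => β.2 ((secThrough EM F E a.proj (A.baseVec q)) β.proj))
        (⟨a.proj, φ⟩ : DualTot F E) :=
      (contMDiff_linearFun _).contMDiffAt.mdifferentiableAt (by simp)
    have h1 := const_smul_mfderiv hlin t
    have h2 : (fun β : DualTot F E =>
        β.2 ((secThrough EM F E a.proj (t • A.baseVec q)) β.proj)) =
        t • (fun β : DualTot F E => β.2 ((secThrough EM F E a.proj (A.baseVec q)) β.proj)) := by
      funext β
      rw [map_smul, ContMDiffSection.coe_smul]
      exact map_smul β.2 _ _
    have h3 : dirDeriv (totModel EM (F →L[ℝ] ℝ)) (fun β : DualTot F E =>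
        β.2 ((secThrough EM F E a.proj (t • A.baseVec q)) β.proj)) ⟨a.proj, φ⟩ z.1.2 =
        t * dirDeriv (totModel EM (F →L[ℝ] ℝ)) (fun β : DualTot F E =>
          β.2 ((secThrough EM F E a.proj (A.baseVec q)) β.proj)) ⟨a.proj, φ⟩ z.1.2 := by
      rw [h2]
      exact congrArg (fun l : EM × (F →L[ℝ] ℝ) →L[ℝ] ℝ => l z.1.2) h1
    have h4 : φ (A.bracket (secThrough EM F E a.proj (t • A.baseVec q))
        (secThrough EM F E a.proj z.1.1) a.proj) =
        t * φ (A.bracket (secThrough EM F E a.proj (A.baseVec q))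
          (secThrough EM F E a.proj z.1.1) a.proj) := by
      rw [map_smul, map_smul, LinearMap.smul_apply, ContMDiffSection.coe_smul]
      exact map_smul φ _ _
    have hb : A.baseVec (t • q) = t • A.baseVec q := rfl
    have ha : A.prolAnchor (t • q) = t • A.prolAnchor q := rfl
    have h5 : ∀ f : TotalSpace F E → ℝ, dirDeriv (totModel EM F) f a (t • A.prolAnchor q) =
        t * dirDeriv (totModel EM F) f a (A.prolAnchor q) := fun f =>
      map_smul (mfderiv (totModel EM F) 𝓘(ℝ, ℝ) f a) _ _
    have h6 : ∀ f : M → ℝ, dirDeriv 𝓘(ℝ, EM) f a.proj (A.anchor a.proj (t • A.baseVec q)) =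
        t * dirDeriv 𝓘(ℝ, EM) f a.proj (A.anchor a.proj (A.baseVec q)) := fun f => by
      rw [map_smul]
      exact map_smul (mfderiv 𝓘(ℝ, EM) 𝓘(ℝ, ℝ) f a.proj) _ _
    dsimp only
    rw [hb, ha, h3, h4, h5, h6, RingHom.id_apply, smul_eq_mul]
    ring

end Tulczyjew

/-- A smooth local diffeomorphism `F : W → E*` over the identity of `M`, defined on the open set
`W` of `E` (the values off `W` are irrelevant). -/
structure FibredLocalDiffeo {M : Type*} [TopologicalSpace M] (EM : Type*) [NormedAddCommGroup EM]
    [NormedSpace ℝ EM] [ChartedSpace EM M] (F : Type*) [NormedAddCommGroup F] [NormedSpace ℝ F]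
    (E : M → Type*) [TopologicalSpace (TotalSpace F E)] [∀ x, TopologicalSpace (E x)]
    [∀ x, AddCommGroup (E x)] [∀ x, Module ℝ (E x)] [FiberBundle F E] [VectorBundle ℝ F E]
    (W : Set (TotalSpace F E)) where
  toFun : ∀ a : TotalSpace F E, DualFib E a.proj
  isLocalDiffeo : IsLocalDiffeomorphOn (totModel EM F) (totModel EM (F →L[ℝ] ℝ)) ∞
    (toDualMap (F := F) toFun) W

section Theta

variable [FiniteDimensional ℝ EM] [T2Space M]

open Classical in
/-- The section `Θ_{Γ,F} = A_E ∘ 𝓛F ∘ Γ` of `(𝓛^τ E)*` over the domain `W` of `F`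
(set to `0` off `W`). -/
def Theta {A : LieAlgebroid EM F E} (Γ : A.SODE) {W : Set (TotalSpace F E)}
    (Φ : FibredLocalDiffeo EM F E W) (a : TotalSpace F E) : Module.Dual ℝ (A.prolE a) :=
  if h : a ∈ W then
    A.tulczyjew a (Φ.toFun a)
      (A.prolMap Φ.toFun a ((Φ.isLocalDiffeo ⟨a, h⟩).mdifferentiableAt (by simp)) (Γ.toFun a))
      (Γ.baseVec_eq a)
  else 0

end Theta

end LieAlgebroid
end Algebroid

end

/-!
The inverse problem of the calculus of variations on a regular Lie algebroid.

Everything rests on one comparison in a chart of `M` and a local frame of `E`. There a point of `E`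
is a pair `(x, y)`, an element `z` of the prolongation is a pair `(c, w₂)` with base component
`w₁ = ρ_x c`, and, writing `Γ̂ = (ρ_x y, Γ)` for the vector field of the SODE section, the section
`Θ` reads `Θ(z) = ⟨DF(Γ̂), c⟩ + F(C(c, y)) + F(w₂)` (`Theta_totPt`). The Euler-Lagrange
expression of `L` has the same shape, with `F` replaced by the fibre derivative of `L`, apart from
the term `-dL(w₁)` (`eulerLagrange_totPt`). Hence, if `F` is the Legendre transformation of `L`,
the Euler-Lagrange equation holds along `Γ` exactly when `Θ(z) = dL(ρ^τ z)`.

*From `L` to `F`.* If `L` solves the inverse problem, then `Θ` is the function `z ↦ ρ^τ(z)(L)`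
(`SolvesInverseProblem.Theta_eq`). It vanishes on the kernel of `ρ^τ`, and it is closed because
the bracket of the prolongation lies over the Lie bracket of vector fields, which is the commutator
of derivations (`dirDeriv_mlieBracket`, `closed_of_solutions`). The Legendre transformation of a
regular `L` is a local diffeomorphism by the inverse function theorem
(`isLocalDiffeomorphAt_toDualMap`, `exists_closed_of_solution`).

*From `F` to `L`.* The anchor is a homomorphism of brackets, by the Jacobi identity
(`anchorCoord_bracketCoord`). As it has constant rank, a fixed projection carries its images
at nearby points isomorphically onto one subspace (`exists_splitting_of_constant_rank`). Since
`Θ` vanishes on `Ker ρ^τ`, it descends to a one-form on the image of `ρ^τ`, an involutive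
distribution which, by means of this projection, is spanned near a point by commuting vector
fields. The one-form is closed along it, so it has a primitive `L` there: this is the Poincaré
lemma with parameters along a foliation (`exists_primitive_along`, `exists_primitive_coord`). It is
proved without the Frobenius theorem. Closedness says that the commuting fields `A ξ` remain
commuting when lifted to the fields `(A ξ, θ ξ)` on the product with `ℝ`; their joint flow
(`exists_joint_flow`), started on a transversal at height `0`, sweeps out the graph of `L`. The
joint flow, smooth in the initial point, comes from the inverse function theorem in the Banach
space of continuous curves. Finally `Θ(z) = dL(ρ^τ z)`: for vertical `z` this says that `F` is the
Legendre transformation of `L`, so that the fibre Hessian of `L` is nondegenerate because `F` is a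
local diffeomorphism; for the remaining `z` it is the Euler-Lagrange equation along `Γ`
(`exists_solution_of_closed`).
-/

set_option linter.unusedSectionVars false

noncomputable section

/-! ### Superposition operators on spaces of continuous maps -/

section Superposition

variable {K : Type*} [TopologicalSpace K] [CompactSpace K]

set_option synthInstance.maxHeartbeats 200000 in
/-- Pointwise evaluation of a continuous family of continuous linear maps on a continuous map, as
a continuous bilinear map between spaces of continuous maps. -/
def ContinuousMap.pointwiseApply (K : Type*) [TopologicalSpace K] [CompactSpace K]
    (E F : Type*) [NormedAddCommGroup E] [NormedSpace ℝ E]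
    [NormedAddCommGroup F] [NormedSpace ℝ F] :
    C(K, E →L[ℝ] F) →L[ℝ] C(K, E) →L[ℝ] C(K, F) :=
  LinearMap.mkContinuous₂
    (LinearMap.mk₂ ℝ (fun (g : C(K, E →L[ℝ] F)) (h : C(K, E)) =>
        (⟨fun t => g t (h t), by fun_prop⟩ : C(K, F)))
      (fun _ _ _ => by ext; simp) (fun _ _ _ => by ext; simp)
      (fun _ _ _ => by ext; simp) (fun _ _ _ => by ext; simp)) 1
    (fun g h => by
      rw [one_mul]
      refine (ContinuousMap.norm_le _ (mul_nonneg (norm_nonneg g) (norm_nonneg h))).2 fun t => ?_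
      exact (g t).le_of_opNorm_le_of_le (g.norm_coe_le_norm t) (h.norm_coe_le_norm t))

set_option synthInstance.maxHeartbeats 200000 in
@[simp]
theorem ContinuousMap.pointwiseApply_apply {E F : Type*} [NormedAddCommGroup E] [NormedSpace ℝ E]
    [NormedAddCommGroup F] [NormedSpace ℝ F] (g : C(K, E →L[ℝ] F)) (h : C(K, E)) (t : K) :
    ContinuousMap.pointwiseApply K E F g h t = g t (h t) := rfl

set_option synthInstance.maxHeartbeats 200000 in
theorem ContDiff.hasFDerivAt_postcomp {E F : Type*} [NormedAddCommGroup E] [NormedSpace ℝ E]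
    [NormedAddCommGroup F] [NormedSpace ℝ F] (f : C(E, F)) (f' : C(E, E →L[ℝ] F))
    (hf : ∀ x, HasFDerivAt f (f' x) x) (u : C(K, E)) :
    HasFDerivAt (fun u : C(K, E) => f.comp u)
      (ContinuousMap.pointwiseApply K E F (f'.comp u)) u := by
  rw [hasFDerivAt_iff_isLittleO_nhds_zero, Asymptotics.isLittleO_iff]
  intro c hc
  have hK : IsCompact (range u) := isCompact_range u.continuous
  have hu := hK.uniformContinuousAt_of_continuousAt f' (fun a _ => f'.continuous.continuousAt)
    (Metric.dist_mem_uniformity hc)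
  obtain ⟨δ, hδ, h⟩ := Metric.mem_uniformity_dist.1 hu
  filter_upwards [Metric.ball_mem_nhds (0 : C(K, E)) hδ] with v hv
  have hv' : ‖v‖ < δ := by simpa using hv
  refine (ContinuousMap.norm_le _ (by positivity)).2 fun t => ?_
  have hvt := v.norm_coe_le_norm t
  have key := (convex_ball (u t) δ).norm_image_sub_le_of_norm_hasFDerivWithin_le'
    (f := f) (f' := f') (φ := f' (u t)) (C := c) (x := u t) (y := u t + v t)
    (fun x _ => (hf x).hasFDerivWithinAt)
    (fun x hx => by
      have h2 : Dist.dist (f' (u t)) (f' x) < c :=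
        h (by rw [dist_comm]; exact hx) ⟨t, rfl⟩
      rw [← dist_eq_norm, dist_comm]
      exact h2.le)
    (Metric.mem_ball_self hδ) (by simpa using hvt.trans_lt hv')
  have h3 : ‖f (u t + v t) - f (u t) - f' (u t) (v t)‖ ≤ c * ‖v t‖ := by simpa using key
  change ‖f (u t + v t) - f (u t) - f' (u t) (v t)‖ ≤ _
  exact h3.trans (mul_le_mul_of_nonneg_left hvt hc.le)

universe uE uF in
set_option synthInstance.maxHeartbeats 200000 in
/-- Composition with a smooth map is a smooth operation on continuous maps of a compact space. The
derivative at `u` is the pointwise application of `f' ∘ u`, so that induction applies. -/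
theorem ContDiff.postcomp_continuousMap {E : Type uE} {F : Type (max uE uF)}
    [NormedAddCommGroup E] [NormedSpace ℝ E]
    [NormedAddCommGroup F] [NormedSpace ℝ F] (f : C(E, F)) (hf : ContDiff ℝ ∞ f) :
    ContDiff ℝ ∞ (fun u : C(K, E) => f.comp u) := by
  rw [contDiff_infty]
  intro n
  induction n generalizing F with
  | zero => exact contDiff_zero.2 (ContinuousMap.continuous_postcomp f)
  | succ n ih =>
    let f' : C(E, E →L[ℝ] F) := ⟨fderiv ℝ f, hf.continuous_fderiv (by simp)⟩
    refine contDiff_succ_iff_hasFDerivAt.2 ⟨fun u => ContinuousMap.pointwiseApply K E F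
      (f'.comp u), ?_, ContDiff.hasFDerivAt_postcomp f f' fun x => ?_⟩
    · exact (ContinuousLinearMap.contDiff _).comp
        (ih f' (hf.fderiv_right (m := ∞) (by simp)))
    · exact (hf.differentiable (by simp) x).hasFDerivAt

end Superposition

/-! ### The inverse function theorem on open sets -/

/-- The inverse function theorem in the smooth category: the local inverse is smooth on a whole
neighbourhood. -/
theorem ContDiffOn.exists_openPartialHomeomorph {E F : Type*} [NormedAddCommGroup E]
    [NormedSpace ℝ E] [CompleteSpace E] [NormedAddCommGroup F] [NormedSpace ℝ F]
    {f : E → F} {U : Set E} (hU : IsOpen U) (hf : ContDiffOn ℝ ∞ f U) {a : E} (ha : a ∈ U)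
    (f' : E ≃L[ℝ] F) (hf' : HasFDerivAt f (f' : E →L[ℝ] F) a) :
    ∃ Ψ : OpenPartialHomeomorph E F, (Ψ : E → F) = f ∧ a ∈ Ψ.source ∧ Ψ.source ⊆ U ∧
      ContDiffOn ℝ ∞ Ψ.symm Ψ.target ∧ ∀ x ∈ Ψ.source, ∃ g : E ≃L[ℝ] F, HasFDerivAt f (g : E →L[ℝ] F) x := by
  have hfa : ContDiffAt ℝ ∞ f a := hf.contDiffAt (hU.mem_nhds ha)
  let Ψ₀ := hfa.toOpenPartialHomeomorph f hf' (by simp)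
  have hcont : ContinuousOn (fderiv ℝ f) U := hf.continuousOn_fderiv_of_isOpen hU (by simp)
  let V : Set E := U ∩ fderiv ℝ f ⁻¹' range ((↑) : (E ≃L[ℝ] F) → E →L[ℝ] F)
  have hV : IsOpen V := hcont.isOpen_inter_preimage hU ContinuousLinearEquiv.isOpen
  refine ⟨Ψ₀.restrOpen V hV, rfl, ⟨hfa.mem_toOpenPartialHomeomorph_source hf' (by simp), ha,
    ⟨f', hf'.fderiv.symm⟩⟩, fun x hx => hx.2.1, fun y hy => ContDiffAt.contDiffWithinAt ?_, fun x hx => ?_⟩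
  swap
  · obtain ⟨g, hg⟩ := hx.2.2
    refine ⟨g, ?_⟩
    rw [hg]
    exact ((hf.contDiffAt (hU.mem_nhds hx.2.1)).differentiableAt (by simp)).hasFDerivAt
  have hx := (Ψ₀.restrOpen V hV).map_target hy
  obtain ⟨g, hg⟩ := hx.2.2
  refine (Ψ₀.restrOpen V hV).contDiffAt_symm (f₀' := g) hy ?_ (hf.contDiffAt (hU.mem_nhds hx.2.1))
  rw [hg]
  exact ((hf.contDiffAt (hU.mem_nhds hx.2.1)).differentiableAt (by simp)).hasFDerivAt

/-- A smooth germ is the germ of a globally smooth map. -/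
theorem ContDiffOn.exists_contDiff_eventuallyEq {E F : Type*} [NormedAddCommGroup E]
    [NormedSpace ℝ E] [FiniteDimensional ℝ E] [NormedAddCommGroup F] [NormedSpace ℝ F]
    {f : E → F} {U : Set E} (hU : IsOpen U) (hf : ContDiffOn ℝ ∞ f U) {a : E} (ha : a ∈ U) :
    ∃ g : E → F, ContDiff ℝ ∞ g ∧ g =ᶠ[𝓝 a] f := by
  obtain ⟨r, hr, hrU⟩ := Metric.isOpen_iff.1 hU a ha
  let χ : ContDiffBump a := ⟨r / 4, r / 2, by positivity, by linarith⟩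
  refine ⟨fun x => χ x • f x, contDiff_iff_contDiffAt.2 fun x => ?_, ?_⟩
  · by_cases hx : x ∈ Metric.ball a r
    · exact χ.contDiff.contDiffAt.smul (hf.contDiffAt (hU.mem_nhds (hrU hx)))
    · have h0 : (fun x => χ x • f x) =ᶠ[𝓝 x] fun _ => 0 := by
        have hx' : x ∉ tsupport χ := by
          rw [χ.tsupport_eq]
          intro h
          have h' : Dist.dist x a ≤ r / 2 := h
          exact hx (h'.trans_lt (by linarith))
        filter_upwards [notMem_tsupport_iff_eventuallyEq.1 hx'] with y hy
        rw [hy]; simp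
      exact contDiffAt_const.congr_of_eventuallyEq h0
  · filter_upwards [χ.eventuallyEq_one] with y hy
    rw [hy]; simp

/-! ### Joint flows of commuting vector fields -/

section Flow

open unitInterval

/-- The operator sending a curve `u` on `[0, 1]` to its primitive `t ↦ ∫₀ᵗ u`. -/
def curvePrimitive (H : Type*) [NormedAddCommGroup H] [NormedSpace ℝ H] :
    C(I, H) →L[ℝ] C(I, H) :=
  LinearMap.mkContinuous
    { toFun := fun u => ⟨fun t => ∫ r in (0 : ℝ)..t, u (projIcc 0 1 zero_le_one r), by
        have h : Continuous fun r => u (projIcc 0 1 zero_le_one r) :=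
          u.continuous.comp continuous_projIcc
        exact (intervalIntegral.continuous_primitive (fun _ _ => h.intervalIntegrable _ _) 0).comp
          continuous_subtype_val⟩
      map_add' := fun u v => by
        ext t
        exact intervalIntegral.integral_add
          ((u.continuous.comp continuous_projIcc).intervalIntegrable _ _)
          ((v.continuous.comp continuous_projIcc).intervalIntegrable _ _)
      map_smul' := fun c u => by
        ext t
        exact intervalIntegral.integral_smul c _ } 1
    (fun u => by
      rw [one_mul]
      refine (ContinuousMap.norm_le _ (norm_nonneg _)).2 fun t => ?_
      refine (intervalIntegral.norm_integral_le_of_norm_le_const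
        (fun r _ => u.norm_coe_le_norm _)).trans ?_
      rw [sub_zero, abs_of_nonneg t.2.1]
      exact mul_le_of_le_one_right (norm_nonneg _) t.2.2)

theorem curvePrimitive_apply {H : Type*} [NormedAddCommGroup H] [NormedSpace ℝ H] (u : C(I, H))
    (t : I) : curvePrimitive H u t = ∫ r in (0 : ℝ)..t, u (projIcc 0 1 zero_le_one r) := rfl

/-- Constant curves, as a continuous linear map. -/
def constCurve (H : Type*) [NormedAddCommGroup H] [NormedSpace ℝ H] : H →L[ℝ] C(I, H) :=
  LinearMap.mkContinuous
    { toFun := fun h => ContinuousMap.const I h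
      map_add' := fun _ _ => rfl
      map_smul' := fun _ _ => rfl } 1
    (fun h => by
      rw [one_mul]
      exact (ContinuousMap.norm_le _ (norm_nonneg _)).2 fun t => le_rfl)

@[simp]
theorem constCurve_apply {H : Type*} [NormedAddCommGroup H] [NormedSpace ℝ H] (h : H) (t : I) :
    constCurve H h t = h := rfl

/-- Evaluation of curves at `t`, as a continuous linear map. -/
def curveEval (H : Type*) [NormedAddCommGroup H] [NormedSpace ℝ H] (t : I) : C(I, H) →L[ℝ] H :=
  LinearMap.mkContinuous
    { toFun := fun u => u t
      map_add' := fun _ _ => rfl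
      map_smul' := fun _ _ => rfl } 1
    (fun u => by rw [one_mul]; exact u.norm_coe_le_norm t)

universe uS uH

variable {S : Type uS} [NormedAddCommGroup S] [NormedSpace ℝ S]
  {H : Type uH} [NormedAddCommGroup H] [NormedSpace ℝ H] [CompleteSpace H]

set_option synthInstance.maxHeartbeats 200000 in
/-- If `u` is the integral curve of `A(·) s` from `h`, and the vector fields `A(·) σ` commute along
it, then `V(t) = t A(u(t)) τ` solves the equation of variation of `u` in the direction `τ`. -/
theorem variation_eq_of_commute {A : H → S →L[ℝ] H} (hA : ContDiff ℝ ∞ A) (A₀ : C(H, S →L[ℝ] H))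
    (hA₀ : ∀ x, A₀ x = A x) (A₁ : C(H, H →L[ℝ] S →L[ℝ] H)) (hA₁ : ∀ x, A₁ x = fderiv ℝ A x)
    (s τ : S) (h : H) (u V : C(I, H))
    (hu : u = constCurve H h + curvePrimitive H
      (ContinuousMap.pointwiseApply I S H (A₀.comp u) (constCurve S s)))
    (hV : ∀ t : I, V t = (t : ℝ) • A (u t) τ)
    (hcomm : ∀ t : I, fderiv ℝ A (u t) (A (u t) s) τ = fderiv ℝ A (u t) (A (u t) τ) s) :
    V = curvePrimitive H (ContinuousMap.pointwiseApply I S H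
        (ContinuousMap.pointwiseApply I H (S →L[ℝ] H) (A₁.comp u) V) (constCurve S s)
      + ContinuousMap.pointwiseApply I S H (A₀.comp u) (constCurve S τ)) := by
  -- `a` and `U` extend `A(u) s` and `u` from `[0, 1]` to the line
  set pr : ℝ → I := projIcc 0 1 zero_le_one with hpr
  have hprc : Continuous pr := continuous_projIcc
  let a : ℝ → H := fun r => A (u (pr r)) s
  have ha : Continuous a :=
    ((hA.continuous.comp (u.continuous.comp hprc)).clm_apply continuous_const)
  let U : ℝ → H := fun t => h + ∫ r in (0 : ℝ)..t, a r
  have hU : ∀ t, HasDerivAt U (a t) t := fun t =>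
    (intervalIntegral.integral_hasDerivAt_right (ha.intervalIntegrable _ _)
      (ha.stronglyMeasurableAtFilter _ _) ha.continuousAt).const_add h
  have hUu : ∀ t : I, U t = u t := fun t => by
    conv_rhs => rw [hu]
    simp only [ContinuousMap.add_apply, constCurve_apply, curvePrimitive_apply,
      ContinuousMap.pointwiseApply_apply, ContinuousMap.comp_apply, hA₀]
    rfl
  have hd : ∀ t : ℝ, HasDerivAt (fun t => t • A (U t) τ)
      (A (U t) τ + t • fderiv ℝ A (U t) (a t) τ) t := fun t => by
    have h1 : HasDerivAt (fun t => A (U t)) (fderiv ℝ A (U t) (a t)) t :=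
      ((hA.differentiable (by simp) (U t)).hasFDerivAt).comp_hasDerivAt t (hU t)
    have h2 : HasDerivAt (fun t => A (U t) τ) (fderiv ℝ A (U t) (a t) τ) t := by
      simpa using h1.clm_apply (hasDerivAt_const t τ)
    have h3 := (hasDerivAt_id t).smul h2
    simp only [id, one_smul] at h3
    rw [add_comm] at h3
    exact h3
  have hUc : Continuous U := continuous_iff_continuousAt.2 fun t => (hU t).continuousAt
  have hc : Continuous fun t => A (U t) τ + t • fderiv ℝ A (U t) (a t) τ := by
    have h1 := hA.continuous.comp hUc
    have h2 := (hA.continuous_fderiv (by simp)).comp hUc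
    exact (h1.clm_apply continuous_const).add
      (continuous_id.smul ((h2.clm_apply ha).clm_apply continuous_const))
  ext t
  have key := intervalIntegral.integral_eq_sub_of_hasDerivAt (a := 0) (b := (t : ℝ))
    (fun r _ => hd r) (hc.intervalIntegrable _ _)
  rw [zero_smul, sub_zero, hUu, ← hV] at key
  rw [← key, curvePrimitive_apply]
  refine intervalIntegral.integral_congr fun r hr => ?_
  rw [uIcc_of_le t.2.1] at hr
  have hrI : r ∈ Icc (0 : ℝ) 1 := ⟨hr.1, hr.2.trans t.2.2⟩
  have hr1 : pr r = ⟨r, hrI⟩ := projIcc_of_mem _ hrI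
  have hr2 : U r = u (pr r) := by rw [hr1, ← hUu]
  have hr3 : ((pr r : I) : ℝ) = r := by rw [hr1]
  change A (U r) τ + r • fderiv ℝ A (U r) (A (u (pr r)) s) τ =
    A₁ (u (pr r)) (V (pr r)) s + A₀ (u (pr r)) τ
  rw [hA₁, hA₀, hV, hr2, hr3, hcomm, map_smul, add_comm]
  rfl

/-- The derivative of `((s, h), u) ↦ u - (cH h + J (N(u) · cS s))` for a bilinear product `·` and
linear `J`, `cS`, `cH`. -/
theorem hasFDerivAt_fixedPointMap {S H CS CH CA : Type*} [NormedAddCommGroup S] [NormedSpace ℝ S]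
    [NormedAddCommGroup H] [NormedSpace ℝ H] [NormedAddCommGroup CS] [NormedSpace ℝ CS]
    [NormedAddCommGroup CH] [NormedSpace ℝ CH] [NormedAddCommGroup CA] [NormedSpace ℝ CA]
    (N : CH → CA) (N' : CH →L[ℝ] CA) {x : (S × H) × CH} (hN : HasFDerivAt N N' x.2)
    (B : CA →L[ℝ] CS →L[ℝ] CH) (J : CH →L[ℝ] CH) (cS : S →L[ℝ] CS) (cH : H →L[ℝ] CH) :
    HasFDerivAt (fun x : (S × H) × CH => x.2 - (cH x.1.2 + J (B (N x.2) (cS x.1.1))))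
      (ContinuousLinearMap.snd ℝ _ _ - (cH.comp ((ContinuousLinearMap.snd ℝ S H).comp
        (ContinuousLinearMap.fst ℝ _ _)) + J.comp
      ((B (N x.2)).comp (cS.comp ((ContinuousLinearMap.fst ℝ S H).comp
        (ContinuousLinearMap.fst ℝ _ _))) +
      (B.flip (cS x.1.1)).comp (N'.comp (ContinuousLinearMap.snd ℝ _ _))))) x := by
  have hs : HasFDerivAt (fun x : (S × H) × CH => cS x.1.1)
      (cS.comp ((ContinuousLinearMap.fst ℝ S H).comp (ContinuousLinearMap.fst ℝ (S × H) CH))) x :=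
    cS.hasFDerivAt.comp x (hasFDerivAt_fst.comp x hasFDerivAt_fst)
  have hh : HasFDerivAt (fun x : (S × H) × CH => cH x.1.2)
      (cH.comp ((ContinuousLinearMap.snd ℝ S H).comp (ContinuousLinearMap.fst ℝ (S × H) CH))) x :=
    cH.hasFDerivAt.comp x (hasFDerivAt_snd.comp x hasFDerivAt_fst)
  have hn : HasFDerivAt (fun x : (S × H) × CH => B (N x.2)) _ x :=
    B.hasFDerivAt.comp x (hN.comp x hasFDerivAt_snd)
  exact hasFDerivAt_snd.sub (hh.add (J.hasFDerivAt.comp x (hn.clm_apply hs)))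

/-- The equation `u = cH h + J (N(u) · cS s)` for `u`, with data `(s, h)` near `(0, h₀)`, has a
solution depending smoothly on the data. Its derivative in a direction `(τ, 0)` is characterized by
the linearized equation. -/
theorem exists_contDiffOn_fixedPoint {S H CS CH CA : Type*} [NormedAddCommGroup S]
    [NormedSpace ℝ S] [CompleteSpace S]
    [NormedAddCommGroup H] [NormedSpace ℝ H] [CompleteSpace H]
    [NormedAddCommGroup CS] [NormedSpace ℝ CS] [NormedAddCommGroup CH] [NormedSpace ℝ CH]
    [CompleteSpace CH] [NormedAddCommGroup CA] [NormedSpace ℝ CA]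
    (N : CH → CA) (hN : ContDiff ℝ ∞ N) (B : CA →L[ℝ] CS →L[ℝ] CH) (J : CH →L[ℝ] CH)
    (cS : S →L[ℝ] CS) (cH : H →L[ℝ] CH) (h₀ : H) :
    ∃ (O : Set (S × H)) (u : S × H → CH), IsOpen O ∧ (0, h₀) ∈ O ∧ ContDiffOn ℝ ∞ u O ∧
      u (0, h₀) = cH h₀ ∧ ∀ p ∈ O, u p = cH p.2 + J (B (N (u p)) (cS p.1)) ∧
        ∀ τ V, V = J (B (fderiv ℝ N (u p) V) (cS p.1) + B (N (u p)) (cS τ)) →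
          fderiv ℝ u p (τ, 0) = V := by
  let Q : (S × H) × CH → CH := fun x => x.2 - (cH x.1.2 + J (B (N x.2) (cS x.1.1)))
  let Q' : (S × H) × CH → (S × H) × CH →L[ℝ] CH := fun x =>
    ContinuousLinearMap.snd ℝ _ _ - (cH.comp ((ContinuousLinearMap.snd ℝ S H).comp
        (ContinuousLinearMap.fst ℝ _ _)) + J.comp
      ((B (N x.2)).comp (cS.comp ((ContinuousLinearMap.fst ℝ S H).comp
        (ContinuousLinearMap.fst ℝ _ _))) +
      (B.flip (cS x.1.1)).comp ((fderiv ℝ N x.2).comp (ContinuousLinearMap.snd ℝ _ _))))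
  have hQ : ContDiff ℝ ∞ Q := by
    have h1 : ContDiff ℝ ∞ (fun x : (S × H) × CH => B (N x.2) (cS x.1.1)) :=
      (B.contDiff.comp (hN.comp contDiff_snd)).clm_apply
        (cS.contDiff.comp (contDiff_fst.comp contDiff_fst))
    exact contDiff_snd.sub ((cH.contDiff.comp (contDiff_snd.comp contDiff_fst)).add
      (J.contDiff.comp h1))
  have hQ' : ∀ x, HasFDerivAt Q (Q' x) x := fun x =>
    hasFDerivAt_fixedPointMap N _ (hN.differentiable (by simp) x.2).hasFDerivAt B J cS cH
  let K : (S × H) × CH → (S × H) × CH := fun x => (x.1, Q x)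
  have hK : ContDiff ℝ ∞ K := contDiff_fst.prodMk hQ
  have hK' : ∀ x, HasFDerivAt K ((ContinuousLinearMap.fst ℝ _ _).prod (Q' x)) x := fun x =>
    hasFDerivAt_fst.prodMk (hQ' x)
  let x₀ : (S × H) × CH := ((0, h₀), cH h₀)
  -- the term of the linearization in `N'` drops out at `s = 0`, so it is triangular, hence invertible
  let T : S × H →L[ℝ] CH := -(cH.comp (ContinuousLinearMap.snd ℝ S H) +
    J.comp ((B (N x₀.2)).comp (cS.comp (ContinuousLinearMap.fst ℝ S H))))
  let e : ((S × H) × CH) ≃L[ℝ] ((S × H) × CH) :=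
    (ContinuousLinearEquiv.refl ℝ (S × H)).skewProd (ContinuousLinearEquiv.refl ℝ CH) T
  have he : HasFDerivAt K (e : (S × H) × CH →L[ℝ] (S × H) × CH) x₀ := by
    convert hK' x₀ using 1
    refine ContinuousLinearMap.ext fun x => Prod.ext rfl ?_
    change x.2 + T x.1 = x.2 - (cH x.1.2 + J (B (N x₀.2) (cS x.1.1) +
        B (fderiv ℝ N x₀.2 x.2) (cS 0)))
    rw [map_zero, map_zero, add_zero, sub_eq_add_neg]
    rfl
  obtain ⟨Ψ, hΨ, hx₀, -, hΨs, hΨi⟩ := hK.contDiffOn.exists_openPartialHomeomorph isOpen_univ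
    (mem_univ x₀) e he
  have hQ0 : Q x₀ = 0 := by
    change cH h₀ - (cH h₀ + J (B _ (cS 0))) = 0
    rw [map_zero, map_zero, map_zero, add_zero, sub_self]
  let ι : S × H → (S × H) × CH := fun p => (p, 0)
  have hι : ContDiff ℝ ∞ ι := contDiff_id.prodMk contDiff_const
  let u : S × H → CH := fun p => (Ψ.symm (ι p)).2
  let O₁ : Set (S × H) := ι ⁻¹' Ψ.target
  have hO₁ : IsOpen O₁ := Ψ.open_target.preimage hι.continuous
  have hu : ContDiffOn ℝ ∞ u O₁ := contDiff_snd.comp_contDiffOn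
    (hΨs.comp hι.contDiffOn fun p hp => hp)
  have hsymm : ∀ p ∈ O₁, Ψ.symm (ι p) = (p, u p) ∧ Q (p, u p) = 0 := fun p hp => by
    have h1 : K (Ψ.symm (ι p)) = ι p := by rw [← hΨ]; exact Ψ.right_inv hp
    have h2 : Ψ.symm (ι p) = (p, u p) := by
      have h3 : (Ψ.symm (ι p)).1 = p := congrArg Prod.fst h1
      exact Prod.ext h3 rfl
    rw [h2] at h1
    exact ⟨h2, congrArg Prod.snd h1⟩
  have h1 : ι (0, h₀) = Ψ x₀ := by rw [hΨ]; exact Prod.ext rfl hQ0.symm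
  refine ⟨O₁, u, hO₁, ?_, hu, ?_, fun p hp => ⟨sub_eq_zero.1 (hsymm p hp).2, fun τ V hV => ?_⟩⟩
  · change ι (0, h₀) ∈ Ψ.target
    rw [h1]
    exact Ψ.map_source hx₀
  · change (Ψ.symm (ι (0, h₀))).2 = _
    rw [h1, Ψ.left_inv hx₀]
  · -- `V` and the derivative of `u` solve the same linear equation, which has one solution
    have hup : HasFDerivAt u (fderiv ℝ u p) p :=
      ((hu.contDiffAt (hO₁.mem_nhds hp)).differentiableAt (by simp)).hasFDerivAt
    have hV' : Q' (p, u p) ((τ, 0), V) = 0 := by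
      change V - (cH 0 + J (B (N (u p)) (cS τ) + B (fderiv ℝ N (u p) V) (cS p.1))) = 0
      rw [map_zero, zero_add, add_comm, sub_eq_zero]
      exact hV
    have hW' : Q' (p, u p) ((τ, 0), fderiv ℝ u p (τ, 0)) = 0 := by
      have h1 : HasFDerivAt (fun p => Q (p, u p)) ((Q' (p, u p)).comp
          ((ContinuousLinearMap.id ℝ _).prod (fderiv ℝ u p))) p :=
        HasFDerivAt.comp (g := Q) (f := fun p => (p, u p)) p (hQ' (p, u p))
          ((hasFDerivAt_id p).prodMk hup)
      have h2 : (fun p => Q (p, u p)) =ᶠ[𝓝 p] fun _ => 0 := by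
        filter_upwards [hO₁.mem_nhds hp] with q hq using (hsymm q hq).2
      have h3 := h1.unique ((hasFDerivAt_const (0 : CH) p).congr_of_eventuallyEq h2)
      exact DFunLike.congr_fun h3 (τ, 0)
    obtain ⟨g, hg⟩ := hΨi (p, u p) (by
      rw [← (hsymm p hp).1]
      exact Ψ.map_target hp)
    have hg' := hg.unique (hK' _)
    have hVW : (((τ, 0), V) : (S × H) × CH) = ((τ, 0), fderiv ℝ u p (τ, 0)) := by
      apply g.injective
      have h1 : ∀ x, g x = (x.1, Q' (p, u p) x) := fun x => DFunLike.congr_fun hg' x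
      rw [h1, h1, hV', hW']
    exact (congrArg Prod.snd hVW).symm

set_option synthInstance.maxHeartbeats 200000 in
set_option maxHeartbeats 1000000 in
/-- Frobenius' theorem in parametric form: vector fields `A(·) ξ`, linear in `ξ ∈ S`, which commute
near `h₀` have a smooth joint flow `Φ(s, h)`, with `∂Φ/∂s = A(Φ)` and `Φ(0, h) = h`. The flow at
`(s, h)` is the endpoint of the integral curve of `A(·) s` from `h`. -/
theorem exists_joint_flow [CompleteSpace S] {A : H → S →L[ℝ] H} (hA : ContDiff ℝ ∞ A)
    {U : Set H} (hU : IsOpen U) {h₀ : H} (h₀U : h₀ ∈ U)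
    (hcomm : ∀ h ∈ U, ∀ ξ τ, fderiv ℝ A h (A h ξ) τ = fderiv ℝ A h (A h τ) ξ) :
    ∃ (O : Set (S × H)) (Φ : S × H → H), IsOpen O ∧ (0, h₀) ∈ O ∧ ContDiffOn ℝ ∞ Φ O ∧
      (∀ p ∈ O, p.1 = 0 → Φ p = p.2) ∧
      ∀ p ∈ O, Φ p ∈ U ∧ ∀ τ, fderiv ℝ Φ p (τ, 0) = A (Φ p) τ := by
  let A₀ : C(H, S →L[ℝ] H) := ⟨A, hA.continuous⟩
  let A₁ : C(H, H →L[ℝ] S →L[ℝ] H) := ⟨fderiv ℝ A, hA.continuous_fderiv (by simp)⟩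
  have hN : ContDiff ℝ ∞ (fun u : C(I, H) => A₀.comp u) := ContDiff.postcomp_continuousMap A₀ hA
  have hN' : ∀ u : C(I, H), fderiv ℝ (fun u : C(I, H) => A₀.comp u) u =
      ContinuousMap.pointwiseApply I H (S →L[ℝ] H) (A₁.comp u) := fun u =>
    (ContDiff.hasFDerivAt_postcomp A₀ A₁
      (fun x => (hA.differentiable (by simp) x).hasFDerivAt) u).fderiv
  obtain ⟨O₁, u, hO₁, h0, hu, hu0, hp⟩ := exists_contDiffOn_fixedPoint _ hN
    (ContinuousMap.pointwiseApply I S H) (curvePrimitive H) (constCurve S) (constCurve H) h₀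
  let N : Set C(I, H) := {v | MapsTo v univ U}
  have hNo : IsOpen N := ContinuousMap.isOpen_setOfPred_mapsTo isCompact_univ hU
  refine ⟨O₁ ∩ u ⁻¹' N, fun p => u p 1, hu.continuousOn.isOpen_inter_preimage hO₁ hNo,
    ⟨h0, ?_⟩, ?_, ?_, ?_⟩
  · change MapsTo (u (0, h₀)) univ U
    rw [hu0]
    exact fun t _ => h₀U
  · exact (curveEval H 1).contDiff.comp_contDiffOn (hu.mono inter_subset_left)
  · rintro ⟨s, h⟩ ⟨hpO, -⟩ (rfl : s = 0)
    have h1 := (hp _ hpO).1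
    rw [map_zero, map_zero, map_zero, add_zero] at h1
    change u (0, h) 1 = h
    rw [h1]
    rfl
  · rintro p ⟨hpO, hpN⟩
    refine ⟨hpN (mem_univ 1), fun τ => ?_⟩
    have hup : HasFDerivAt u (fderiv ℝ u p) p :=
      ((hu.contDiffAt (hO₁.mem_nhds hpO)).differentiableAt (by simp)).hasFDerivAt
    have hend : HasFDerivAt (fun p => u p 1) ((curveEval H 1).comp (fderiv ℝ u p)) p :=
      (curveEval H 1).hasFDerivAt.comp p hup
    rw [hend.fderiv]
    let V : C(I, H) := ⟨fun t => (t : ℝ) • A (u p t) τ, by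
      have h1 := hA.continuous.comp (u p).continuous
      exact continuous_subtype_val.smul (h1.clm_apply continuous_const)⟩
    have hV := variation_eq_of_commute hA A₀ (fun _ => rfl) A₁ (fun _ => rfl) p.1 τ p.2 (u p) V
      (hp p hpO).1 (fun _ => rfl) (fun t => hcomm _ (hpN (mem_univ t)) _ _)
    rw [← hN'] at hV
    change (fderiv ℝ u p (τ, 0)) 1 = A (u p 1) τ
    rw [(hp p hpO).2 τ V hV]
    exact one_smul ℝ _

end Flow

/-! ### The Poincaré lemma along a distribution -/

section Poincare

universe uS uH

/-- The Poincaré lemma along the distribution spanned by commuting vector fields `A(·) ξ`: a form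
`θ` on the distribution which is closed along it is the differential of a function along it. The
graph of a primitive is a leaf of the distribution spanned by the fields `(A ξ, θ ξ)` on `H × ℝ`,
so the primitive is read off from their joint flow. -/
theorem exists_primitive_along {S : Type uS} [NormedAddCommGroup S] [NormedSpace ℝ S]
    [CompleteSpace S] {H : Type uH} [NormedAddCommGroup H] [NormedSpace ℝ H]
    [FiniteDimensional ℝ H] {A : H → S →L[ℝ] H} {θ : H → S →L[ℝ] ℝ} {U : Set H}
    (hU : IsOpen U) {h₀ : H} (h₀U : h₀ ∈ U) (hA : ContDiffOn ℝ ∞ A U) (hθ : ContDiffOn ℝ ∞ θ U)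
    (pr : H →L[ℝ] S) (hpr : ∀ ξ, pr (A h₀ ξ) = ξ)
    (hAc : ∀ h ∈ U, ∀ ξ τ, fderiv ℝ A h (A h ξ) τ = fderiv ℝ A h (A h τ) ξ)
    (hθc : ∀ h ∈ U, ∀ ξ τ, fderiv ℝ θ h (A h ξ) τ = fderiv ℝ θ h (A h τ) ξ) :
    ∃ (V : Set H) (f : H → ℝ), IsOpen V ∧ h₀ ∈ V ∧ V ⊆ U ∧ ContDiffOn ℝ ∞ f V ∧
      ∀ h ∈ V, ∀ ξ, fderiv ℝ f h (A h ξ) = θ h ξ := by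
  have : CompleteSpace H := FiniteDimensional.complete ℝ H
  obtain ⟨A₁, hA₁, hAA⟩ := hA.exists_contDiff_eventuallyEq hU h₀U
  obtain ⟨θ₁, hθ₁, hθθ⟩ := hθ.exists_contDiff_eventuallyEq hU h₀U
  obtain ⟨U₁, hU₁s, hU₁, h₀U₁⟩ := mem_nhds_iff.1 ((hAA.and hθθ).and (hU.mem_nhds h₀U))
  let B : H × ℝ → S →L[ℝ] H × ℝ := fun x => (A₁ x.1).prod (θ₁ x.1)
  have hB : ContDiff ℝ ∞ B := by
    have h1 := (ContinuousLinearMap.prodₗᵢ (𝕜 := ℝ) (E := S) (F := H) (G := ℝ) ℝ).contDiff (n := ∞)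
    exact h1.comp ((hA₁.comp contDiff_fst).prodMk (hθ₁.comp contDiff_fst))
  have hB' : ∀ x : H × ℝ, ∀ v τ, fderiv ℝ B x v τ = (fderiv ℝ A₁ x.1 v.1 τ, fderiv ℝ θ₁ x.1 v.1 τ) := by
    intro x v τ
    have h1 : HasFDerivAt (fun x : H × ℝ => A₁ x.1) _ x :=
      (hA₁.differentiable (by simp) x.1).hasFDerivAt.comp x hasFDerivAt_fst
    have h2 : HasFDerivAt (fun x : H × ℝ => θ₁ x.1) _ x :=
      (hθ₁.differentiable (by simp) x.1).hasFDerivAt.comp x hasFDerivAt_fst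
    have h3 : fderiv ℝ (fun x => B x τ) x v = fderiv ℝ B x v τ := by
      have := ((hB.differentiable (by simp) x).hasFDerivAt.clm_apply (hasFDerivAt_const τ x)).fderiv
      rw [this]; simp
    have h4 := ((h1.clm_apply (hasFDerivAt_const τ x)).prodMk
      (h2.clm_apply (hasFDerivAt_const τ x))).fderiv
    rw [← h3]
    refine (DFunLike.congr_fun h4 v).trans ?_
    simp
  have hev : ∀ h ∈ U₁, A₁ h = A h ∧ θ₁ h = θ h ∧ fderiv ℝ A₁ h = fderiv ℝ A h ∧
      fderiv ℝ θ₁ h = fderiv ℝ θ h ∧ h ∈ U := fun h hh => by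
    have h1 : A₁ =ᶠ[𝓝 h] A := by
      filter_upwards [hU₁.mem_nhds hh] with y hy using (hU₁s hy).1.1
    have h2 : θ₁ =ᶠ[𝓝 h] θ := by
      filter_upwards [hU₁.mem_nhds hh] with y hy using (hU₁s hy).1.2
    exact ⟨h1.eq_of_nhds, h2.eq_of_nhds, h1.fderiv_eq, h2.fderiv_eq, (hU₁s hh).2⟩
  obtain ⟨O, Φ, hO, h0O, hΦ, hΦ0, hΦd⟩ := exists_joint_flow hB (U := U₁ ×ˢ univ)
    (hU₁.prod isOpen_univ) (h₀ := (h₀, (0 : ℝ))) ⟨h₀U₁, mem_univ _⟩ (by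
      rintro ⟨h, r⟩ ⟨hh, -⟩ ξ τ
      obtain ⟨e1, e2, e3, e4, hhU⟩ := hev h hh
      rw [hB', hB']
      change (fderiv ℝ A₁ h (A₁ h ξ) τ, fderiv ℝ θ₁ h (A₁ h ξ) τ) =
        (fderiv ℝ A₁ h (A₁ h τ) ξ, fderiv ℝ θ₁ h (A₁ h τ) ξ)
      rw [e1, e3, e4, hAc h hhU, hθc h hhU])
  -- the flow out of the transversal `h₀ + ker pr`, on which the primitive is to vanish
  let Z := LinearMap.ker pr.toLinearMap
  let ι : S × Z → S × (H × ℝ) := fun x => (x.1, (h₀ + x.2, 0))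
  have hι : ContDiff ℝ ∞ ι := contDiff_fst.prodMk
    ((contDiff_const.add (Z.subtypeL.contDiff.comp contDiff_snd)).prodMk contDiff_const)
  let O' : Set (S × Z) := ι ⁻¹' O
  have hO' : IsOpen O' := hO.preimage hι.continuous
  have h0O' : (0 : S × Z) ∈ O' := by
    change (0, (h₀ + ((0 : Z) : H), (0 : ℝ))) ∈ O
    simpa using h0O
  let P : S × Z → H := fun x => (Φ (ι x)).1
  let g : S × Z → ℝ := fun x => (Φ (ι x)).2
  have hΦι : ContDiffOn ℝ ∞ (fun x => Φ (ι x)) O' := hΦ.comp hι.contDiffOn fun _ hx => hx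
  have hP : ContDiffOn ℝ ∞ P O' := contDiff_fst.comp_contDiffOn hΦι
  have hg : ContDiffOn ℝ ∞ g O' := contDiff_snd.comp_contDiffOn hΦι
  have hder : ∀ x ∈ O', ∀ τ, fderiv ℝ P x (τ, 0) = A₁ (P x) τ ∧
      fderiv ℝ g x (τ, 0) = θ₁ (P x) τ := by
    intro x hx τ
    have h1 : HasFDerivAt Φ (fderiv ℝ Φ (ι x)) (ι x) :=
      ((hΦ.contDiffAt (hO.mem_nhds hx)).differentiableAt (by simp)).hasFDerivAt
    have h2 : HasFDerivAt ι ((ContinuousLinearMap.fst ℝ S Z).prod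
        ((Z.subtypeL.comp (ContinuousLinearMap.snd ℝ S Z)).prod 0)) x :=
      hasFDerivAt_fst.prodMk (((Z.subtypeL.hasFDerivAt.comp x hasFDerivAt_snd).const_add
        h₀).prodMk (hasFDerivAt_const _ _))
    have h3 := h1.comp x h2
    have h4 : HasFDerivAt P _ x := hasFDerivAt_fst.comp x h3
    have h5 : HasFDerivAt g _ x := hasFDerivAt_snd.comp x h3
    rw [h4.fderiv, h5.fderiv]
    have h6 := (hΦd (ι x) hx).2 τ
    refine ⟨congrArg Prod.fst h6, congrArg Prod.snd h6⟩
  have hP0 : P 0 = h₀ := by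
    have := hΦ0 _ h0O' rfl
    change (Φ (ι 0)).1 = h₀
    rw [this]
    change h₀ + ((0 : Z) : H) = h₀
    simp
  have hPz : ∀ z : Z, fderiv ℝ P 0 (0, z) = z := by
    intro z
    have h1 : HasFDerivAt P (fderiv ℝ P 0) ((0 : S), (0 : Z)) :=
      ((hP.contDiffAt (hO'.mem_nhds h0O')).differentiableAt (by simp)).hasFDerivAt
    have h2 : HasFDerivAt (fun z : Z => P (0, z)) _ 0 :=
      h1.comp (0 : Z) ((hasFDerivAt_const (0 : S) (0 : Z)).prodMk (hasFDerivAt_id 0))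
    have h3 : (fun z : Z => P (0, z)) =ᶠ[𝓝 0] fun z => h₀ + (z : H) := by
      have hc : Continuous fun z : Z => ((0 : S), z) := by fun_prop
      filter_upwards [(hO'.preimage hc).mem_nhds h0O'] with z hz
      have := hΦ0 _ hz rfl
      change (Φ (ι (0, z))).1 = _
      rw [this]
    have h4 := (h2.congr_of_eventuallyEq h3.symm).unique
      (Z.subtypeL.hasFDerivAt.const_add h₀)
    exact DFunLike.congr_fun h4 z
  have e0 := hev h₀ h₀U₁
  have hPd : ∀ ξ : S, ∀ z : Z, fderiv ℝ P 0 (ξ, z) = A h₀ ξ + z := by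
    intro ξ z
    have : ((ξ, z) : S × Z) = (ξ, 0) + (0, z) := by simp
    rw [this, map_add, (hder 0 h0O' ξ).1, hPz, hP0, e0.1]
  let e : (S × Z) ≃L[ℝ] H := ContinuousLinearEquiv.equivOfInverse (fderiv ℝ P 0)
    (pr.prod ((ContinuousLinearMap.id ℝ H - (A h₀).comp pr).codRestrict Z (fun h => by
      change pr (h - A h₀ (pr h)) = 0
      rw [map_sub, hpr, sub_self])))
    (by
      rintro ⟨ξ, z⟩
      have hz : pr (z : H) = 0 := z.2
      rw [hPd]
      refine Prod.ext ?_ (Subtype.ext ?_)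
      · change pr (A h₀ ξ + z) = ξ
        rw [map_add, hpr, hz, add_zero]
      · change A h₀ ξ + z - A h₀ (pr (A h₀ ξ + z)) = z
        rw [map_add, hpr, hz, add_zero, add_sub_cancel_left])
    (by
      intro h
      refine (hPd _ _).trans ?_
      change A h₀ (pr h) + (h - A h₀ (pr h)) = h
      abel)
  obtain ⟨Ψ, hΨ, h0Ψ, hΨO, hΨs, -⟩ := hP.exists_openPartialHomeomorph hO' h0O' e
    ((hP.contDiffAt (hO'.mem_nhds h0O')).differentiableAt (by simp)).hasFDerivAt
  have hsub : ∀ h ∈ Ψ.target, Ψ.symm h ∈ O' ∧ P (Ψ.symm h) = h := fun h hh =>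
    ⟨hΨO (Ψ.map_target hh), by rw [← hΨ]; exact Ψ.right_inv hh⟩
  have hin : ∀ h ∈ Ψ.target, h ∈ U₁ := fun h hh => by
    have h1 := (hΦd _ (hsub h hh).1).1.1
    have h2 : P (Ψ.symm h) ∈ U₁ := h1
    rwa [(hsub h hh).2] at h2
  have hf : ContDiffOn ℝ ∞ (fun h => g (Ψ.symm h)) Ψ.target :=
    hg.comp hΨs fun h hh => (hsub h hh).1
  refine ⟨Ψ.target, fun h => g (Ψ.symm h), Ψ.open_target, ?_, fun h hh => (hU₁s (hin h hh)).2,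
    hf, fun h hh ξ => ?_⟩
  · rw [← hP0, ← hΨ]
    exact Ψ.map_source h0Ψ
  · set x := Ψ.symm h with hx
    have hxO := (hsub h hh).1
    have hPx : P x = h := (hsub h hh).2
    have h1 : HasFDerivAt (fun h => g (Ψ.symm h)) (fderiv ℝ (fun h => g (Ψ.symm h)) h) (P x) := by
      rw [hPx]
      exact ((hf.contDiffAt (Ψ.open_target.mem_nhds hh)).differentiableAt (by simp)).hasFDerivAt
    have h2 : HasFDerivAt P (fderiv ℝ P x) x :=
      ((hP.contDiffAt (hO'.mem_nhds hxO)).differentiableAt (by simp)).hasFDerivAt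
    have h3 : HasFDerivAt g (fderiv ℝ g x) x :=
      ((hg.contDiffAt (hO'.mem_nhds hxO)).differentiableAt (by simp)).hasFDerivAt
    have h4 : (fun y => g (Ψ.symm (P y))) =ᶠ[𝓝 x] g := by
      filter_upwards [Ψ.open_source.mem_nhds (Ψ.map_target hh)] with y hy
      rw [← hΨ, Ψ.left_inv hy]
    have h5 := ((h1.comp x h2).congr_of_eventuallyEq h4.symm).unique h3
    have h6 := DFunLike.congr_fun h5 (ξ, 0)
    rw [ContinuousLinearMap.comp_apply, (hder x hxO ξ).1, (hder x hxO ξ).2, hPx] at h6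
    obtain ⟨e1, e2, -, -, -⟩ := hev h (hin h hh)
    rw [← e1, ← e2]
    exact h6

end Poincare

/-! ### Derivatives, vector fields and Lie brackets in a fixed chart -/

section FixedChart

variable {EN HN N : Type*} [NormedAddCommGroup EN] [NormedSpace ℝ EN] [TopologicalSpace HN]
  {J : ModelWithCorners ℝ EN HN} [TopologicalSpace N] [ChartedSpace HN N]

variable (J) in
/-- The components of a tangent vector at `p` in the chart at `p₀`. -/
def tangentCoord (p₀ p : N) : TangentSpace J p →L[ℝ] EN :=
  mfderiv J 𝓘(ℝ, EN) (extChartAt J p₀) p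

variable (J) in
/-- The tangent vector at `p` with given components in the chart at `p₀`. -/
def ofTangentCoord (p₀ p : N) : EN →L[ℝ] TangentSpace J p :=
  (tangentCoord J p₀ p).inverse

variable [IsManifold J ∞ N]

theorem isInvertible_tangentCoord {p₀ p : N} (hp : p ∈ (extChartAt J p₀).source) :
    (tangentCoord J p₀ p).IsInvertible := by
  have : IsManifold J 1 N := IsManifold.of_le (n := ∞) (by simp)
  exact isInvertible_mfderiv_extChartAt hp

theorem tangentCoord_ofTangentCoord {p₀ p : N} (hp : p ∈ (extChartAt J p₀).source) (u : EN) :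
    tangentCoord J p₀ p (ofTangentCoord J p₀ p u) = u :=
  (isInvertible_tangentCoord hp).self_apply_inverse u

theorem tangentCoord_injective {p₀ p : N} (hp : p ∈ (extChartAt J p₀).source) :
    Function.Injective (tangentCoord J p₀ p) :=
  (isInvertible_tangentCoord hp).injective

theorem hasMFDerivAt_extChartAt_tangentCoord {p₀ p : N} (hp : p ∈ (extChartAt J p₀).source) :
    HasMFDerivAt J 𝓘(ℝ, EN) (extChartAt J p₀) p (tangentCoord J p₀ p) := by
  have : IsManifold J 1 N := IsManifold.of_le (n := ∞) (by simp)
  exact (mdifferentiableAt_extChartAt (by rwa [extChartAt_source] at hp)).hasMFDerivAt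

theorem contMDiffOn_vectorField_iff {p₀ : N} {V : Set N} (hV : IsOpen V)
    (hVs : V ⊆ (extChartAt J p₀).source) (w : ∀ q : N, TangentSpace J q) :
    ContMDiffOn J J.tangent ∞ (fun q => (⟨q, w q⟩ : TangentBundle J N)) V ↔
      ContMDiffOn J 𝓘(ℝ, EN) ∞ (fun q => tangentCoord J p₀ q (w q)) V := by
  rw [extChartAt_source] at hVs
  have : IsManifold J 1 N := IsManifold.of_le (n := ∞) (by simp)
  have := (trivializationAt EN (TangentSpace J) p₀).contMDiffOn_section_iff (IB := J) (n := ∞)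
    (s := w) hV (by rwa [TangentBundle.trivializationAt_baseSet])
  refine this.trans (contMDiffOn_congr fun q hq => ?_)
  have h1 := TangentBundle.continuousLinearMapAt_trivializationAt (I := J) (hVs hq)
  have hb : q ∈ (trivializationAt EN (TangentSpace J) p₀).baseSet := by
    rw [TangentBundle.trivializationAt_baseSet]; exact hVs hq
  have h2 := (trivializationAt EN (TangentSpace J) p₀).coe_linearMapAt_of_mem (R := ℝ) hb
  have h3 := congrArg (fun l : TangentSpace J q →L[ℝ] EN => l (w q)) h1
  refine Eq.trans ?_ h3
  exact (congrFun h2 (w q)).symm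

variable [J.Boundaryless]

theorem hasMFDerivAt_extChartAt_symm {p₀ : N} {y : EN} (hy : y ∈ (extChartAt J p₀).target) :
    HasMFDerivAt 𝓘(ℝ, EN) J (extChartAt J p₀).symm y
      (ofTangentCoord J p₀ ((extChartAt J p₀).symm y)) := by
  have : IsManifold J 1 N := IsManifold.of_le (n := ∞) (by simp)
  have h1 : MDifferentiableAt 𝓘(ℝ, EN) J (extChartAt J p₀).symm y := by
    have := mdifferentiableWithinAt_extChartAt_symm hy
    rwa [J.range_eq_univ, mdifferentiableWithinAt_univ] at this
  have hp := (extChartAt J p₀).map_target hy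
  have h2 := (hasMFDerivAt_extChartAt_tangentCoord hp).comp y h1.hasMFDerivAt
  have h3 : HasMFDerivAt 𝓘(ℝ, EN) 𝓘(ℝ, EN) (extChartAt J p₀ ∘ (extChartAt J p₀).symm) y
      (ContinuousLinearMap.id ℝ EN) := by
    refine (hasMFDerivAt_id y).congr_of_eventuallyEq ?_
    filter_upwards [(isOpen_extChartAt_target p₀).mem_nhds hy] with z hz
      using (extChartAt J p₀).right_inv hz
  have h4 := hasMFDerivAt_unique h2 h3
  have h5 : mfderiv 𝓘(ℝ, EN) J (extChartAt J p₀).symm y =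
      ofTangentCoord J p₀ ((extChartAt J p₀).symm y) := by
    ext u
    apply tangentCoord_injective hp
    exact (DFunLike.congr_fun h4 u).trans (tangentCoord_ofTangentCoord hp (u : EN)).symm
  rw [← h5]
  exact h1.hasMFDerivAt

theorem differentiableAt_comp_extChartAt_symm {p₀ p : N} (hp : p ∈ (extChartAt J p₀).source)
    {f : N → ℝ} (hf : MDifferentiableAt J 𝓘(ℝ, ℝ) f p) :
    DifferentiableAt ℝ (f ∘ (extChartAt J p₀).symm) (extChartAt J p₀ p) := by
  have hy := (extChartAt J p₀).map_source hp
  rw [← (extChartAt J p₀).left_inv hp] at hf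
  exact (hf.comp _ (hasMFDerivAt_extChartAt_symm hy).mdifferentiableAt).differentiableAt

/-- A directional derivative, computed in the chart at `p₀`. -/
theorem dirDeriv_eq_fderiv {p₀ p : N} (hp : p ∈ (extChartAt J p₀).source) {f : N → ℝ}
    (hf : MDifferentiableAt J 𝓘(ℝ, ℝ) f p) (v : TangentSpace J p) :
    dirDeriv J f p v = fderiv ℝ (f ∘ (extChartAt J p₀).symm) (extChartAt J p₀ p)
      (tangentCoord J p₀ p v) := by
  have hd := (differentiableAt_comp_extChartAt_symm hp hf).hasFDerivAt.hasMFDerivAt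
  have h1 := hd.comp p (hasMFDerivAt_extChartAt_tangentCoord hp)
  have h2 : HasMFDerivAt J 𝓘(ℝ, ℝ) f p _ := h1.congr_of_eventuallyEq (by
    filter_upwards [(isOpen_extChartAt_source (I := J) p₀).mem_nhds hp] with q hq
    exact congrArg f ((extChartAt J p₀).left_inv hq).symm)
  unfold dirDeriv
  rw [h2.mfderiv]
  rfl

/-- The Lie bracket of vector fields, computed in the chart at `p₀`. -/
theorem tangentCoord_mlieBracket [CompleteSpace EN] {p₀ p : N} (hp : p ∈ (extChartAt J p₀).source)
    {V W : ∀ q : N, TangentSpace J q}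
    (hV : MDifferentiableAt J J.tangent (fun q => (⟨q, V q⟩ : TangentBundle J N)) p)
    (hW : MDifferentiableAt J J.tangent (fun q => (⟨q, W q⟩ : TangentBundle J N)) p) :
    tangentCoord J p₀ p (VectorField.mlieBracket J V W p) =
      VectorField.lieBracket ℝ
        (fun y => tangentCoord J p₀ _ (V ((extChartAt J p₀).symm y)))
        (fun y => tangentCoord J p₀ _ (W ((extChartAt J p₀).symm y))) (extChartAt J p₀ p) := by
  obtain ⟨y, hy, rfl⟩ : ∃ y ∈ (extChartAt J p₀).target, p = (extChartAt J p₀).symm y :=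
    ⟨_, (extChartAt J p₀).map_source hp, ((extChartAt J p₀).left_inv hp).symm⟩
  have : IsManifold J (minSmoothness ℝ 3) N := IsManifold.of_le (n := ∞) (by
    rw [minSmoothness_of_isRCLikeNormedField]; exact ENat.LEInfty.out)
  have hs : ContMDiffAt 𝓘(ℝ, EN) J ∞ (extChartAt J p₀).symm y :=
    (contMDiffOn_extChartAt_symm p₀).contMDiffAt ((isOpen_extChartAt_target p₀).mem_nhds hy)
  have key := VectorField.mpullback_mlieBracket (I := 𝓘(ℝ, EN)) (I' := J) hV hW hs (by
    rw [minSmoothness_of_isRCLikeNormedField]; exact ENat.LEInfty.out)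
  have hpull : ∀ (U : ∀ q : N, TangentSpace J q), ∀ z ∈ (extChartAt J p₀).target,
      VectorField.mpullback 𝓘(ℝ, EN) J (extChartAt J p₀).symm U z =
        tangentCoord J p₀ _ (U ((extChartAt J p₀).symm z)) := by
    intro U z hz
    rw [VectorField.mpullback_apply, (hasMFDerivAt_extChartAt_symm hz).mfderiv]
    have hz' := (extChartAt J p₀).map_target hz
    exact congrArg (fun l : TangentSpace J _ →L[ℝ] EN => l (U ((extChartAt J p₀).symm z)))
      (isInvertible_tangentCoord hz').inverse_inverse
  rw [hpull _ y hy] at key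
  have hmodel : ∀ (V W : ∀ z : EN, TangentSpace 𝓘(ℝ, EN) z) (z : EN),
      VectorField.mlieBracket 𝓘(ℝ, EN) V W z = VectorField.lieBracket ℝ (V : EN → EN) W z := by
    intro V W z
    rw [← VectorField.mlieBracketWithin_univ, VectorField.mlieBracketWithin_eq_lieBracketWithin]
    exact congrFun VectorField.lieBracketWithin_univ z
  rw [(extChartAt J p₀).right_inv hy]
  refine (key.trans (hmodel _ _ y)).trans ?_
  have hev : ∀ U : ∀ q : N, TangentSpace J q,
      (VectorField.mpullback 𝓘(ℝ, EN) J (extChartAt J p₀).symm U : EN → EN) =ᶠ[𝓝 y]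
        fun z => tangentCoord J p₀ _ (U ((extChartAt J p₀).symm z)) := fun U => by
    filter_upwards [(isOpen_extChartAt_target p₀).mem_nhds hy] with z hz using hpull U z hz
  exact Filter.EventuallyEq.lieBracket_vectorField_eq (E := EN) (x := y) (hev V) (hev W)

end FixedChart

/-! ### Local frames and functions with prescribed germs -/

section Frames

variable {EM : Type*} [NormedAddCommGroup EM] [NormedSpace ℝ EM] [FiniteDimensional ℝ EM]
  {M : Type*} [TopologicalSpace M] [ChartedSpace EM M] [IsManifold 𝓘(ℝ, EM) ∞ M] [T2Space M]
  {F : Type*} [NormedAddCommGroup F] [NormedSpace ℝ F]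
  {E : M → Type*} [TopologicalSpace (TotalSpace F E)] [∀ x, TopologicalSpace (E x)]
  [∀ x, AddCommGroup (E x)] [∀ x, Module ℝ (E x)]
  [FiberBundle F E] [VectorBundle ℝ F E]

variable (EM) in
/-- A smooth function which is `1` near `x` and supported in a given neighbourhood of `x`. -/
theorem exists_contMDiff_eventuallyEq_one {x : M} {U : Set M} (hU : U ∈ 𝓝 x) :
    ∃ χ : M → ℝ, ContMDiff 𝓘(ℝ, EM) 𝓘(ℝ, ℝ) ∞ χ ∧ tsupport χ ⊆ U ∧ ∀ᶠ y in 𝓝 x, χ y = 1 := by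
  obtain ⟨f, -, hf⟩ := (SmoothBumpFunction.nhds_basis_tsupport (I := 𝓘(ℝ, EM)) x).mem_iff.1 hU
  exact ⟨f, f.contMDiff, hf, f.eventuallyEq_one⟩

/-- A smooth germ of a function is the germ of a globally smooth function. -/
theorem ContMDiffOn.exists_contMDiff_eventuallyEq {x : M} {U : Set M} (hU : IsOpen U) (hx : x ∈ U)
    {f : M → ℝ} (hf : ContMDiffOn 𝓘(ℝ, EM) 𝓘(ℝ, ℝ) ∞ f U) :
    ∃ g : M → ℝ, ContMDiff 𝓘(ℝ, EM) 𝓘(ℝ, ℝ) ∞ g ∧ g =ᶠ[𝓝 x] f := by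
  obtain ⟨χ, hχ, hχU, hχ1⟩ := exists_contMDiff_eventuallyEq_one EM (hU.mem_nhds hx)
  refine ⟨fun y => χ y * f y, contMDiff_of_tsupport fun y hy => ?_, ?_⟩
  · have hyU : y ∈ U := hχU (closure_mono (fun z hz => left_ne_zero_of_mul hz) hy)
    exact hχ.contMDiffAt.mul (hf.contMDiffAt (hU.mem_nhds hyU))
  · filter_upwards [hχ1] with y hy
    rw [hy, one_mul]

variable [ContMDiffVectorBundle ∞ F E 𝓘(ℝ, EM)]

variable (F E) in
/-- The components of a vector of `E_x` in the trivialization at `x₀`. -/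
abbrev fibreCoord (x₀ x : M) : E x →L[ℝ] F :=
  (trivializationAt F E x₀).continuousLinearMapAt ℝ x

variable (F E) in
/-- The vector of `E_x` with given components in the trivialization at `x₀`. -/
abbrev ofFibreCoord (x₀ x : M) : F →L[ℝ] E x := (trivializationAt F E x₀).symmL ℝ x

variable (EM F E) in
theorem exists_frame (x₀ : M) :
    ∃ (N : Set M) (s : F →ₗ[ℝ] Sec EM F E), IsOpen N ∧ x₀ ∈ N ∧
      N ⊆ (extChartAt 𝓘(ℝ, EM) x₀).source ∩ (trivializationAt F E x₀).baseSet ∧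
      ∀ x ∈ N, ∀ c, s c x = ofFibreCoord F E x₀ x c := by
  set U := (extChartAt 𝓘(ℝ, EM) x₀).source ∩ (trivializationAt F E x₀).baseSet with hU'
  have hU : IsOpen U := (isOpen_extChartAt_source x₀).inter (trivializationAt F E x₀).open_baseSet
  have hx₀ : x₀ ∈ U := ⟨mem_extChartAt_source x₀, mem_baseSet_trivializationAt F E x₀⟩
  obtain ⟨χ, hχ, hχU, hχ1⟩ := exists_contMDiff_eventuallyEq_one EM (hU.mem_nhds hx₀)
  have hs : ∀ c : F, ContMDiffOn 𝓘(ℝ, EM) (totModel EM F) ∞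
      (fun x => (⟨x, ofFibreCoord F E x₀ x c⟩ : TotalSpace F E)) U := fun c => by
    refine ((trivializationAt F E x₀).contMDiffOn_section_iff (IB := 𝓘(ℝ, EM)) (n := ∞) hU
      inter_subset_right).2 ?_
    refine (contMDiffOn_const (c := c)).congr fun x hx => ?_
    have h := congrArg Prod.snd ((trivializationAt F E x₀).apply_mk_symm hx.2 c)
    rwa [← Trivialization.symmL_apply (R := ℝ) _ hx.2] at h
  obtain ⟨N, hN1, hN, hxN⟩ := mem_nhds_iff.1 (Filter.inter_mem hχ1 (hU.mem_nhds hx₀))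
  refine ⟨N,
    { toFun := fun c => ⟨fun x => χ x • ofFibreCoord F E x₀ x c,
        ContMDiffOn.smul_section_of_tsupport hχ.contMDiffOn hU hχU (hs c)⟩
      map_add' := fun c d => by
        ext x
        exact (congrArg (χ x • ·) (map_add (ofFibreCoord F E x₀ x) c d)).trans (smul_add _ _ _)
      map_smul' := fun r c => by
        ext x
        exact (congrArg (χ x • ·) (map_smul (ofFibreCoord F E x₀ x) r c)).trans
          (smul_comm _ _ _) }, hN, hxN, fun x hx => (hN1 hx).2, fun x hx c => ?_⟩
  have h1 : χ x = 1 := (hN1 hx).1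
  change χ x • ofFibreCoord F E x₀ x c = _
  rw [h1, one_smul]

variable (EM F E) in
/-- A neighbourhood of `x₀` on which `frameSec` is a frame with constant components. -/
def frameNhd (x₀ : M) : Set M := Classical.choose (exists_frame EM F E x₀)

variable (EM F E) in
/-- Global sections with constant components `c` on `frameNhd`, linear in `c`. -/
def frameSec (x₀ : M) : F →ₗ[ℝ] Sec EM F E :=
  Classical.choose (Classical.choose_spec (exists_frame EM F E x₀))

theorem isOpen_frameNhd (x₀ : M) : IsOpen (frameNhd EM F E x₀) :=
  (Classical.choose_spec (Classical.choose_spec (exists_frame EM F E x₀))).1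

theorem mem_frameNhd (x₀ : M) : x₀ ∈ frameNhd EM F E x₀ :=
  (Classical.choose_spec (Classical.choose_spec (exists_frame EM F E x₀))).2.1

theorem mem_source_of_mem_frameNhd {x₀ x : M} (hx : x ∈ frameNhd EM F E x₀) :
    x ∈ (extChartAt 𝓘(ℝ, EM) x₀).source :=
  ((Classical.choose_spec (Classical.choose_spec (exists_frame EM F E x₀))).2.2.1 hx).1

theorem mem_baseSet_of_mem_frameNhd {x₀ x : M} (hx : x ∈ frameNhd EM F E x₀) :
    x ∈ (trivializationAt F E x₀).baseSet :=
  ((Classical.choose_spec (Classical.choose_spec (exists_frame EM F E x₀))).2.2.1 hx).2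

theorem frameSec_apply {x₀ x : M} (hx : x ∈ frameNhd EM F E x₀) (c : F) :
    frameSec EM F E x₀ c x = ofFibreCoord F E x₀ x c :=
  (Classical.choose_spec (Classical.choose_spec (exists_frame EM F E x₀))).2.2.2 x hx c

theorem fibreCoord_ofFibreCoord {x₀ x : M} (hx : x ∈ frameNhd EM F E x₀) (c : F) :
    fibreCoord F E x₀ x (ofFibreCoord F E x₀ x c) = c :=
  (trivializationAt F E x₀).continuousLinearMapAt_symmL (mem_baseSet_of_mem_frameNhd hx) c

theorem ofFibreCoord_fibreCoord {x₀ x : M} (hx : x ∈ frameNhd EM F E x₀) (b : E x) :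
    ofFibreCoord F E x₀ x (fibreCoord F E x₀ x b) = b :=
  (trivializationAt F E x₀).symmL_continuousLinearMapAt (mem_baseSet_of_mem_frameNhd hx) b

theorem trivializationAt_snd_eq {x₀ x : M} (hx : x ∈ frameNhd EM F E x₀) (b : E x) :
    (trivializationAt F E x₀ ⟨x, b⟩).2 = fibreCoord F E x₀ x b :=
  (congrFun ((trivializationAt F E x₀).coe_linearMapAt_of_mem (R := ℝ)
    (mem_baseSet_of_mem_frameNhd hx)) b).symm

/-- The product of a section with a smooth function. -/
def smulSec (f : M → ℝ) (hf : ContMDiff 𝓘(ℝ, EM) 𝓘(ℝ, ℝ) ∞ f) (X : Sec EM F E) : Sec EM F E :=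
  ⟨fun x => f x • X x, hf.smul_section X.contMDiff⟩

variable (EM F E) in
/-- The coordinate domain corresponding to `frameNhd`. -/
def frameDom (x₀ : M) : Set EM :=
  (extChartAt 𝓘(ℝ, EM) x₀).target ∩ (extChartAt 𝓘(ℝ, EM) x₀).symm ⁻¹' frameNhd EM F E x₀

theorem isOpen_frameDom (x₀ : M) : IsOpen (frameDom EM F E x₀) :=
  (continuousOn_extChartAt_symm x₀).isOpen_inter_preimage (isOpen_extChartAt_target x₀)
    (isOpen_frameNhd x₀)

theorem exists_frameDom {x₀ x : M} (hx : x ∈ frameNhd EM F E x₀) :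
    ∃ p ∈ frameDom EM F E x₀, (extChartAt 𝓘(ℝ, EM) x₀).symm p = x ∧
      p = extChartAt 𝓘(ℝ, EM) x₀ x := by
  have h := mem_source_of_mem_frameNhd hx
  refine ⟨_, ⟨(extChartAt 𝓘(ℝ, EM) x₀).map_source h, ?_⟩,
    (extChartAt 𝓘(ℝ, EM) x₀).left_inv h, rfl⟩
  rwa [mem_preimage, (extChartAt 𝓘(ℝ, EM) x₀).left_inv h]

/-- The components of a section, as a function of the coordinates. -/
def secCoord (x₀ : M) (X : Sec EM F E) (p : EM) : F :=
  fibreCoord F E x₀ _ (X ((extChartAt 𝓘(ℝ, EM) x₀).symm p))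

theorem contMDiffOn_fibreCoord_sec (x₀ : M) (X : Sec EM F E) :
    ContMDiffOn 𝓘(ℝ, EM) 𝓘(ℝ, F) ∞ (fun x => fibreCoord F E x₀ x (X x))
      (frameNhd EM F E x₀) := by
  refine (((trivializationAt F E x₀).contMDiffOn_section_iff (IB := 𝓘(ℝ, EM)) (n := ∞)
    (isOpen_frameNhd x₀) fun x hx => mem_baseSet_of_mem_frameNhd (EM := EM) hx).1
      X.contMDiff.contMDiffOn).congr fun x hx => ?_
  exact (trivializationAt_snd_eq hx _).symm

theorem contDiffOn_comp_extChartAt_symm {G : Type*} [NormedAddCommGroup G] [NormedSpace ℝ G]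
    (x₀ : M) {f : M → G} (hf : ContMDiffOn 𝓘(ℝ, EM) 𝓘(ℝ, G) ∞ f (frameNhd EM F E x₀)) :
    ContDiffOn ℝ ∞ (fun p => f ((extChartAt 𝓘(ℝ, EM) x₀).symm p)) (frameDom EM F E x₀) :=
  contMDiffOn_iff_contDiffOn.1 (hf.comp ((contMDiffOn_extChartAt_symm x₀).mono inter_subset_left)
    fun _ hp => hp.2)

theorem contDiffOn_secCoord (x₀ : M) (X : Sec EM F E) :
    ContDiffOn ℝ ∞ (secCoord x₀ X) (frameDom EM F E x₀) :=
  contDiffOn_comp_extChartAt_symm x₀ (contMDiffOn_fibreCoord_sec x₀ X)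

end Frames

/-! ### The anchor and the bracket in a local frame -/

section AlgebroidCoord

variable {EM : Type*} [NormedAddCommGroup EM] [NormedSpace ℝ EM] [FiniteDimensional ℝ EM]
  {M : Type*} [TopologicalSpace M] [ChartedSpace EM M] [IsManifold 𝓘(ℝ, EM) ∞ M] [T2Space M]
  {F : Type*} [NormedAddCommGroup F] [NormedSpace ℝ F]
  {E : M → Type*} [TopologicalSpace (TotalSpace F E)] [∀ x, TopologicalSpace (E x)]
  [∀ x, AddCommGroup (E x)] [∀ x, Module ℝ (E x)]
  [FiberBundle F E] [VectorBundle ℝ F E] [ContMDiffVectorBundle ∞ F E 𝓘(ℝ, EM)]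

/-- Evaluation of sections at `x`, as a linear map. -/
def secEval (x : M) : Sec EM F E →ₗ[ℝ] E x where
  toFun s := s x
  map_add' _ _ := rfl
  map_smul' _ _ := rfl

namespace LieAlgebroid

variable (A : LieAlgebroid EM F E)

theorem bracket_swap (X Y : Sec EM F E) : A.bracket X Y = -A.bracket Y X := by
  have h := A.bracket_self (X + Y)
  simp only [map_add, LinearMap.add_apply, A.bracket_self, zero_add, add_zero] at h
  exact eq_neg_of_add_eq_zero_right h

theorem bracket_smulSec (f : M → ℝ) (hf : ContMDiff 𝓘(ℝ, EM) 𝓘(ℝ, ℝ) ∞ f) (X Y : Sec EM F E)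
    (x : M) : A.bracket X (smulSec f hf Y) x =
      f x • A.bracket X Y x + dirDeriv 𝓘(ℝ, EM) f x (A.anchor x (X x)) • Y x :=
  A.leibniz f hf X Y _ (fun _ => rfl) x

/-- The bracket is local. -/
theorem bracket_congr_right {X Y Y' : Sec EM F E} {x : M} (h : ∀ᶠ y in 𝓝 x, Y y = Y' y) :
    A.bracket X Y x = A.bracket X Y' x := by
  obtain ⟨χ, hχ, hχU, hχ1⟩ := exists_contMDiff_eventuallyEq_one EM h
  have hZ : ∀ y, (Y - Y') y = (1 - χ y) • (Y - Y') y := fun y => by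
    by_cases hy : Y y = Y' y
    · have : (Y - Y') y = 0 := by rw [ContMDiffSection.coe_sub, Pi.sub_apply, hy, sub_self]
      rw [this, smul_zero]
    · have : χ y = 0 := by
        by_contra h0
        exact hy (hχU (subset_tsupport _ h0))
      rw [this, sub_zero, one_smul]
  have h1 := A.leibniz (fun y => 1 - χ y) (contMDiff_const.sub hχ) X (Y - Y') (Y - Y') hZ x
  have h2 : (Y - Y') x = 0 := by
    rw [ContMDiffSection.coe_sub, Pi.sub_apply, h.self_of_nhds, sub_self]
  rw [h2, smul_zero, add_zero, hχ1.self_of_nhds, sub_self, zero_smul, map_sub,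
    ContMDiffSection.coe_sub, Pi.sub_apply, sub_eq_zero] at h1
  exact h1

variable [FiniteDimensional ℝ F]

/-- The anchor in coordinates, at the point with coordinates `p`. -/
def anchorCoord (x₀ : M) (p : EM) : F →L[ℝ] EM :=
  LinearMap.toContinuousLinearMap
    ((tangentCoord 𝓘(ℝ, EM) x₀ ((extChartAt 𝓘(ℝ, EM) x₀).symm p)).toLinearMap ∘ₗ
      A.anchor ((extChartAt 𝓘(ℝ, EM) x₀).symm p) ∘ₗ
        (ofFibreCoord F E x₀ ((extChartAt 𝓘(ℝ, EM) x₀).symm p)).toLinearMap)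

/-- The structure functions: the components of the bracket of the frame sections with constant
components `c` and `d`. -/
def bracketCoord (x₀ : M) (p : EM) : F →L[ℝ] F →L[ℝ] F :=
  LinearMap.toContinuousLinearMap
    (LinearMap.toContinuousLinearMap.toLinearMap ∘ₗ
      LinearMap.mk₂ ℝ (fun c d => secCoord x₀ (A.bracket (frameSec EM F E x₀ c)
        (frameSec EM F E x₀ d)) p)
        (fun c c' d => by
          rw [map_add, map_add, LinearMap.add_apply]
          exact map_add (fibreCoord F E x₀ _) _ _)
        (fun r c d => by
          rw [map_smul, map_smul, LinearMap.smul_apply]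
          exact map_smul (fibreCoord F E x₀ _) _ _)
        (fun c d d' => by
          rw [map_add, map_add]
          exact map_add (fibreCoord F E x₀ _) _ _)
        (fun r c d => by
          rw [map_smul, map_smul]
          exact map_smul (fibreCoord F E x₀ _) _ _))

theorem bracketCoord_apply (x₀ : M) (p : EM) (c d : F) : A.bracketCoord x₀ p c d =
    secCoord x₀ (A.bracket (frameSec EM F E x₀ c) (frameSec EM F E x₀ d)) p := rfl

theorem anchorCoord_fibreCoord {x₀ : M} {p : EM} (hp : p ∈ frameDom EM F E x₀)
    (b : E ((extChartAt 𝓘(ℝ, EM) x₀).symm p)) :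
    A.anchorCoord x₀ p (fibreCoord F E x₀ _ b) =
      tangentCoord 𝓘(ℝ, EM) x₀ _ (A.anchor _ b) := by
  change tangentCoord 𝓘(ℝ, EM) x₀ _ (A.anchor _ (ofFibreCoord F E x₀ _ (fibreCoord F E x₀ _ b))) = _
  rw [ofFibreCoord_fibreCoord hp.2]

theorem contDiffOn_bracketCoord (x₀ : M) :
    ContDiffOn ℝ ∞ (A.bracketCoord x₀) (frameDom EM F E x₀) := by
  refine contDiffOn_clm_apply.2 fun c => contDiffOn_clm_apply.2 fun d => ?_
  exact contDiffOn_secCoord x₀ _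

/-- The vector field `ρ(X)` is smooth. -/
theorem contMDiff_anchor_sec (X : Sec EM F E) :
    ContMDiff 𝓘(ℝ, EM) 𝓘(ℝ, EM).tangent ∞
      (fun x => (⟨x, A.anchor x (X x)⟩ : TangentBundle 𝓘(ℝ, EM) M)) :=
  A.contMDiff_anchor.comp X.contMDiff

theorem contDiffOn_anchorCoord (x₀ : M) :
    ContDiffOn ℝ ∞ (A.anchorCoord x₀) (frameDom EM F E x₀) := by
  refine contDiffOn_clm_apply.2 fun c => ?_
  have h1 := (contMDiffOn_vectorField_iff (isOpen_frameNhd (F := F) (E := E) x₀)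
    (fun x hx => mem_source_of_mem_frameNhd hx) _).1
      (A.contMDiff_anchor_sec (frameSec EM F E x₀ c)).contMDiffOn
  refine (contDiffOn_comp_extChartAt_symm x₀ h1).congr fun p hp => ?_
  rw [frameSec_apply hp.2]
  rfl

theorem contMDiff_dirDeriv_anchor (X : Sec EM F E) {f : M → ℝ}
    (hf : ContMDiff 𝓘(ℝ, EM) 𝓘(ℝ, ℝ) ∞ f) :
    ContMDiff 𝓘(ℝ, EM) 𝓘(ℝ, ℝ) ∞ (fun x => dirDeriv 𝓘(ℝ, EM) f x (A.anchor x (X x))) := by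
  have h1 : ContMDiff 𝓘(ℝ, EM).tangent 𝓘(ℝ, ℝ).tangent ∞ (tangentMap 𝓘(ℝ, EM) 𝓘(ℝ, ℝ) f) :=
    hf.contMDiff_tangentMap (m := ∞) (by simp)
  have h2 := h1.comp (A.contMDiff_anchor_sec X)
  intro x
  have h3 := (contMDiffAt_totalSpace.1 (h2 x)).2
  exact h3.congr_of_eventuallyEq (Filter.Eventually.of_forall fun y => by
    simp only [dirDeriv]; simp; rfl)

theorem dirDeriv_anchor_eq {x₀ : M} {p : EM} (hp : p ∈ frameDom EM F E x₀) {f : M → ℝ}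
    (hf : MDifferentiableAt 𝓘(ℝ, EM) 𝓘(ℝ, ℝ) f ((extChartAt 𝓘(ℝ, EM) x₀).symm p))
    (b : E ((extChartAt 𝓘(ℝ, EM) x₀).symm p)) :
    dirDeriv 𝓘(ℝ, EM) f _ (A.anchor _ b) = fderiv ℝ (f ∘ (extChartAt 𝓘(ℝ, EM) x₀).symm) p
      (A.anchorCoord x₀ p (fibreCoord F E x₀ _ b)) := by
  rw [A.anchorCoord_fibreCoord hp, dirDeriv_eq_fderiv (mem_source_of_mem_frameNhd hp.2) hf,
    (extChartAt 𝓘(ℝ, EM) x₀).right_inv hp.1]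

/-- The anchor is a homomorphism of Lie algebras: a consequence of the Jacobi identity for `X`, `Y`
and the multiples `f Z` of a section. -/
theorem anchor_bracket (X Y : Sec EM F E) {f : M → ℝ} (hf : ContMDiff 𝓘(ℝ, EM) 𝓘(ℝ, ℝ) ∞ f)
    (x : M) : dirDeriv 𝓘(ℝ, EM) f x (A.anchor x (A.bracket X Y x)) =
      dirDeriv 𝓘(ℝ, EM) (fun y => dirDeriv 𝓘(ℝ, EM) f y (A.anchor y (Y y))) x (A.anchor x (X x)) -
      dirDeriv 𝓘(ℝ, EM) (fun y => dirDeriv 𝓘(ℝ, EM) f y (A.anchor y (X y))) x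
        (A.anchor x (Y x)) := by
  -- the argument needs a section `Z` with `Z(x) ≠ 0`, so the zero bundle is treated apart
  rcases subsingleton_or_nontrivial F with hF | hF
  · have h0 : ∀ (g : M → ℝ) (y : M) (b : E y), dirDeriv 𝓘(ℝ, EM) g y (A.anchor y b) = 0 := by
      intro g y b
      rw [← ofFibreCoord_fibreCoord (EM := EM) (F := F) (mem_frameNhd y) b,
        Subsingleton.elim (fibreCoord F E y y b) 0, map_zero, map_zero]
      exact map_zero (mfderiv 𝓘(ℝ, EM) 𝓘(ℝ, ℝ) g y)
    simp only [h0, sub_zero]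
  obtain ⟨z, hz⟩ := exists_ne (0 : F)
  set Z := frameSec EM F E x z with hZ
  have hZx : Z x ≠ 0 := by
    rw [hZ, frameSec_apply (mem_frameNhd x)]
    intro h
    have h' := congrArg (fibreCoord F E x x) h
    rw [fibreCoord_ofFibreCoord (EM := EM) (mem_frameNhd x), map_zero] at h'
    exact hz h'
  have hu := A.contMDiff_dirDeriv_anchor X hf
  have hv := A.contMDiff_dirDeriv_anchor Y hf
  have h1 : ∀ (W : Sec EM F E) (hw : ContMDiff 𝓘(ℝ, EM) 𝓘(ℝ, ℝ) ∞
      (fun x => dirDeriv 𝓘(ℝ, EM) f x (A.anchor x (W x)))),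
      A.bracket W (smulSec f hf Z) = smulSec f hf (A.bracket W Z) + smulSec _ hw Z := by
    intro W hw
    ext y
    exact A.bracket_smulSec f hf W Z y
  have jac := congrArg (fun s : Sec EM F E => s x) (A.jacobi X Y (smulSec f hf Z))
  have jac₀ := congrArg (fun s : Sec EM F E => s x) (A.jacobi X Y Z)
  rw [A.bracket_swap (smulSec f hf Z) X, A.bracket_swap (smulSec f hf Z) (A.bracket X Y), h1 Y hv,
    h1 X hu] at jac
  rw [A.bracket_swap Z X, A.bracket_swap Z (A.bracket X Y)] at jac₀
  simp only [map_add, map_neg, ContMDiffSection.coe_add, ContMDiffSection.coe_neg, Pi.add_apply,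
    Pi.neg_apply, A.bracket_smulSec, ContMDiffSection.coe_zero, Pi.zero_apply] at jac jac₀
  -- the Jacobi identity for `f Z`, minus `f` times that for `Z`
  have key : (dirDeriv 𝓘(ℝ, EM) (fun y => dirDeriv 𝓘(ℝ, EM) f y (A.anchor y (Y y))) x
      (A.anchor x (X x)) - dirDeriv 𝓘(ℝ, EM) (fun y => dirDeriv 𝓘(ℝ, EM) f y (A.anchor y (X y))) x
        (A.anchor x (Y x)) - dirDeriv 𝓘(ℝ, EM) f x (A.anchor x (A.bracket X Y x))) • Z x = 0 := by
    have h2 := congrArg (fun w => f x • w) jac₀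
    simp only [smul_zero] at h2
    rw [← sub_eq_zero, sub_zero] at jac h2
    rw [← sub_self (0 : E x)]
    conv_rhs =>
      arg 1
      rw [← jac]
    rw [← h2]
    module
  have := (smul_eq_zero.1 key).resolve_right hZx
  linarith

/-- Freezing the components of the second argument: the Leibniz rule, for the second argument expanded
in a frame near the point. -/
theorem secCoord_bracket_right {x₀ : M} {p : EM} (hp : p ∈ frameDom EM F E x₀)
    (X Y : Sec EM F E) : secCoord x₀ (A.bracket X Y) p =
      secCoord x₀ (A.bracket X (frameSec EM F E x₀ (secCoord x₀ Y p))) p +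
      fderiv ℝ (secCoord x₀ Y) p (A.anchorCoord x₀ p (secCoord x₀ X p)) := by
  set x := (extChartAt 𝓘(ℝ, EM) x₀).symm p with hx
  have hxN : x ∈ frameNhd EM F E x₀ := hp.2
  let b := Module.finBasis ℝ F
  have hh : ∀ i, ContMDiffOn 𝓘(ℝ, EM) 𝓘(ℝ, ℝ) ∞
      (fun y => b.coord i (fibreCoord F E x₀ y (Y y))) (frameNhd EM F E x₀) := fun i =>
    (LinearMap.toContinuousLinearMap (b.coord i)).contMDiff.comp_contMDiffOn
      (contMDiffOn_fibreCoord_sec x₀ Y)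
  choose g hg hgh using fun i => (hh i).exists_contMDiff_eventuallyEq (isOpen_frameNhd x₀) hxN
  let Y' : Sec EM F E := ∑ i, smulSec (g i) (hg i) (frameSec EM F E x₀ (b i))
  have hYY : ∀ᶠ y in 𝓝 x, Y y = Y' y := by
    filter_upwards [Filter.eventually_all.2 hgh, (isOpen_frameNhd x₀).mem_nhds hxN] with y hy hyN
    have h1 : Y' y = ∑ i, g i y • frameSec EM F E x₀ (b i) y := by
      exact map_sum (secEval y) _ _
    rw [h1]
    simp only [hy, frameSec_apply hyN, ← map_smul, ← map_sum]
    have h2 := b.sum_repr (fibreCoord F E x₀ y (Y y))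
    simp only [Module.Basis.coord_apply, h2]
    exact (ofFibreCoord_fibreCoord hyN _).symm
  have hval : ∑ i, g i x • b i = secCoord x₀ Y p := by
    refine Eq.trans ?_ (b.sum_repr _)
    exact Finset.sum_congr rfl fun i _ => congrArg (· • b i) (hgh i).self_of_nhds
  have hder : ∀ i, dirDeriv 𝓘(ℝ, EM) (g i) x (A.anchor x (X x)) =
      b.coord i (fderiv ℝ (secCoord x₀ Y) p (A.anchorCoord x₀ p (secCoord x₀ X p))) := fun i => by
    rw [A.dirDeriv_anchor_eq hp ((hg i).mdifferentiableAt (by simp))]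
    have h1 : g i ∘ (extChartAt 𝓘(ℝ, EM) x₀).symm =ᶠ[𝓝 p]
        fun q => (LinearMap.toContinuousLinearMap (b.coord i)) (secCoord x₀ Y q) :=
      ((continuousAt_extChartAt_symm'' hp.1).eventually (hgh i))
    have h2 : HasFDerivAt (secCoord x₀ Y) (fderiv ℝ (secCoord x₀ Y) p) p :=
      (((contDiffOn_secCoord x₀ Y).contDiffAt ((isOpen_frameDom x₀).mem_nhds hp)).differentiableAt
        (by simp)).hasFDerivAt
    have h3 : HasFDerivAt (fun q => (LinearMap.toContinuousLinearMap (b.coord i))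
        (secCoord x₀ Y q)) _ p :=
      (LinearMap.toContinuousLinearMap (b.coord i)).hasFDerivAt.comp p h2
    rw [h1.fderiv_eq, h3.fderiv]
    rfl
  have h1 : A.bracket X Y x = ∑ i, (g i x • A.bracket X (frameSec EM F E x₀ (b i)) x +
      dirDeriv 𝓘(ℝ, EM) (g i) x (A.anchor x (X x)) • frameSec EM F E x₀ (b i) x) := by
    rw [A.bracket_congr_right hYY, map_sum]
    refine (map_sum (secEval x) _ _).trans ?_
    exact Finset.sum_congr rfl fun i _ => A.bracket_smulSec _ _ _ _ _
  have h2 : secCoord x₀ (A.bracket X Y) p = fibreCoord F E x₀ x (A.bracket X Y x) := rfl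
  rw [h2, h1, Finset.sum_add_distrib, map_add]
  congr 1
  · rw [← hval]
    simp only [map_sum, map_smul]
    refine Eq.trans ?_ (congrArg (fibreCoord F E x₀ x) (map_sum (secEval x) _ _).symm)
    rw [map_sum]
    refine Finset.sum_congr rfl fun i _ => ?_
    exact (map_smul (fibreCoord F E x₀ x) _ _).symm
  · rw [map_sum, ← b.sum_repr (fderiv ℝ (secCoord x₀ Y) p _)]
    refine Finset.sum_congr rfl fun i _ => ?_
    rw [map_smul, hder, frameSec_apply hxN, fibreCoord_ofFibreCoord hxN]
    rfl

theorem secCoord_frameSec {x₀ : M} {p : EM} (hp : p ∈ frameDom EM F E x₀) (c : F) :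
    secCoord x₀ (frameSec EM F E x₀ c) p = c := by
  unfold secCoord
  rw [frameSec_apply hp.2, fibreCoord_ofFibreCoord hp.2]

/-- The components of the bracket of two sections. -/
theorem secCoord_bracket {x₀ : M} {p : EM} (hp : p ∈ frameDom EM F E x₀) (X Y : Sec EM F E) :
    secCoord x₀ (A.bracket X Y) p = A.bracketCoord x₀ p (secCoord x₀ X p) (secCoord x₀ Y p) +
      fderiv ℝ (secCoord x₀ Y) p (A.anchorCoord x₀ p (secCoord x₀ X p)) -
      fderiv ℝ (secCoord x₀ X) p (A.anchorCoord x₀ p (secCoord x₀ Y p)) := by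
  have hneg : ∀ V W : Sec EM F E, secCoord x₀ (A.bracket V W) p = -secCoord x₀ (A.bracket W V) p :=
    fun V W => by
      rw [A.bracket_swap V W]
      exact map_neg (fibreCoord F E x₀ _) _
  rw [A.secCoord_bracket_right hp, hneg, A.secCoord_bracket_right hp, bracketCoord_apply,
    secCoord_frameSec hp, neg_add, ← hneg]
  abel

/-- The homomorphism property of the anchor, in coordinates. It is tested on functions which are
linear in the coordinates near the point. -/
theorem anchorCoord_bracketCoord {x₀ : M} {p : EM} (hp : p ∈ frameDom EM F E x₀) (c d : F) :
    A.anchorCoord x₀ p (A.bracketCoord x₀ p c d) =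
      fderiv ℝ (A.anchorCoord x₀) p (A.anchorCoord x₀ p c) d -
      fderiv ℝ (A.anchorCoord x₀) p (A.anchorCoord x₀ p d) c := by
  set x := (extChartAt 𝓘(ℝ, EM) x₀).symm p with hx
  have hxN : x ∈ frameNhd EM F E x₀ := hp.2
  have hD := (isOpen_frameDom (EM := EM) (F := F) (E := E) x₀).mem_nhds hp
  rw [SeparatingDual.eq_iff_forall_dual_eq (R := ℝ)]
  intro l
  have hl : ContMDiffOn 𝓘(ℝ, EM) 𝓘(ℝ, ℝ) ∞ (fun y => l (extChartAt 𝓘(ℝ, EM) x₀ y))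
      (frameNhd EM F E x₀) :=
    l.contMDiff.comp_contMDiffOn (contMDiffOn_extChartAt.mono fun y hy => by
      rw [← extChartAt_source 𝓘(ℝ, EM)]; exact mem_source_of_mem_frameNhd hy)
  obtain ⟨f, hf, hfl⟩ := hl.exists_contMDiff_eventuallyEq (isOpen_frameNhd x₀) hxN
  have hfl' : f ∘ (extChartAt 𝓘(ℝ, EM) x₀).symm =ᶠ[𝓝 p] l := by
    filter_upwards [(continuousAt_extChartAt_symm'' hp.1).eventually hfl, hD] with q hq hqD
    exact hq.trans (congrArg l ((extChartAt 𝓘(ℝ, EM) x₀).right_inv hqD.1))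
  have hdir : ∀ᶠ q in 𝓝 p, ∀ b : E ((extChartAt 𝓘(ℝ, EM) x₀).symm q),
      dirDeriv 𝓘(ℝ, EM) f _ (A.anchor _ b) =
        l (A.anchorCoord x₀ q (fibreCoord F E x₀ _ b)) := by
    filter_upwards [hfl'.eventuallyEq_nhds, hD] with q hq hqD b
    rw [A.dirDeriv_anchor_eq hqD (hf.mdifferentiableAt (by simp)), hq.fderiv_eq, l.fderiv]
  have hfr : ∀ (e : F), (fun y => dirDeriv 𝓘(ℝ, EM) f y (A.anchor y (frameSec EM F E x₀ e y))) ∘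
      (extChartAt 𝓘(ℝ, EM) x₀).symm =ᶠ[𝓝 p] fun q => l (A.anchorCoord x₀ q e) := fun e => by
    filter_upwards [hdir, hD] with q hq hqD
    exact (hq _).trans (congrArg (fun c => l (A.anchorCoord x₀ q c)) (secCoord_frameSec hqD e))
  have hdfr : ∀ c e : F, dirDeriv 𝓘(ℝ, EM)
      (fun y => dirDeriv 𝓘(ℝ, EM) f y (A.anchor y (frameSec EM F E x₀ e y))) x
        (A.anchor x (frameSec EM F E x₀ c x)) =
      l (fderiv ℝ (A.anchorCoord x₀) p (A.anchorCoord x₀ p c) e) := fun c e => by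
    rw [A.dirDeriv_anchor_eq hp ((A.contMDiff_dirDeriv_anchor _ hf).mdifferentiableAt (by simp)),
      (hfr e).fderiv_eq]
    have h1 : HasFDerivAt (A.anchorCoord x₀) (fderiv ℝ (A.anchorCoord x₀) p) p :=
      (((A.contDiffOn_anchorCoord x₀).contDiffAt hD).differentiableAt (by simp)).hasFDerivAt
    have h2 : HasFDerivAt (fun q => l (A.anchorCoord x₀ q e)) _ p :=
      l.hasFDerivAt.comp p (h1.clm_apply (hasFDerivAt_const e p))
    have h3 : fibreCoord F E x₀ _ (frameSec EM F E x₀ c ((extChartAt 𝓘(ℝ, EM) x₀).symm p)) = c :=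
      secCoord_frameSec hp c
    rw [h2.fderiv, h3]
    simp
  have key := A.anchor_bracket (frameSec EM F E x₀ c) (frameSec EM F E x₀ d) hf x
  rw [hdfr, hdfr, hdir.self_of_nhds] at key
  rw [map_sub]
  exact key

end LieAlgebroid

end AlgebroidCoord

/-! ### The total space in a local frame -/

/-- A directional derivative in the chart at `p₀`, for a function given near `p` by a coordinate
expression `g`. -/
theorem dirDeriv_eq_fderiv_of_eventuallyEq {EN HN N : Type*} [NormedAddCommGroup EN]
    [NormedSpace ℝ EN] [TopologicalSpace HN] {J : ModelWithCorners ℝ EN HN} [TopologicalSpace N]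
    [ChartedSpace HN N] [IsManifold J ∞ N] {p₀ p : N} (hp : p ∈ (extChartAt J p₀).source)
    {f : N → ℝ} {g : EN → ℝ} (hg : DifferentiableAt ℝ g (extChartAt J p₀ p))
    (hfg : f =ᶠ[𝓝 p] g ∘ extChartAt J p₀) (v : TangentSpace J p) :
    dirDeriv J f p v = fderiv ℝ g (extChartAt J p₀ p) (tangentCoord J p₀ p v) := by
  have h1 := hg.hasFDerivAt.hasMFDerivAt.comp p (hasMFDerivAt_extChartAt_tangentCoord hp)
  have h2 : HasMFDerivAt J 𝓘(ℝ, ℝ) f p _ := h1.congr_of_eventuallyEq hfg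
  unfold dirDeriv
  rw [h2.mfderiv]
  rfl

section TotalCoord

variable {EM : Type*} [NormedAddCommGroup EM] [NormedSpace ℝ EM] [FiniteDimensional ℝ EM]
  {M : Type*} [TopologicalSpace M] [ChartedSpace EM M] [IsManifold 𝓘(ℝ, EM) ∞ M] [T2Space M]
  {F : Type*} [NormedAddCommGroup F] [NormedSpace ℝ F]
  {E : M → Type*} [TopologicalSpace (TotalSpace F E)] [∀ x, TopologicalSpace (E x)]
  [∀ x, AddCommGroup (E x)] [∀ x, Module ℝ (E x)]
  [FiberBundle F E] [VectorBundle ℝ F E] [ContMDiffVectorBundle ∞ F E 𝓘(ℝ, EM)]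

variable (EM F E) in
/-- The chart of the total space at the zero vector over `x₀`. -/
abbrev totChart (x₀ : M) : PartialEquiv (TotalSpace F E) (EM × F) :=
  extChartAt (totModel EM F) (⟨x₀, 0⟩ : TotalSpace F E)

variable (F E) in
/-- The point of `E` with coordinates `(x, y)`, in the chart and the trivialization at `x₀`. -/
def totPt (x₀ : M) (q : EM × F) : TotalSpace F E :=
  ⟨(extChartAt 𝓘(ℝ, EM) x₀).symm q.1, ofFibreCoord F E x₀ _ q.2⟩

variable (EM F E) in
/-- The coordinate domain in `EM × F` corresponding to `frameNhd`. -/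
def totDom (x₀ : M) : Set (EM × F) := frameDom EM F E x₀ ×ˢ univ

variable (EM) in
/-- The components `(ẋ, ẏ)` of a tangent vector of `E`. -/
def totCoord (x₀ : M) (a : TotalSpace F E) : TangentSpace (totModel EM F) a →L[ℝ] EM × F :=
  tangentCoord (totModel EM F) (⟨x₀, 0⟩ : TotalSpace F E) a

theorem isOpen_totDom (x₀ : M) : IsOpen (totDom EM F E x₀) :=
  (isOpen_frameDom x₀).prod isOpen_univ

theorem totChart_apply {x₀ : M} {a : TotalSpace F E} (ha : a.proj ∈ frameNhd EM F E x₀) :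
    totChart EM F E x₀ a = (extChartAt 𝓘(ℝ, EM) x₀ a.proj, fibreCoord F E x₀ a.proj a.2) := by
  rw [totChart, FiberBundle.extChartAt]
  refine Prod.ext ?_ ?_
  · change extChartAt 𝓘(ℝ, EM) x₀ (trivializationAt F E x₀ a).1 = _
    rw [(trivializationAt F E x₀).coe_fst' (mem_baseSet_of_mem_frameNhd ha)]
  · exact trivializationAt_snd_eq ha a.2

theorem mem_totChart_source {x₀ : M} {a : TotalSpace F E} (ha : a.proj ∈ frameNhd EM F E x₀) :
    a ∈ (totChart EM F E x₀).source := by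
  have h1 := mem_source_of_mem_frameNhd ha
  have h2 := mem_baseSet_of_mem_frameNhd ha
  rw [totChart, FiberBundle.extChartAt]
  refine ⟨(trivializationAt F E x₀).mem_source.2 h2, ?_⟩
  change (trivializationAt F E x₀ a) ∈ (extChartAt 𝓘(ℝ, EM) x₀).source ×ˢ univ
  refine ⟨?_, mem_univ _⟩
  rwa [(trivializationAt F E x₀).coe_fst' h2]

theorem totChart_totPt {x₀ : M} {q : EM × F} (hq : q ∈ totDom EM F E x₀) :
    totChart EM F E x₀ (totPt F E x₀ q) = q := by
  have h : (totPt F E x₀ q).proj ∈ frameNhd EM F E x₀ := hq.1.2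
  rw [totChart_apply h]
  exact Prod.ext ((extChartAt 𝓘(ℝ, EM) x₀).right_inv hq.1.1) (fibreCoord_ofFibreCoord h _)

theorem totPt_totChart {x₀ : M} {a : TotalSpace F E} (ha : a.proj ∈ frameNhd EM F E x₀) :
    totChart EM F E x₀ a ∈ totDom EM F E x₀ ∧ totPt F E x₀ (totChart EM F E x₀ a) = a := by
  obtain ⟨x, b⟩ := a
  obtain ⟨p, hp, hpx, hpx'⟩ := exists_frameDom ha
  dsimp only at hpx hpx'
  subst hpx
  have h1 : totChart EM F E x₀ ⟨(extChartAt 𝓘(ℝ, EM) x₀).symm p, b⟩ = (p, fibreCoord F E x₀ _ b) := by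
    rw [totChart_apply ha, ← hpx']
  rw [h1]
  refine ⟨⟨hp, mem_univ _⟩, ?_⟩
  unfold totPt
  rw [ofFibreCoord_fibreCoord (EM := EM) hp.2]

theorem exists_totDom {x₀ : M} {a : TotalSpace F E} (ha : a.proj ∈ frameNhd EM F E x₀) :
    ∃ q ∈ totDom EM F E x₀, totPt F E x₀ q = a :=
  ⟨_, (totPt_totChart ha).1, (totPt_totChart ha).2⟩

theorem totChart_symm {x₀ : M} {q : EM × F} (hq : q ∈ totDom EM F E x₀) :
    (totChart EM F E x₀).symm q = totPt F E x₀ q := by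
  conv_lhs => rw [← totChart_totPt hq]
  exact (totChart EM F E x₀).left_inv (mem_totChart_source hq.1.2)

theorem contMDiffOn_totChart (x₀ : M) : ContMDiffOn (totModel EM F) 𝓘(ℝ, EM × F) ∞
    (totChart EM F E x₀) ((TotalSpace.proj : TotalSpace F E → M) ⁻¹' frameNhd EM F E x₀) :=
  (contMDiffOn_extChartAt (n := ∞)).mono fun a ha => by
    have := mem_totChart_source (a := a) ha
    rwa [totChart, extChartAt_source] at this

theorem isOpen_proj_preimage (x₀ : M) :
    IsOpen ((TotalSpace.proj : TotalSpace F E → M) ⁻¹' frameNhd EM F E x₀) :=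
  (isOpen_frameNhd x₀).preimage (FiberBundle.continuous_proj F E)

theorem mem_nhds_proj_preimage {x₀ : M} {a : TotalSpace F E} (ha : a.proj ∈ frameNhd EM F E x₀) :
    (TotalSpace.proj : TotalSpace F E → M) ⁻¹' frameNhd EM F E x₀ ∈ 𝓝 a :=
  (isOpen_proj_preimage x₀).mem_nhds ha

theorem continuousAt_totChart {x₀ : M} {a : TotalSpace F E} (ha : a.proj ∈ frameNhd EM F E x₀) :
    ContinuousAt (totChart EM F E x₀) a :=
  continuousAt_extChartAt' (mem_totChart_source ha)

theorem totDom_subset_target (x₀ : M) : totDom EM F E x₀ ⊆ (totChart EM F E x₀).target :=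
  fun q hq => by
    rw [← totChart_totPt hq]
    exact (totChart EM F E x₀).map_source (mem_totChart_source hq.1.2)

theorem contMDiffOn_totPt (x₀ : M) : ContMDiffOn 𝓘(ℝ, EM × F) (totModel EM F) ∞
    (totPt F E x₀) (totDom EM F E x₀) :=
  ((contMDiffOn_extChartAt_symm _).mono (totDom_subset_target x₀)).congr
    fun _ hq => (totChart_symm hq).symm

/-- A directional derivative of a function on `E`, given near `totPt q` by a coordinate
expression `g`. -/
theorem dirDeriv_totPt {x₀ : M} {q : EM × F} (hq : q ∈ totDom EM F E x₀)
    {f : TotalSpace F E → ℝ} {g : EM × F → ℝ} (hg : DifferentiableAt ℝ g q)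
    (hfg : (fun q => f (totPt F E x₀ q)) =ᶠ[𝓝 q] g)
    (v : TangentSpace (totModel EM F) (totPt F E x₀ q)) :
    dirDeriv (totModel EM F) f (totPt F E x₀ q) v = fderiv ℝ g q (totCoord EM x₀ _ v) := by
  have h1 := dirDeriv_eq_fderiv_of_eventuallyEq (f := f) (g := g)
    (mem_totChart_source (a := totPt F E x₀ q) hq.1.2) (by rwa [totChart_totPt hq]) (by
      have hc := continuousAt_totChart (a := totPt F E x₀ q) hq.1.2
      rw [ContinuousAt, totChart_totPt hq] at hc
      filter_upwards [hc.eventually hfg, mem_nhds_proj_preimage (a := totPt F E x₀ q) hq.1.2]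
        with a ha haN
      rw [(totPt_totChart haN).2] at ha
      exact ha) v
  rw [totChart_totPt hq] at h1
  exact h1

/-- A directional derivative of a function on `M` along the anchor, in coordinates. -/
theorem LieAlgebroid.dirDeriv_anchor_of_eventuallyEq [FiniteDimensional ℝ F]
    (A : LieAlgebroid EM F E) {x₀ : M} {p : EM}
    (hp : p ∈ frameDom EM F E x₀) {f : M → ℝ} {g : EM → ℝ} (hg : DifferentiableAt ℝ g p)
    (hfg : (fun p => f ((extChartAt 𝓘(ℝ, EM) x₀).symm p)) =ᶠ[𝓝 p] g)
    (b : E ((extChartAt 𝓘(ℝ, EM) x₀).symm p)) :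
    dirDeriv 𝓘(ℝ, EM) f _ (A.anchor _ b) =
      fderiv ℝ g p (A.anchorCoord x₀ p (fibreCoord F E x₀ _ b)) := by
  have hr := (extChartAt 𝓘(ℝ, EM) x₀).right_inv hp.1
  have hs := mem_source_of_mem_frameNhd (F := F) (E := E) hp.2
  have h1 := dirDeriv_eq_fderiv_of_eventuallyEq (f := f) (g := g) hs (by rwa [hr]) (by
      have hc : ContinuousAt (extChartAt 𝓘(ℝ, EM) x₀) ((extChartAt 𝓘(ℝ, EM) x₀).symm p) :=
        continuousAt_extChartAt' hs
      rw [ContinuousAt, hr] at hc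
      filter_upwards [hc.eventually hfg, (isOpen_extChartAt_source (I := 𝓘(ℝ, EM)) x₀).mem_nhds hs]
        with a ha haN
      rw [(extChartAt 𝓘(ℝ, EM) x₀).left_inv haN] at ha
      exact ha) (A.anchor _ b)
  rw [hr] at h1
  rw [h1, A.anchorCoord_fibreCoord hp]

theorem totCoord_vertLift {x₀ : M} {a : TotalSpace F E} (ha : a.proj ∈ frameNhd EM F E x₀)
    (b : E a.proj) : totCoord EM x₀ a (vertLift a b) = (0, fibreCoord F E x₀ a.proj b) := by
  -- `a.2 + 0 • b` is not syntactically `a.2`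
  have key : ∀ p : TotalSpace F E, p = a → HasMFDerivAt (totModel EM F) 𝓘(ℝ, EM × F)
      (totChart EM F E x₀) p (totCoord EM x₀ a : EM × F →L[ℝ] EM × F) := by
    rintro p rfl
    exact hasMFDerivAt_extChartAt_tangentCoord (mem_totChart_source ha)
  have h1 := (key (⟨a.proj, a.2 + (0 : ℝ) • b⟩ : TotalSpace F E) (by cases a; simp)).comp (0 : ℝ)
    (hasMFDerivAt_fibreLine (EM := EM) a b)
  have h2 : HasDerivAt (fun t : ℝ => ((extChartAt 𝓘(ℝ, EM) x₀ a.proj,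
      fibreCoord F E x₀ a.proj a.2 + t • fibreCoord F E x₀ a.proj b) : EM × F))
      ((0 : EM), fibreCoord F E x₀ a.proj b) 0 := by
    refine (hasDerivAt_const _ _).prodMk ?_
    simpa using ((hasDerivAt_id (0 : ℝ)).smul_const
      (fibreCoord F E x₀ a.proj b)).const_add (fibreCoord F E x₀ a.proj a.2)
  have h3 : (totChart EM F E x₀ ∘ fun t : ℝ => (⟨a.proj, a.2 + t • b⟩ : TotalSpace F E)) =
      fun t : ℝ => ((extChartAt 𝓘(ℝ, EM) x₀ a.proj,
        fibreCoord F E x₀ a.proj a.2 + t • fibreCoord F E x₀ a.proj b) : EM × F) := by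
    funext t
    refine (totChart_apply (a := (⟨a.proj, a.2 + t • b⟩ : TotalSpace F E)) ha).trans ?_
    dsimp only
    rw [map_add, map_smul]
  rw [h3] at h1
  have h4 := DFunLike.congr_fun (hasMFDerivAt_unique h1 h2.hasFDerivAt.hasMFDerivAt) (1 : ℝ)
  have h5 : vertLift (EM := EM) a b = ((0 : EM),
      (trivializationAt F E a.proj).continuousLinearEquivAt ℝ a.proj
        (mem_baseSet_trivializationAt F E a.proj) b) := vertVelocity_eq a b
  rw [h5]
  refine (congrArg (totCoord EM x₀ a : EM × F →L[ℝ] EM × F) (one_smul ℝ _).symm).trans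
    (h4.trans (one_smul ℝ _))

theorem tangentCoord_mfderiv_proj {x₀ : M} {a : TotalSpace F E}
    (ha : a.proj ∈ frameNhd EM F E x₀) (w : TangentSpace (totModel EM F) a) :
    tangentCoord 𝓘(ℝ, EM) x₀ a.proj
      (mfderiv (totModel EM F) 𝓘(ℝ, EM) (TotalSpace.proj : TotalSpace F E → M) a w) =
      (totCoord EM x₀ a w).1 := by
  have h1 : HasMFDerivAt (totModel EM F) 𝓘(ℝ, EM) (TotalSpace.proj : TotalSpace F E → M) a _ :=
    ((contMDiff_proj E (n := 1)).mdifferentiableAt one_ne_zero).hasMFDerivAt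
  have h2 := (hasMFDerivAt_extChartAt_tangentCoord (mem_source_of_mem_frameNhd ha)).comp a h1
  have h3 := hasMFDerivAt_extChartAt_tangentCoord (mem_totChart_source ha)
  have h4 := ((ContinuousLinearMap.fst ℝ EM F).hasMFDerivAt).comp a h3
  have h5 := h4.congr_of_eventuallyEq (f₁ := extChartAt 𝓘(ℝ, EM) x₀ ∘ TotalSpace.proj) (by
    filter_upwards [mem_nhds_proj_preimage ha] with a' ha'
    exact (congrArg Prod.fst (totChart_apply ha')).symm)
  exact DFunLike.congr_fun (hasMFDerivAt_unique h2 h5) w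

/-- The defining relation `ρ(b) = Tτ(v)` of `𝓛^τ E`, in coordinates. -/
theorem LieAlgebroid.anchorCoord_baseVec [FiniteDimensional ℝ F] (A : LieAlgebroid EM F E) {x₀ : M}
    {q : EM × F} (hq : q ∈ totDom EM F E x₀) (z : A.prolE (totPt F E x₀ q)) :
    A.anchorCoord x₀ q.1 (fibreCoord F E x₀ _ (A.baseVec z)) =
      (totCoord EM x₀ _ (A.prolAnchor z)).1 := by
  rw [← tangentCoord_mfderiv_proj (a := totPt F E x₀ q) hq.1.2]
  exact (A.anchorCoord_fibreCoord hq.1 (A.baseVec z)).trans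
    (congrArg (tangentCoord 𝓘(ℝ, EM) x₀ _) z.2)

theorem LieAlgebroid.mem_prolE [FiniteDimensional ℝ F] (A : LieAlgebroid EM F E) {x₀ : M}
    {q : EM × F} (hq : q ∈ totDom EM F E x₀) (b : E (totPt F E x₀ q).proj)
    (w : TangentSpace (totModel EM F) (totPt F E x₀ q))
    (h : A.anchorCoord x₀ q.1 (fibreCoord F E x₀ _ b) = (totCoord EM x₀ _ w).1) :
    (b, w) ∈ A.prolE (totPt F E x₀ q) := by
  apply tangentCoord_injective (J := 𝓘(ℝ, EM)) (p₀ := x₀) (mem_source_of_mem_frameNhd hq.1.2)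
  exact (A.anchorCoord_fibreCoord hq.1 b).symm.trans
    (h.trans (tangentCoord_mfderiv_proj (a := totPt F E x₀ q) hq.1.2 w).symm)

/-! ### Functions on the total space and fibre derivatives in coordinates -/

variable (EM) in
/-- The coordinates of the points of `U` over `frameNhd`. -/
def totPre (x₀ : M) (U : Set (TotalSpace F E)) : Set (EM × F) :=
  totDom EM F E x₀ ∩ totPt F E x₀ ⁻¹' U

theorem isOpen_totPre (x₀ : M) {U : Set (TotalSpace F E)} (hU : IsOpen U) :
    IsOpen (totPre EM x₀ U) :=
  (contMDiffOn_totPt x₀).continuousOn.isOpen_inter_preimage (isOpen_totDom x₀) hU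

theorem contDiffOn_comp_totPt {G : Type*} [NormedAddCommGroup G] [NormedSpace ℝ G] (x₀ : M)
    {U : Set (TotalSpace F E)} {f : TotalSpace F E → G}
    (hf : ContMDiffOn (totModel EM F) 𝓘(ℝ, G) ∞ f U) :
    ContDiffOn ℝ ∞ (fun q => f (totPt F E x₀ q)) (totPre EM x₀ U) :=
  contMDiffOn_iff_contDiffOn.1 (hf.comp ((contMDiffOn_totPt x₀).mono inter_subset_left)
    fun _ hp => hp.2)

theorem totPt_add_smul {x₀ : M} {q : EM × F} (hq : q ∈ totDom EM F E x₀)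
    (b : E (totPt F E x₀ q).proj) (t : ℝ) :
    (⟨(totPt F E x₀ q).proj, (totPt F E x₀ q).2 + t • b⟩ : TotalSpace F E) =
      totPt F E x₀ (q + t • ((0 : EM), fibreCoord F E x₀ _ b)) := by
  have h : totPt F E x₀ (q + t • ((0 : EM), fibreCoord F E x₀ _ b)) =
      totPt F E x₀ (q.1, q.2 + t • fibreCoord F E x₀ (totPt F E x₀ q).proj b) := by
    congr 1
    exact Prod.ext (by simp) rfl
  rw [h]
  change _ = (⟨(totPt F E x₀ q).proj, ofFibreCoord F E x₀ (totPt F E x₀ q).proj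
    (q.2 + t • fibreCoord F E x₀ (totPt F E x₀ q).proj b)⟩ : TotalSpace F E)
  rw [map_add, map_smul, ofFibreCoord_fibreCoord (EM := EM) (x := (totPt F E x₀ q).proj) hq.1.2]
  rfl

theorem hasDerivAt_comp_fibreLine {G : Type*} [NormedAddCommGroup G] [NormedSpace ℝ G]
    {g : EM × F → G} {q : EM × F} (hg : DifferentiableAt ℝ g q) (c : F) :
    HasDerivAt (fun t : ℝ => g (q + t • ((0 : EM), c))) (fderiv ℝ g q (0, c)) 0 := by
  have h1 : HasDerivAt (fun t : ℝ => q + t • ((0 : EM), c)) ((0 : EM), c) 0 := by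
    simpa using ((hasDerivAt_id (0 : ℝ)).smul_const ((0 : EM), c)).const_add q
  have h2 : HasFDerivAt g (fderiv ℝ g q) (q + (0 : ℝ) • ((0 : EM), c)) := by
    rw [zero_smul, add_zero]; exact hg.hasFDerivAt
  exact h2.comp_hasDerivAt (0 : ℝ) h1

theorem fibreDeriv_totPt {x₀ : M} {q : EM × F} (hq : q ∈ totDom EM F E x₀)
    {f : TotalSpace F E → ℝ} (hf : DifferentiableAt ℝ (fun q => f (totPt F E x₀ q)) q)
    (b : E (totPt F E x₀ q).proj) : fibreDeriv f (totPt F E x₀ q) b =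
      fderiv ℝ (fun q => f (totPt F E x₀ q)) q (0, fibreCoord F E x₀ _ b) := by
  unfold fibreDeriv
  simp only [totPt_add_smul hq]
  exact (hasDerivAt_comp_fibreLine hf _).deriv

theorem fibreDeriv_fibreLine {x₀ : M} {q : EM × F} (hq : q ∈ totDom EM F E x₀)
    {f : TotalSpace F E → ℝ} (b c : E (totPt F E x₀ q).proj) (t : ℝ)
    (hf : DifferentiableAt ℝ (fun q => f (totPt F E x₀ q))
      (q + t • ((0 : EM), fibreCoord F E x₀ _ b))) :
    fibreDeriv f (⟨(totPt F E x₀ q).proj, (totPt F E x₀ q).2 + t • b⟩ : TotalSpace F E) c =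
      fderiv ℝ (fun q => f (totPt F E x₀ q)) (q + t • ((0 : EM), fibreCoord F E x₀ _ b))
        (0, fibreCoord F E x₀ _ c) := by
  unfold fibreDeriv
  have h : ∀ s : ℝ, (⟨(totPt F E x₀ q).proj, (totPt F E x₀ q).2 + t • b + s • c⟩ :
      TotalSpace F E) = totPt F E x₀ (q + t • ((0 : EM), fibreCoord F E x₀ _ b) +
        s • ((0 : EM), fibreCoord F E x₀ _ c)) := fun s => by
    have h1 := totPt_add_smul hq (t • b + s • c) 1
    rw [one_smul, one_smul] at h1
    rw [add_assoc, h1]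
    congr 1
    rw [add_assoc]
    congr 1
    exact Prod.ext (by simp) (by simp)
  simp only [h]
  exact (hasDerivAt_comp_fibreLine hf _).deriv

theorem fibreHessian_totPt {x₀ : M} {q : EM × F} {U : Set (EM × F)} (hU : IsOpen U)
    (hUD : U ⊆ totDom EM F E x₀) (hq : q ∈ U)
    {f : TotalSpace F E → ℝ} (hf : ContDiffOn ℝ ∞ (fun q => f (totPt F E x₀ q)) U)
    (b c : E (totPt F E x₀ q).proj) : fibreHessian f (totPt F E x₀ q) b c =
      fderiv ℝ (fderiv ℝ (fun q => f (totPt F E x₀ q))) q (0, fibreCoord F E x₀ _ b)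
        (0, fibreCoord F E x₀ _ c) := by
  unfold fibreHessian
  have h2 : DifferentiableAt ℝ (fderiv ℝ (fun q => f (totPt F E x₀ q))) q :=
    ((hf.fderiv_of_isOpen hU (m := ∞) (by simp)).contDiffAt (hU.mem_nhds hq)).differentiableAt
      (by simp)
  have h3 := (hasDerivAt_comp_fibreLine h2 (fibreCoord F E x₀ _ b)).clm_apply
    (hasDerivAt_const (0 : ℝ) ((0 : EM), fibreCoord F E x₀ _ c))
  have h4 : Filter.Tendsto (fun t : ℝ => q + t • ((0 : EM), fibreCoord F E x₀ _ b)) (𝓝 0) (𝓝 q) := by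
    have : Continuous (fun t : ℝ => q + t • ((0 : EM), fibreCoord F E x₀ _ b)) := by fun_prop
    simpa using this.tendsto 0
  refine (h3.congr_of_eventuallyEq ?_).deriv.trans (by simp)
  filter_upwards [h4.eventually (hU.mem_nhds hq)] with t ht
  exact fibreDeriv_fibreLine (hUD hq) b c t
    ((hf.contDiffAt (hU.mem_nhds ht)).differentiableAt (by simp))

/-! ### Maps to the dual bundle in coordinates -/

/-- The components of a map `E → E*` over `M`, as a function of the coordinates. -/
def dualCoord (x₀ : M) (G : ∀ a : TotalSpace F E, DualFib E a.proj) (q : EM × F) : F →L[ℝ] ℝ :=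
  (G (totPt F E x₀ q)).comp (ofFibreCoord F E x₀ _)

/-- The components of a section of `E*`, as a function of the coordinates. -/
def dualSecCoord (x₀ : M) (θ : Sec EM (F →L[ℝ] ℝ) (DualFib E)) (p : EM) : F →L[ℝ] ℝ :=
  (θ ((extChartAt 𝓘(ℝ, EM) x₀).symm p)).comp (ofFibreCoord F E x₀ _)

theorem dualCoord_fibreCoord {x₀ : M} {q : EM × F} (hq : q ∈ totDom EM F E x₀)
    (G : ∀ a : TotalSpace F E, DualFib E a.proj) (b : E (totPt F E x₀ q).proj) :
    dualCoord x₀ G q (fibreCoord F E x₀ _ b) = G (totPt F E x₀ q) b :=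
  congrArg (G (totPt F E x₀ q))
    (ofFibreCoord_fibreCoord (EM := EM) (x := (totPt F E x₀ q).proj) hq.1.2 b)

theorem dualSecCoord_fibreCoord {x₀ : M} {p : EM} (hp : p ∈ frameDom EM F E x₀)
    (θ : Sec EM (F →L[ℝ] ℝ) (DualFib E)) (b : E ((extChartAt 𝓘(ℝ, EM) x₀).symm p)) :
    dualSecCoord x₀ θ p (fibreCoord F E x₀ _ b) = θ _ b :=
  congrArg (θ ((extChartAt 𝓘(ℝ, EM) x₀).symm p)) (ofFibreCoord_fibreCoord (EM := EM) hp.2 b)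

variable [FiniteDimensional ℝ F]

theorem contDiffOn_dualCoord (x₀ : M) {W : Set (TotalSpace F E)}
    {G : ∀ a : TotalSpace F E, DualFib E a.proj}
    (hG : ContMDiffOn (totModel EM F) (totModel EM (F →L[ℝ] ℝ)) ∞ (LieAlgebroid.toDualMap (F := F) G) W) :
    ContDiffOn ℝ ∞ (dualCoord (EM := EM) x₀ G) (totPre EM x₀ W) := by
  refine contDiffOn_clm_apply.2 fun c => ?_
  have h1 := contDiffOn_comp_totPt x₀
    ((contMDiff_linearFun (frameSec EM F E x₀ c)).comp_contMDiffOn hG)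
  refine h1.congr fun q hq => ?_
  exact congrArg (G (totPt F E x₀ q)) (frameSec_apply (x := (totPt F E x₀ q).proj) hq.1.1.2 c).symm

theorem contDiffOn_dualSecCoord (x₀ : M) (θ : Sec EM (F →L[ℝ] ℝ) (DualFib E)) :
    ContDiffOn ℝ ∞ (dualSecCoord x₀ θ) (frameDom EM F E x₀) := by
  refine contDiffOn_clm_apply.2 fun c => ?_
  have h1 := contDiffOn_comp_extChartAt_symm (F := F) (E := E) x₀
    ((contMDiff_linearFun (frameSec EM F E x₀ c)).comp θ.contMDiff).contMDiffOn
  refine h1.congr fun p hp => ?_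
  exact congrArg (θ ((extChartAt 𝓘(ℝ, EM) x₀).symm p)) (frameSec_apply hp.2 c).symm

end TotalCoord

/-! ### The section `Θ` and the Euler-Lagrange expression in coordinates -/

section ThetaCoord

variable {EM : Type*} [NormedAddCommGroup EM] [NormedSpace ℝ EM] [FiniteDimensional ℝ EM]
  {M : Type*} [TopologicalSpace M] [ChartedSpace EM M] [IsManifold 𝓘(ℝ, EM) ∞ M] [T2Space M]
  {F : Type*} [NormedAddCommGroup F] [NormedSpace ℝ F] [FiniteDimensional ℝ F]
  {E : M → Type*} [TopologicalSpace (TotalSpace F E)] [∀ x, TopologicalSpace (E x)]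
  [∀ x, AddCommGroup (E x)] [∀ x, Module ℝ (E x)]
  [FiberBundle F E] [VectorBundle ℝ F E] [ContMDiffVectorBundle ∞ F E 𝓘(ℝ, EM)]

/-- The derivative of a contraction `⟨ξ(q), η(x)⟩`, where `η` depends on `x` only. -/
theorem fderiv_clm_apply_fst {G : Type*} [NormedAddCommGroup G] [NormedSpace ℝ G]
    {ξ : EM × F → G →L[ℝ] ℝ} {η : EM → G} {q : EM × F} (hξ : DifferentiableAt ℝ ξ q)
    (hη : DifferentiableAt ℝ η q.1) : DifferentiableAt ℝ (fun q => ξ q (η q.1)) q ∧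
      ∀ w, fderiv ℝ (fun q => ξ q (η q.1)) q w = fderiv ℝ ξ q w (η q.1) +
        ξ q (fderiv ℝ η q.1 w.1) := by
  have h1 : HasFDerivAt (fun q : EM × F => η q.1)
      ((fderiv ℝ η q.1).comp (ContinuousLinearMap.fst ℝ EM F)) q :=
    HasFDerivAt.comp (g := η) (f := Prod.fst) q hη.hasFDerivAt hasFDerivAt_fst
  have h2 := hξ.hasFDerivAt.clm_apply h1
  refine ⟨h2.differentiableAt, fun w => ?_⟩
  rw [h2.fderiv]
  simp only [add_apply, ContinuousLinearMap.comp_apply,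
    ContinuousLinearMap.flip_apply, ContinuousLinearMap.coe_fst']
  rw [add_comm]

namespace LieAlgebroid

/-- The derivative of the linear function on `E*` given by `X` along the image of a map. -/
theorem dirDeriv_linearFun_comp {G : ∀ a : TotalSpace F E, DualFib E a.proj} {a : TotalSpace F E}
    (hG : MDifferentiableAt (totModel EM F) (totModel EM (F →L[ℝ] ℝ)) (toDualMap (F := F) G) a)
    (X : Sec EM F E) (w : TangentSpace (totModel EM F) a) :
    dirDeriv (totModel EM (F →L[ℝ] ℝ)) (fun β : DualTot F E => β.2 (X β.proj))
      (toDualMap (F := F) G a)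
      (mfderiv (totModel EM F) (totModel EM (F →L[ℝ] ℝ)) (toDualMap (F := F) G) a w) =
    dirDeriv (totModel EM F) (fun a' => G a' (X a'.proj)) a w := by
  have h1 : MDifferentiableAt (totModel EM (F →L[ℝ] ℝ)) 𝓘(ℝ, ℝ)
      (fun β : DualTot F E => β.2 (X β.proj)) (toDualMap (F := F) G a) :=
    (contMDiff_linearFun X).contMDiffAt.mdifferentiableAt (by simp)
  exact (DFunLike.congr_fun (mfderiv_comp a h1 hG) w).symm

theorem dirDeriv_pairing {x₀ : M} {q : EM × F} (hq : q ∈ totDom EM F E x₀)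
    {G : ∀ a : TotalSpace F E, DualFib E a.proj}
    (hG : DifferentiableAt ℝ (dualCoord (EM := EM) x₀ G) q)
    (X : Sec EM F E) (w : TangentSpace (totModel EM F) (totPt F E x₀ q)) :
    dirDeriv (totModel EM F) (fun a' => G a' (X a'.proj)) (totPt F E x₀ q) w =
      fderiv ℝ (dualCoord x₀ G) q (totCoord EM x₀ _ w) (secCoord x₀ X q.1) +
        dualCoord x₀ G q (fderiv ℝ (secCoord x₀ X) q.1 (totCoord EM x₀ _ w).1) := by
  have hX : DifferentiableAt ℝ (secCoord x₀ X) q.1 :=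
    ((contDiffOn_secCoord x₀ X).contDiffAt ((isOpen_frameDom x₀).mem_nhds hq.1)).differentiableAt
      (by simp)
  obtain ⟨h1, h2⟩ := fderiv_clm_apply_fst hG hX
  rw [← h2]
  refine dirDeriv_totPt hq h1 ?_ w
  filter_upwards [(isOpen_totDom x₀).mem_nhds hq] with q' hq'
  exact (dualCoord_fibreCoord hq' G _).symm

theorem secCoord_secThrough {x₀ : M} {q : EM × F} (b : E (totPt F E x₀ q).proj) :
    secCoord x₀ (secThrough EM F E (totPt F E x₀ q).proj b) q.1 = fibreCoord F E x₀ _ b :=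
  congrArg (fibreCoord F E x₀ (totPt F E x₀ q).proj)
    (secThrough_apply (EM := EM) (totPt F E x₀ q).proj b)

theorem fibreCoord_totPt {x₀ : M} {q : EM × F} (hq : q ∈ totDom EM F E x₀) :
    fibreCoord F E x₀ _ (totPt F E x₀ q).2 = q.2 :=
  fibreCoord_ofFibreCoord (EM := EM) (x := (totPt F E x₀ q).proj) hq.1.2 q.2

variable {A : LieAlgebroid EM F E}

/-- The SODE condition `ẋ = ρ(y)`. -/
theorem SODE.totCoord_field_fst (Γ : A.SODE) {x₀ : M} {q : EM × F} (hq : q ∈ totDom EM F E x₀) :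
    (totCoord EM x₀ (totPt F E x₀ q) (Γ.field (totPt F E x₀ q))).1 = A.anchorCoord x₀ q.1 q.2 := by
  rw [SODE.field, ← A.anchorCoord_baseVec hq, Γ.baseVec_eq, fibreCoord_totPt hq]

/-- The local expression of `Θ_{Γ,F}`. -/
theorem Theta_totPt (Γ : A.SODE) {W : Set (TotalSpace F E)} (Φ : FibredLocalDiffeo EM F E W)
    {x₀ : M} {q : EM × F} (hq : q ∈ totDom EM F E x₀) (hqW : totPt F E x₀ q ∈ W)
    (hG : DifferentiableAt ℝ (dualCoord (EM := EM) x₀ Φ.toFun) q)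
    (z : A.prolE (totPt F E x₀ q)) :
    Theta Γ Φ (totPt F E x₀ q) z =
      fderiv ℝ (dualCoord x₀ Φ.toFun) q (totCoord EM x₀ _ (Γ.field (totPt F E x₀ q)))
        (fibreCoord F E x₀ _ (A.baseVec z)) +
      dualCoord x₀ Φ.toFun q
        (A.bracketCoord x₀ q.1 (fibreCoord F E x₀ _ (A.baseVec z)) q.2) +
      dualCoord x₀ Φ.toFun q (totCoord EM x₀ _ (A.prolAnchor z)).2 := by
  set X := secThrough EM F E (totPt F E x₀ q).proj (A.baseVec z) with hX
  set Y := secThrough EM F E (totPt F E x₀ q).proj (totPt F E x₀ q).2 with hY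
  set θ := secThrough EM (F →L[ℝ] ℝ) (DualFib E) (totPt F E x₀ q).proj (Φ.toFun (totPt F E x₀ q)) with hθ
  have hmd : MDifferentiableAt (totModel EM F) (totModel EM (F →L[ℝ] ℝ))
      (toDualMap (F := F) Φ.toFun) (totPt F E x₀ q) := (Φ.isLocalDiffeo ⟨(totPt F E x₀ q), hqW⟩).mdifferentiableAt (by simp)
  have hT : Theta Γ Φ (totPt F E x₀ q) z =
      dirDeriv (totModel EM (F →L[ℝ] ℝ)) (fun β : DualTot F E => β.2 (X β.proj))
        (toDualMap (F := F) Φ.toFun (totPt F E x₀ q))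
        (mfderiv (totModel EM F) (totModel EM (F →L[ℝ] ℝ)) (toDualMap (F := F) Φ.toFun) (totPt F E x₀ q)
          (Γ.field (totPt F E x₀ q)))
      + Φ.toFun (totPt F E x₀ q) (A.bracket X Y (totPt F E x₀ q).proj)
      + (dirDeriv (totModel EM F) (fun e : TotalSpace F E => θ e.proj e.2) (totPt F E x₀ q) (A.prolAnchor z)
        - dirDeriv 𝓘(ℝ, EM) (fun x => θ x (Y x)) (totPt F E x₀ q).proj (A.anchor (totPt F E x₀ q).proj (A.baseVec z))) := by
    unfold Theta
    rw [dif_pos hqW, hY, ← Γ.baseVec_eq (totPt F E x₀ q)]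
    rfl
  have hXc : secCoord x₀ X q.1 = fibreCoord F E x₀ _ (A.baseVec z) := secCoord_secThrough _
  have hYc : secCoord x₀ Y q.1 = q.2 := (secCoord_secThrough _).trans (fibreCoord_totPt hq)
  have hdiff : ∀ V : Sec EM F E, DifferentiableAt ℝ (secCoord x₀ V) q.1 := fun V =>
    ((contDiffOn_secCoord x₀ V).contDiffAt ((isOpen_frameDom x₀).mem_nhds hq.1)).differentiableAt
      (by simp)
  have hθd : DifferentiableAt ℝ (dualSecCoord x₀ θ) q.1 :=
    ((contDiffOn_dualSecCoord x₀ θ).contDiffAt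
      ((isOpen_frameDom x₀).mem_nhds hq.1)).differentiableAt (by simp)
  have hθq : dualSecCoord x₀ θ q.1 = dualCoord x₀ Φ.toFun q :=
    congrArg (fun l : DualFib E (totPt F E x₀ q).proj => l.comp (ofFibreCoord F E x₀ (totPt F E x₀ q).proj))
      (secThrough_apply (EM := EM) (F := F →L[ℝ] ℝ) (E := DualFib E) (totPt F E x₀ q).proj (Φ.toFun (totPt F E x₀ q)))
  have t1 := (dirDeriv_linearFun_comp hmd X (Γ.field (totPt F E x₀ q))).trans (dirDeriv_pairing hq hG X _)
  have t2 : Φ.toFun (totPt F E x₀ q) (A.bracket X Y (totPt F E x₀ q).proj) =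
      dualCoord x₀ Φ.toFun q (secCoord x₀ (A.bracket X Y) q.1) :=
    (dualCoord_fibreCoord hq Φ.toFun _).symm
  have t3 : dirDeriv (totModel EM F) (fun e : TotalSpace F E => θ e.proj e.2) (totPt F E x₀ q) (A.prolAnchor z) =
      fderiv ℝ (dualSecCoord x₀ θ) q.1 (totCoord EM x₀ (totPt F E x₀ q) (A.prolAnchor z)).1 q.2 +
        dualCoord x₀ Φ.toFun q (totCoord EM x₀ (totPt F E x₀ q) (A.prolAnchor z)).2 := by
    have h1 : HasFDerivAt (fun q : EM × F => dualSecCoord x₀ θ q.1)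
        ((fderiv ℝ (dualSecCoord x₀ θ) q.1).comp (ContinuousLinearMap.fst ℝ EM F)) q :=
      HasFDerivAt.comp (g := dualSecCoord x₀ θ) (f := Prod.fst) q hθd.hasFDerivAt hasFDerivAt_fst
    have h2 := h1.clm_apply (hasFDerivAt_snd (𝕜 := ℝ) (p := q))
    rw [dirDeriv_totPt hq h2.differentiableAt ?_ (A.prolAnchor z), h2.fderiv]
    · simp only [add_apply, ContinuousLinearMap.comp_apply,
        ContinuousLinearMap.flip_apply, ContinuousLinearMap.coe_fst',
        ContinuousLinearMap.coe_snd', hθq]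
      rw [add_comm]
    · filter_upwards [(isOpen_totDom x₀).mem_nhds hq] with q' hq'
      rfl
  have t4 : dirDeriv 𝓘(ℝ, EM) (fun x => θ x (Y x)) (totPt F E x₀ q).proj (A.anchor (totPt F E x₀ q).proj (A.baseVec z)) =
      fderiv ℝ (dualSecCoord x₀ θ) q.1 (totCoord EM x₀ (totPt F E x₀ q) (A.prolAnchor z)).1 q.2 +
        dualCoord x₀ Φ.toFun q (fderiv ℝ (secCoord x₀ Y) q.1
          (totCoord EM x₀ (totPt F E x₀ q) (A.prolAnchor z)).1) := by
    have h2 := hθd.hasFDerivAt.clm_apply (hdiff Y).hasFDerivAt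
    refine (A.dirDeriv_anchor_of_eventuallyEq hq.1 h2.differentiableAt ?_ (A.baseVec z)).trans ?_
    · filter_upwards [(isOpen_frameDom x₀).mem_nhds hq.1] with p hp
      exact (dualSecCoord_fibreCoord hp θ _).symm
    · rw [h2.fderiv]
      have h3 := A.anchorCoord_baseVec hq z
      rw [← h3]
      simp only [add_apply, ContinuousLinearMap.comp_apply,
        ContinuousLinearMap.flip_apply, hθq, hYc]
      rw [add_comm]
      rfl
  -- the derivatives of the auxiliary sections `X`, `Y` and `θ` cancel
  rw [hT, t1, t2, t3, t4, A.secCoord_bracket hq.1, hXc, hYc, Γ.totCoord_field_fst hq,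
    A.anchorCoord_baseVec hq]
  simp only [map_add, map_sub]
  ring

/-- The local expression of the Euler-Lagrange operator. -/
theorem eulerLagrange_totPt (L : TotalSpace F E → ℝ) {U : Set (EM × F)} {x₀ : M} (hU : IsOpen U)
    (hUD : U ⊆ totDom EM F E x₀) (hL : ContDiffOn ℝ ∞ (fun q => L (totPt F E x₀ q)) U)
    {q : EM × F} (hq : q ∈ U) (v : TangentSpace (totModel EM F) (totPt F E x₀ q))
    (hv : (totCoord EM x₀ _ v).1 = A.anchorCoord x₀ q.1 q.2) (X Y : Sec EM F E)
    (hY : Y (totPt F E x₀ q).proj = (totPt F E x₀ q).2) :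
    A.eulerLagrange L (totPt F E x₀ q) v X Y =
      fderiv ℝ (fderiv ℝ (fun q => L (totPt F E x₀ q))) q (totCoord EM x₀ _ v)
        (0, secCoord x₀ X q.1) -
      fderiv ℝ (fun q => L (totPt F E x₀ q)) q (A.anchorCoord x₀ q.1 (secCoord x₀ X q.1), 0) +
      fderiv ℝ (fun q => L (totPt F E x₀ q)) q
        (0, A.bracketCoord x₀ q.1 (secCoord x₀ X q.1) q.2) := by
  set f := fun q : EM × F => L (totPt F E x₀ q) with hf
  have hqD := hUD hq
  have hfd : ∀ q ∈ U, DifferentiableAt ℝ f q := fun q hq =>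
    (hL.contDiffAt (hU.mem_nhds hq)).differentiableAt (by simp)
  have hfd2 : DifferentiableAt ℝ (fderiv ℝ f) q :=
    ((hL.fderiv_of_isOpen hU (m := ∞) (by simp)).contDiffAt (hU.mem_nhds hq)).differentiableAt
      (by simp)
  have hdiff : ∀ V : Sec EM F E, DifferentiableAt ℝ (secCoord x₀ V) q.1 := fun V =>
    ((contDiffOn_secCoord x₀ V).contDiffAt ((isOpen_frameDom x₀).mem_nhds hqD.1)).differentiableAt
      (by simp)
  have hYc : secCoord x₀ Y q.1 = q.2 :=
    (congrArg (fibreCoord F E x₀ (totPt F E x₀ q).proj) hY).trans (fibreCoord_totPt hqD)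
  have t1 : dirDeriv (totModel EM F) (fun a' => fibreDeriv L a' (X a'.proj)) (totPt F E x₀ q) v =
      fderiv ℝ (fderiv ℝ f) q (totCoord EM x₀ (totPt F E x₀ q) v) (0, secCoord x₀ X q.1) +
        fderiv ℝ f q (0, fderiv ℝ (secCoord x₀ X) q.1 (totCoord EM x₀ (totPt F E x₀ q) v).1) := by
    have hη : HasFDerivAt (fun q : EM × F => ((0 : EM), secCoord x₀ X q.1))
        ((ContinuousLinearMap.inr ℝ EM F).comp ((fderiv ℝ (secCoord x₀ X) q.1).comp
          (ContinuousLinearMap.fst ℝ EM F))) q := by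
      have h1 : HasFDerivAt (fun q : EM × F => secCoord x₀ X q.1)
          ((fderiv ℝ (secCoord x₀ X) q.1).comp (ContinuousLinearMap.fst ℝ EM F)) q :=
        HasFDerivAt.comp (g := secCoord x₀ X) (f := Prod.fst) q (hdiff X).hasFDerivAt
          hasFDerivAt_fst
      exact HasFDerivAt.comp (g := ContinuousLinearMap.inr ℝ EM F) q
        (ContinuousLinearMap.inr ℝ EM F).hasFDerivAt h1
    have h2 := hfd2.hasFDerivAt.clm_apply hη
    rw [dirDeriv_totPt hqD h2.differentiableAt ?_ v, h2.fderiv]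
    · simp only [add_apply, ContinuousLinearMap.comp_apply,
        ContinuousLinearMap.flip_apply, ContinuousLinearMap.coe_fst',
        ContinuousLinearMap.inr_apply]
      rw [add_comm]
    · filter_upwards [hU.mem_nhds hq] with q' hq'
      exact fibreDeriv_totPt (hUD hq') (hfd q' hq') _
  have t2 : dirDeriv 𝓘(ℝ, EM) (fun x => L ⟨x, Y x⟩) (totPt F E x₀ q).proj (A.anchor (totPt F E x₀ q).proj (X (totPt F E x₀ q).proj)) =
      fderiv ℝ f q (A.anchorCoord x₀ q.1 (secCoord x₀ X q.1),
        fderiv ℝ (secCoord x₀ Y) q.1 (A.anchorCoord x₀ q.1 (secCoord x₀ X q.1))) := by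
    have h1 : HasFDerivAt (fun p : EM => (p, secCoord x₀ Y p))
        ((ContinuousLinearMap.id ℝ EM).prod (fderiv ℝ (secCoord x₀ Y) q.1)) q.1 :=
      (hasFDerivAt_id q.1).prodMk (hdiff Y).hasFDerivAt
    have h2 : HasFDerivAt f (fderiv ℝ f q) (q.1, secCoord x₀ Y q.1) := by
      rw [hYc]; exact (hfd q hq).hasFDerivAt
    have h3 : HasFDerivAt (fun p : EM => f (p, secCoord x₀ Y p)) _ q.1 :=
      HasFDerivAt.comp (g := f) (f := fun p : EM => (p, secCoord x₀ Y p)) q.1 h2 h1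
    refine (A.dirDeriv_anchor_of_eventuallyEq hqD.1 h3.differentiableAt ?_ (X (totPt F E x₀ q).proj)).trans ?_
    · filter_upwards [(isOpen_frameDom x₀).mem_nhds hqD.1] with p hp
      change L _ = L (⟨_, ofFibreCoord F E x₀ _ (fibreCoord F E x₀ _ (Y _))⟩ : TotalSpace F E)
      rw [ofFibreCoord_fibreCoord hp.2]
    · rw [h3.fderiv]
      rfl
  have t3 : fibreDeriv L (totPt F E x₀ q) (A.bracket X Y (totPt F E x₀ q).proj) =
      fderiv ℝ f q (0, secCoord x₀ (A.bracket X Y) q.1) := fibreDeriv_totPt hqD (hfd q hq) _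
  unfold eulerLagrange
  -- the derivatives of `X` and `Y` cancel
  rw [t1, t2, t3, A.secCoord_bracket hqD.1, hYc, hv]
  have hs : ∀ u v : F, ((0 : EM), u + v) = ((0 : EM), u) + ((0 : EM), v) := fun u v => by simp
  have hs' : ∀ u v : F, ((0 : EM), u - v) = ((0 : EM), u) - ((0 : EM), v) := fun u v => by simp
  have hs2 : ∀ (u : EM) (v : F), (u, v) = (u, (0 : F)) + ((0 : EM), v) := fun u v => by simp
  rw [hs', hs, hs2 (A.anchorCoord x₀ q.1 _) (fderiv ℝ (secCoord x₀ Y) q.1 _)]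
  simp only [map_add, map_sub]
  ring

end LieAlgebroid

end ThetaCoord

/-! ### From solutions of the inverse problem to closed forms -/

/-- The Lie bracket of vector fields is the commutator of the derivations. -/
theorem dirDeriv_mlieBracket {EN HN N : Type*} [NormedAddCommGroup EN] [NormedSpace ℝ EN]
    [CompleteSpace EN] [TopologicalSpace HN]
    {J : ModelWithCorners ℝ EN HN} [J.Boundaryless] [TopologicalSpace N] [ChartedSpace HN N]
    [IsManifold J ∞ N] {O : Set N} (hO : IsOpen O) {f : N → ℝ} (hf : ContMDiffOn J 𝓘(ℝ, ℝ) ∞ f O)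
    {V W : ∀ q : N, TangentSpace J q}
    (hV : ContMDiffOn J J.tangent ∞ (fun q => (⟨q, V q⟩ : TangentBundle J N)) O)
    (hW : ContMDiffOn J J.tangent ∞ (fun q => (⟨q, W q⟩ : TangentBundle J N)) O) {p : N}
    (hp : p ∈ O) :
    dirDeriv J (fun q => dirDeriv J f q (W q)) p (V p) -
      dirDeriv J (fun q => dirDeriv J f q (V q)) p (W p) =
      dirDeriv J f p (VectorField.mlieBracket J V W p) := by
  set D := (extChartAt J p).target ∩ (extChartAt J p).symm ⁻¹' O with hD
  have hDo : IsOpen D := (continuousOn_extChartAt_symm p).isOpen_inter_preimage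
    (isOpen_extChartAt_target p) hO
  have hps : p ∈ (extChartAt J p).source := mem_extChartAt_source p
  have hpD : extChartAt J p p ∈ D := ⟨mem_extChartAt_target p, by
    rw [mem_preimage, (extChartAt J p).left_inv hps]; exact hp⟩
  have hsymm : ContMDiffOn 𝓘(ℝ, EN) J ∞ (extChartAt J p).symm D :=
    (contMDiffOn_extChartAt_symm p).mono inter_subset_left
  have hfc : ContDiffOn ℝ ∞ (f ∘ (extChartAt J p).symm) D :=
    contMDiffOn_iff_contDiffOn.1 (hf.comp hsymm fun _ hz => hz.2)
  have hvec : ∀ X : ∀ q : N, TangentSpace J q,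
      ContMDiffOn J J.tangent ∞ (fun q => (⟨q, X q⟩ : TangentBundle J N)) O →
      ContDiffOn ℝ ∞ (fun z => tangentCoord J p _ (X ((extChartAt J p).symm z))) D := fun X hX =>
    contMDiffOn_iff_contDiffOn.1 (((contMDiffOn_vectorField_iff (p₀ := p)
      (hO.inter (isOpen_extChartAt_source p)) inter_subset_right X).1
        (hX.mono inter_subset_left)).comp hsymm fun z hz =>
          ⟨hz.2, (extChartAt J p).map_target hz.1⟩)
  have hVc := hvec V hV
  have hWc := hvec W hW
  have hd : ∀ {G : Type _} [NormedAddCommGroup G] [NormedSpace ℝ G] {g : EN → G},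
      ContDiffOn ℝ ∞ g D → DifferentiableAt ℝ g (extChartAt J p p) := fun hg =>
    (hg.contDiffAt (hDo.mem_nhds hpD)).differentiableAt (by simp)
  have hf1 : ContDiffOn ℝ ∞ (fderiv ℝ (f ∘ (extChartAt J p).symm)) D :=
    hfc.fderiv_of_isOpen hDo (by simp)
  have key : ∀ X Y : ∀ q : N, TangentSpace J q,
      ContDiffOn ℝ ∞ (fun z => tangentCoord J p _ (X ((extChartAt J p).symm z))) D →
      dirDeriv J (fun q => dirDeriv J f q (X q)) p (Y p) =
        fderiv ℝ (fderiv ℝ (f ∘ (extChartAt J p).symm)) (extChartAt J p p)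
          (tangentCoord J p p (Y p)) (tangentCoord J p p (X p)) +
        fderiv ℝ (f ∘ (extChartAt J p).symm) (extChartAt J p p)
          (fderiv ℝ (fun z => tangentCoord J p _ (X ((extChartAt J p).symm z)))
            (extChartAt J p p) (tangentCoord J p p (Y p))) := by
    intro X Y hX
    have h1 := (hd hf1).hasFDerivAt.clm_apply (hd hX).hasFDerivAt
    have h2 : tangentCoord J p ((extChartAt J p).symm (extChartAt J p p))
        (X ((extChartAt J p).symm (extChartAt J p p))) = tangentCoord J p p (X p) := by
      rw [(extChartAt J p).left_inv hps]
    rw [dirDeriv_eq_fderiv_of_eventuallyEq hps h1.differentiableAt, h1.fderiv]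
    · simp only [add_apply, ContinuousLinearMap.comp_apply, ContinuousLinearMap.flip_apply]
      rw [add_comm]
      congr 1
      exact congrArg (fderiv ℝ (fderiv ℝ (f ∘ (extChartAt J p).symm)) (extChartAt J p p)
        (tangentCoord J p p (Y p))) h2
    · filter_upwards [hO.mem_nhds hp, (isOpen_extChartAt_source (I := J) p).mem_nhds hps]
        with q hq hqs
      rw [dirDeriv_eq_fderiv hqs ((hf.contMDiffAt (hO.mem_nhds hq)).mdifferentiableAt (by simp)),
        Function.comp_apply, (extChartAt J p).left_inv hqs]
  have hbr := tangentCoord_mlieBracket hps ((hV.contMDiffAt (hO.mem_nhds hp)).mdifferentiableAt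
    (by simp)) ((hW.contMDiffAt (hO.mem_nhds hp)).mdifferentiableAt (by simp))
  have hsym : IsSymmSndFDerivAt ℝ (f ∘ (extChartAt J p).symm) (extChartAt J p p) :=
    (hfc.contDiffAt (hDo.mem_nhds hpD)).isSymmSndFDerivAt (by
      rw [minSmoothness_of_isRCLikeNormedField]; exact ENat.LEInfty.out)
  have hself : ∀ X : ∀ q : N, TangentSpace J q,
      tangentCoord J p ((extChartAt J p).symm (extChartAt J p p))
        (X ((extChartAt J p).symm (extChartAt J p p))) = tangentCoord J p p (X p) := fun X => by
    rw [(extChartAt J p).left_inv hps]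
  rw [key W V hWc, key V W hVc, dirDeriv_eq_fderiv hps
    ((hf.contMDiffAt (hO.mem_nhds hp)).mdifferentiableAt (by simp)), hbr, VectorField.lieBracket,
    hsym.eq (tangentCoord J p p (V p))]
  rw [map_sub, hself V, hself W]
  ring

section Solutions

variable {EM : Type*} [NormedAddCommGroup EM] [NormedSpace ℝ EM] [FiniteDimensional ℝ EM]
  {M : Type*} [TopologicalSpace M] [ChartedSpace EM M] [IsManifold 𝓘(ℝ, EM) ∞ M] [T2Space M]
  {F : Type*} [NormedAddCommGroup F] [NormedSpace ℝ F] [FiniteDimensional ℝ F]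
  {E : M → Type*} [TopologicalSpace (TotalSpace F E)] [∀ x, TopologicalSpace (E x)]
  [∀ x, AddCommGroup (E x)] [∀ x, Module ℝ (E x)]
  [FiberBundle F E] [VectorBundle ℝ F E] [ContMDiffVectorBundle ∞ F E 𝓘(ℝ, EM)]

namespace LieAlgebroid

variable {A : LieAlgebroid EM F E}

/-- A section of `(𝓛^τ E)*` which is `z ↦ ρ^τ(z)(L)` on `W` is closed and vanishes on `Ker ρ^τ`,
locally in `W`. -/
theorem isClosedOn_of_eq_dirDeriv {Θ : ∀ a : TotalSpace F E, Module.Dual ℝ (A.prolE a)}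
    {W : Set (TotalSpace F E)}
    (h : ∀ a ∈ W, ∃ U : Set (TotalSpace F E), IsOpen U ∧ a ∈ U ∧ ∃ L : TotalSpace F E → ℝ,
      ContMDiffOn (totModel EM F) 𝓘(ℝ, ℝ) ∞ L U ∧
      ∀ a' ∈ U, ∀ z : A.prolE a', Θ a' z = dirDeriv (totModel EM F) L a' (A.prolAnchor z)) :
    A.IsClosedOn Θ W ∧ A.VanishesOnKer Θ W := by
  constructor
  · intro V hV hVW Z₁ Z₂ Z₃ h₁ h₂ hbr a ha
    obtain ⟨k, l, h', X, s, Y, -, -, -, -, hZ⟩ := hbr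
    obtain ⟨U, hU, haU, L, hL, hΘ⟩ := h a (hVW ha)
    have hO := hU.inter hV
    have hloc : ∀ Z : ∀ a : TotalSpace F E, A.prolE a, ∀ v,
        dirDeriv (totModel EM F) (fun a' => Θ a' (Z a')) a v =
          dirDeriv (totModel EM F) (fun a' => dirDeriv (totModel EM F) L a' (A.prolAnchor (Z a')))
            a v := fun Z v => by
      have : (fun a' => Θ a' (Z a')) =ᶠ[𝓝 a]
          (fun a' => dirDeriv (totModel EM F) L a' (A.prolAnchor (Z a'))) := by
        filter_upwards [hU.mem_nhds haU] with a' ha' using hΘ a' ha' _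
      exact DFunLike.congr_fun (this.mfderiv_eq (I := totModel EM F) (I' := 𝓘(ℝ, ℝ))) v
    rw [hloc, hloc, hΘ a haU, (hZ a ha).2]
    have key := dirDeriv_mlieBracket hO (hL.mono inter_subset_left)
      (h₁.2.mono inter_subset_right) (h₂.2.mono inter_subset_right) ⟨haU, ha⟩
    rw [← key, sub_self]
  · intro V hV hVW Z hZ hker a ha
    obtain ⟨U, hU, haU, L, hL, hΘ⟩ := h a (hVW ha)
    rw [hΘ a haU, hker a ha]
    exact map_zero (mfderiv (totModel EM F) 𝓘(ℝ, ℝ) L a)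

/-- In coordinates, a Legendre transformation is the fibre part of the differential. -/
theorem dualCoord_eq_fderiv {L : TotalSpace F E → ℝ} {U : Set (EM × F)} {x₀ : M} (hU : IsOpen U)
    (hUD : U ⊆ totDom EM F E x₀) (hL : ContDiffOn ℝ ∞ (fun q => L (totPt F E x₀ q)) U)
    {G : ∀ a : TotalSpace F E, DualFib E a.proj}
    (hG : ∀ q ∈ U, ∀ b, G (totPt F E x₀ q) b = fibreDeriv L (totPt F E x₀ q) b) {q : EM × F}
    (hq : q ∈ U) : dualCoord (EM := EM) x₀ G q =
      (fderiv ℝ (fun q => L (totPt F E x₀ q)) q).comp (ContinuousLinearMap.inr ℝ EM F) := by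
  ext c
  have h1 := hG q hq (ofFibreCoord F E x₀ _ c)
  rw [fibreDeriv_totPt (hUD hq) ((hL.contDiffAt (hU.mem_nhds hq)).differentiableAt (by simp)),
    fibreCoord_ofFibreCoord (EM := EM) (x := (totPt F E x₀ q).proj) (hUD hq).1.2] at h1
  exact h1

/-- The derivative of a Legendre transformation is the second derivative `∂²L/∂(x, y)∂y`. -/
theorem fderiv_dualCoord {L : TotalSpace F E → ℝ} {U : Set (EM × F)} {x₀ : M} (hU : IsOpen U)
    (hUD : U ⊆ totDom EM F E x₀) (hL : ContDiffOn ℝ ∞ (fun q => L (totPt F E x₀ q)) U)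
    {G : ∀ a : TotalSpace F E, DualFib E a.proj}
    (hG : ∀ q ∈ U, ∀ b, G (totPt F E x₀ q) b = fibreDeriv L (totPt F E x₀ q) b) {q : EM × F}
    (hq : q ∈ U) : DifferentiableAt ℝ (dualCoord (EM := EM) x₀ G) q ∧ ∀ w c,
      fderiv ℝ (dualCoord (EM := EM) x₀ G) q w c =
        fderiv ℝ (fderiv ℝ (fun q => L (totPt F E x₀ q))) q w (0, c) := by
  have h1 : HasFDerivAt (fderiv ℝ (fun q : EM × F => L (totPt F E x₀ q))) _ q :=
    (((hL.fderiv_of_isOpen hU (m := ∞) (by simp)).contDiffAt (hU.mem_nhds hq)).differentiableAt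
      (by simp)).hasFDerivAt
  have h2 := h1.clm_comp (hasFDerivAt_const (ContinuousLinearMap.inr ℝ EM F) q)
  have h3 := h2.congr_of_eventuallyEq (f₁ := dualCoord (EM := EM) x₀ G) (by
    filter_upwards [hU.mem_nhds hq] with q' hq' using dualCoord_eq_fderiv hU hUD hL hG hq')
  refine ⟨h3.differentiableAt, fun w c => ?_⟩
  rw [h3.fderiv]
  simp

/-- If `L` solves the inverse problem and `F` is its Legendre transformation, then
`Θ_{Γ,F}(z) = ρ^τ(z)(L)`: this is the Euler-Lagrange equation along `Γ`. -/
theorem SolvesInverseProblem.Theta_eq {Γ : A.SODE} {U W : Set (TotalSpace F E)}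
    {L : TotalSpace F E → ℝ} (h : SolvesInverseProblem Γ U L) (hU : IsOpen U) (hUW : U ⊆ W)
    (Φ : FibredLocalDiffeo EM F E W) (hΦ : ∀ a ∈ U, ∀ b, Φ.toFun a b = fibreDeriv L a b)
    {a : TotalSpace F E} (ha : a ∈ U) (z : A.prolE a) :
    Theta Γ Φ a z = dirDeriv (totModel EM F) L a (A.prolAnchor z) := by
  obtain ⟨x₀, q, hq, rfl⟩ : ∃ x₀, ∃ q ∈ totDom EM F E x₀, totPt F E x₀ q = a :=
    ⟨a.proj, exists_totDom (mem_frameNhd _)⟩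
  have hO := isOpen_totPre x₀ hU (EM := EM)
  have hqO : q ∈ totPre EM x₀ U := ⟨hq, ha⟩
  have hOD : totPre EM x₀ U ⊆ totDom EM F E x₀ := inter_subset_left
  have hL := contDiffOn_comp_totPt x₀ h.smooth
  obtain ⟨hd, hd'⟩ := fderiv_dualCoord hO hOD hL (fun q hq b => hΦ _ hq.2 b) hqO
  have hG := dualCoord_eq_fderiv hO hOD hL (G := Φ.toFun) (fun q hq b => hΦ _ hq.2 b) hqO
  obtain ⟨g, -, hg⟩ := h.multipliers
  -- at `ẏ = Γ` the left-hand side of the multiplier equation vanishes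
  have hEL := hg _ ha (Γ.field _) 0 (by rw [sub_self, map_zero])
    (secThrough EM F E (totPt F E x₀ q).proj (A.baseVec z))
    (secThrough EM F E (totPt F E x₀ q).proj (totPt F E x₀ q).2) (secThrough_apply _ _)
  rw [map_zero, LinearMap.zero_apply, eulerLagrange_totPt L hO hOD hL hqO _
    (Γ.totCoord_field_fst hq) _ _ (secThrough_apply _ _), secCoord_secThrough,
    A.anchorCoord_baseVec hq] at hEL
  rw [Theta_totPt Γ Φ hq (hUW ha) hd, hd', hG, dirDeriv_totPt hq
    ((hL.contDiffAt (hO.mem_nhds hqO)).differentiableAt (by simp)) Filter.EventuallyEq.rfl]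
  simp only [ContinuousLinearMap.comp_apply, ContinuousLinearMap.inr_apply]
  have hs : totCoord EM x₀ _ (A.prolAnchor z) = ((totCoord EM x₀ _ (A.prolAnchor z)).1, (0 : F)) +
    ((0 : EM), (totCoord EM x₀ _ (A.prolAnchor z)).2) := by simp
  conv_rhs => rw [hs, map_add]
  linarith

/-- The Legendre transformation of solutions of the inverse problem makes `Θ` closed and vanishing on
`Ker ρ^τ`. -/
theorem closed_of_solutions {Γ : A.SODE} {W : Set (TotalSpace F E)}
    (Φ : FibredLocalDiffeo EM F E W)
    (h : ∀ a ∈ W, ∃ U : Set (TotalSpace F E), IsOpen U ∧ a ∈ U ∧ U ⊆ W ∧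
      ∃ L : TotalSpace F E → ℝ, SolvesInverseProblem Γ U L ∧
        ∀ a' ∈ U, ∀ b : E a'.proj, Φ.toFun a' b = fibreDeriv L a' b) :
    A.IsClosedOn (Theta Γ Φ) W ∧ A.VanishesOnKer (Theta Γ Φ) W := by
  refine isClosedOn_of_eq_dirDeriv fun a ha => ?_
  obtain ⟨U, hU, haU, hUW, L, hL, hΦ⟩ := h a ha
  exact ⟨U, hU, haU, L, hL.smooth, fun a' ha' z => hL.Theta_eq hU hUW Φ hΦ ha' z⟩

end LieAlgebroid

end Solutions

/-! ### The Legendre transformation of a regular Lagrangian -/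

section Legendre

variable {EM : Type*} [NormedAddCommGroup EM] [NormedSpace ℝ EM] [FiniteDimensional ℝ EM]
  {M : Type*} [TopologicalSpace M] [ChartedSpace EM M] [IsManifold 𝓘(ℝ, EM) ∞ M] [T2Space M]
  {F : Type*} [NormedAddCommGroup F] [NormedSpace ℝ F] [FiniteDimensional ℝ F]
  {E : M → Type*} [TopologicalSpace (TotalSpace F E)] [∀ x, TopologicalSpace (E x)]
  [∀ x, AddCommGroup (E x)] [∀ x, Module ℝ (E x)]
  [FiberBundle F E] [VectorBundle ℝ F E] [ContMDiffVectorBundle ∞ F E 𝓘(ℝ, EM)]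

variable (EM F E) in
/-- The chart of the total space of `E*` at the zero covector over `x₀`. -/
abbrev dualChart (x₀ : M) : PartialEquiv (DualTot F E) (EM × (F →L[ℝ] ℝ)) :=
  extChartAt (totModel EM (F →L[ℝ] ℝ)) (⟨x₀, 0⟩ : DualTot F E)

theorem dualChart_apply (x₀ : M) (β : DualTot F E) :
    dualChart EM F E x₀ β =
      (extChartAt 𝓘(ℝ, EM) x₀ β.proj, β.2.comp (ofFibreCoord F E x₀ β.proj)) := by
  rw [dualChart, FiberBundle.extChartAt]
  have h1 : trivializationAt (F →L[ℝ] ℝ) (DualFib E) x₀ β =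
      (β.proj, ContinuousLinearMap.inCoordinates F E ℝ (Bundle.Trivial M ℝ) x₀ β.proj x₀ β.proj
        β.2) := rfl
  refine Prod.ext (congrArg (fun z : M × (F →L[ℝ] ℝ) => extChartAt 𝓘(ℝ, EM) x₀ z.1) h1)
    ((congrArg Prod.snd h1).trans ?_)
  unfold ContinuousLinearMap.inCoordinates
  ext c
  exact congrArg (fun l : ℝ →L[ℝ] ℝ => l (β.2 (ofFibreCoord F E x₀ β.proj c))) (Bundle.Trivial.continuousLinearMapAt_trivialization ℝ M ℝ β.proj)

theorem mem_dualChart_source {x₀ : M} {β : DualTot F E} (hβ : β.proj ∈ frameNhd EM F E x₀) :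
    β ∈ (dualChart EM F E x₀).source := by
  have h1 := mem_source_of_mem_frameNhd hβ
  have h2 : β.proj ∈ (trivializationAt (F →L[ℝ] ℝ) (DualFib E) x₀).baseSet :=
    ⟨mem_baseSet_of_mem_frameNhd hβ, mem_univ _⟩
  rw [dualChart, FiberBundle.extChartAt]
  refine ⟨(trivializationAt (F →L[ℝ] ℝ) (DualFib E) x₀).mem_source.2 h2, ?_⟩
  change (trivializationAt (F →L[ℝ] ℝ) (DualFib E) x₀ β) ∈
    (extChartAt 𝓘(ℝ, EM) x₀).source ×ˢ univ
  refine ⟨?_, mem_univ _⟩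
  rwa [(trivializationAt (F →L[ℝ] ℝ) (DualFib E) x₀).coe_fst' h2]

theorem dualChart_toDualMap {x₀ : M} {q : EM × F} (hq : q ∈ totDom EM F E x₀)
    (G : ∀ a : TotalSpace F E, DualFib E a.proj) :
    dualChart EM F E x₀ (LieAlgebroid.toDualMap (F := F) G (totPt F E x₀ q)) =
      (q.1, dualCoord x₀ G q) := by
  rw [dualChart_apply]
  exact Prod.ext ((extChartAt 𝓘(ℝ, EM) x₀).right_inv hq.1.1) rfl

/-- A map `E → E*` over `M` whose local expression `(x, y) ↦ (x, F(x, y))` has a fibre derivative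
`∂F/∂y` with trivial kernel is a local diffeomorphism. -/
theorem isLocalDiffeomorphAt_toDualMap {x₀ : M} {G : ∀ a : TotalSpace F E, DualFib E a.proj}
    {U : Set (EM × F)} (hU : IsOpen U) (hUD : U ⊆ totDom EM F E x₀)
    (hG : ContDiffOn ℝ ∞ (dualCoord (EM := EM) x₀ G) U) {q : EM × F} (hq : q ∈ U)
    (hker : ∀ w : F, fderiv ℝ (dualCoord (EM := EM) x₀ G) q (0, w) = 0 → w = 0) :
    IsLocalDiffeomorphAt (totModel EM F) (totModel EM (F →L[ℝ] ℝ)) ∞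
      (LieAlgebroid.toDualMap (F := F) G) (totPt F E x₀ q) := by
  have : CompleteSpace (EM × F) := FiniteDimensional.complete ℝ _
  have hsm : ContDiffOn ℝ ∞ (fun q : EM × F => (q.1, dualCoord (EM := EM) x₀ G q)) U :=
    contDiff_fst.contDiffOn.prodMk hG
  have hd := ((hG.contDiffAt (hU.mem_nhds hq)).differentiableAt (by simp)).hasFDerivAt
  have hd' : HasFDerivAt (fun q : EM × F => (q.1, dualCoord (EM := EM) x₀ G q))
      ((ContinuousLinearMap.fst ℝ EM F).prod (fderiv ℝ (dualCoord (EM := EM) x₀ G) q)) q :=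
    hasFDerivAt_fst.prodMk hd
  have hinj : Function.Injective
      ((ContinuousLinearMap.fst ℝ EM F).prod (fderiv ℝ (dualCoord (EM := EM) x₀ G) q)) := by
    rw [injective_iff_map_eq_zero]
    rintro ⟨v, w⟩ hvw
    have h1 : v = 0 := congrArg Prod.fst hvw
    subst h1
    rw [hker w (congrArg Prod.snd hvw)]
    rfl
  have hfin : Module.finrank ℝ (EM × F) = Module.finrank ℝ (EM × (F →L[ℝ] ℝ)) := by
    rw [Module.finrank_prod, Module.finrank_prod,
      ← (LinearMap.toContinuousLinearMap (𝕜 := ℝ) (E := F) (F' := ℝ)).finrank_eq]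
    congr 1
    exact (Subspace.dual_finrank_eq (K := ℝ) (V := F)).symm
  let e : (EM × F) ≃L[ℝ] EM × (F →L[ℝ] ℝ) := (LinearEquiv.ofInjectiveOfFinrankEq
    ((ContinuousLinearMap.fst ℝ EM F).prod (fderiv ℝ (dualCoord (EM := EM) x₀ G) q)).toLinearMap
    hinj hfin).toContinuousLinearEquiv
  obtain ⟨Ψ, hΨ, hqΨ, hΨU, hΨs, -⟩ := hsm.exists_openPartialHomeomorph hU hq e
    (hd'.congr_fderiv (by ext <;> rfl))
  have hΨq : ∀ q, Ψ q = (q.1, dualCoord (EM := EM) x₀ G q) := fun q => congrFun hΨ q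
  have hdom : ∀ q ∈ Ψ.source, q ∈ totDom EM F E x₀ := fun q hq => hUD (hΨU hq)
  have hN : ∀ q ∈ Ψ.source, (totPt F E x₀ q).proj ∈ frameNhd EM F E x₀ := fun q hq => (hdom q hq).1.2
  have hχ : ∀ q ∈ Ψ.source, dualChart EM F E x₀ (LieAlgebroid.toDualMap (F := F) G
      (totPt F E x₀ q)) = Ψ q := fun q hq => by
    rw [dualChart_toDualMap (hdom q hq), hΨq]
  have hsrc : ∀ a : TotalSpace F E, a.proj ∈ frameNhd EM F E x₀ →
      totChart EM F E x₀ a ∈ Ψ.source → ∃ q ∈ Ψ.source, a = totPt F E x₀ q ∧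
        totChart EM F E x₀ a = q := fun a ha h =>
    ⟨_, h, (totPt_totChart ha).2.symm, rfl⟩
  have hopenD : IsOpen ((TotalSpace.proj : DualTot F E → M) ⁻¹' frameNhd EM F E x₀) :=
    (isOpen_frameNhd x₀).preimage (FiberBundle.continuous_proj (F →L[ℝ] ℝ) (DualFib E))
  have hχs : ContMDiffOn (totModel EM (F →L[ℝ] ℝ)) 𝓘(ℝ, EM × (F →L[ℝ] ℝ)) ∞
      (dualChart EM F E x₀) ((TotalSpace.proj : DualTot F E → M) ⁻¹' frameNhd EM F E x₀) :=
    (contMDiffOn_extChartAt (n := ∞)).mono fun β hβ => by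
      have := mem_dualChart_source (β := β) hβ
      rwa [dualChart, extChartAt_source] at this
  have hψs := contMDiffOn_totChart (EM := EM) (F := F) (E := E) x₀
  refine ⟨
    { toFun := LieAlgebroid.toDualMap (F := F) G
      invFun := fun β => totPt F E x₀ (Ψ.symm (dualChart EM F E x₀ β))
      source := ((TotalSpace.proj : TotalSpace F E → M) ⁻¹' frameNhd EM F E x₀) ∩
        totChart EM F E x₀ ⁻¹' Ψ.source
      target := ((TotalSpace.proj : DualTot F E → M) ⁻¹' frameNhd EM F E x₀) ∩
        dualChart EM F E x₀ ⁻¹' Ψ.target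
      map_source' := ?_
      map_target' := ?_
      left_inv' := ?_
      right_inv' := ?_
      open_source := hψs.continuousOn.isOpen_inter_preimage (isOpen_proj_preimage x₀) Ψ.open_source
      open_target := hχs.continuousOn.isOpen_inter_preimage hopenD Ψ.open_target
      contMDiffOn_toFun := ?_
      contMDiffOn_invFun := ?_ }, ⟨(hUD hq).1.2, ?_⟩, fun _ _ => rfl⟩
  · rintro a ⟨ha, h⟩
    obtain ⟨q, hq, rfl, -⟩ := hsrc a ha h
    refine ⟨ha, ?_⟩
    rw [mem_preimage, hχ q hq]
    exact Ψ.map_source hq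
  · rintro β ⟨hβ, h⟩
    have h1 := Ψ.map_target h
    refine ⟨hN _ h1, ?_⟩
    rw [mem_preimage, totChart_totPt (hdom _ h1)]
    exact h1
  · rintro a ⟨ha, h⟩
    obtain ⟨q, hq, rfl, -⟩ := hsrc a ha h
    rw [hχ q hq, Ψ.left_inv hq]
  · rintro β ⟨hβ, h⟩
    have h1 := Ψ.map_target h
    refine (dualChart EM F E x₀).injOn (mem_dualChart_source (hN _ h1)) (mem_dualChart_source hβ) ?_
    rw [hχ _ h1, Ψ.right_inv h]
  · have hcomp : ContMDiffOn (totModel EM F) (totModel EM (F →L[ℝ] ℝ)) ∞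
        (fun a => (dualChart EM F E x₀).symm (Ψ (totChart EM F E x₀ a)))
        (((TotalSpace.proj : TotalSpace F E → M) ⁻¹' frameNhd EM F E x₀) ∩
          totChart EM F E x₀ ⁻¹' Ψ.source) := by
      have h1 : ContMDiffOn 𝓘(ℝ, EM × F) 𝓘(ℝ, EM × (F →L[ℝ] ℝ)) ∞ Ψ Ψ.source := by
        rw [hΨ]; exact (hsm.mono hΨU).contMDiffOn
      refine (contMDiffOn_extChartAt_symm (n := ∞) _).comp (h1.comp (hψs.mono inter_subset_left)
        fun a ha => ha.2) ?_
      rintro a ⟨ha, h⟩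
      obtain ⟨q, hq, rfl, hqa⟩ := hsrc a ha h
      have h2 : Ψ (totChart EM F E x₀ (totPt F E x₀ q)) ∈ (dualChart EM F E x₀).target := by
        rw [hqa, ← hχ q hq]
        exact (dualChart EM F E x₀).map_source (mem_dualChart_source (hN q hq))
      exact h2
    refine hcomp.congr ?_
    rintro a ⟨ha, h⟩
    obtain ⟨q, hq, rfl, hqa⟩ := hsrc a ha h
    rw [hqa, ← hχ q hq]
    exact ((dualChart EM F E x₀).left_inv (mem_dualChart_source (hN q hq))).symm
  · refine (contMDiffOn_totPt x₀).comp (hΨs.contMDiffOn.comp (hχs.mono inter_subset_left)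
      fun β hβ => hβ.2) ?_
    rintro β ⟨hβ, h⟩
    exact hdom _ (Ψ.map_target h)
  · rw [mem_preimage, totChart_totPt (hUD hq)]
    exact hqΨ

/-- The Legendre transformation of `L`: the fibre derivative as a covector, computed in the
trivialization at the base point. It has a meaning only where `L` is differentiable. -/
def legendre (L : TotalSpace F E → ℝ) (a : TotalSpace F E) : DualFib E a.proj :=
  ((fderiv ℝ (fun q : EM × F => L (totPt F E a.proj q)) (totChart EM F E a.proj a)).comp
    (ContinuousLinearMap.inr ℝ EM F)).comp (fibreCoord F E a.proj a.proj)

theorem legendre_apply {U : Set (TotalSpace F E)} (hU : IsOpen U) {L : TotalSpace F E → ℝ}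
    (hL : ContMDiffOn (totModel EM F) 𝓘(ℝ, ℝ) ∞ L U) {a : TotalSpace F E} (ha : a ∈ U)
    (b : E a.proj) : legendre (EM := EM) L a b = fibreDeriv L a b := by
  have hq := totPt_totChart (EM := EM) (mem_frameNhd a.proj)
  have key : ∀ (x₀ : M) (q : EM × F), q ∈ totDom EM F E x₀ → ∀ a : TotalSpace F E,
      totPt F E x₀ q = a → a ∈ U → ∀ b : E a.proj,
      fderiv ℝ (fun q : EM × F => L (totPt F E x₀ q)) q (0, fibreCoord F E x₀ a.proj b) =
        fibreDeriv L a b := by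
    rintro x₀ q hq _ rfl ha b
    exact (fibreDeriv_totPt hq (((contDiffOn_comp_totPt x₀ hL).contDiffAt
      ((isOpen_totPre x₀ hU).mem_nhds ⟨hq, ha⟩)).differentiableAt (by simp)) b).symm
  exact key a.proj _ hq.1 a hq.2 ha b

namespace LieAlgebroid

variable {A : LieAlgebroid EM F E}

/-- Regularity of `L` makes its Legendre transformation a local diffeomorphism. -/
theorem isLocalDiffeomorphOn_legendre {U : Set (TotalSpace F E)} (hU : IsOpen U)
    {L : TotalSpace F E → ℝ} (hL : ContMDiffOn (totModel EM F) 𝓘(ℝ, ℝ) ∞ L U)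
    (hreg : ∀ a ∈ U, ∀ b : E a.proj, (∀ c : E a.proj, fibreHessian L a b c = 0) → b = 0) :
    IsLocalDiffeomorphOn (totModel EM F) (totModel EM (F →L[ℝ] ℝ)) ∞
      (toDualMap (F := F) (legendre (EM := EM) L)) U := by
  rintro ⟨a, ha⟩
  obtain ⟨x₀, q, hq, rfl⟩ : ∃ x₀, ∃ q ∈ totDom EM F E x₀, totPt F E x₀ q = a :=
    ⟨a.proj, exists_totDom (mem_frameNhd _)⟩
  have hO := isOpen_totPre x₀ hU (EM := EM)
  have hqO : q ∈ totPre EM x₀ U := ⟨hq, ha⟩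
  have hOD : totPre EM x₀ U ⊆ totDom EM F E x₀ := inter_subset_left
  have hLc := contDiffOn_comp_totPt x₀ hL
  have hG : ∀ q ∈ totPre EM x₀ U, ∀ b, legendre (EM := EM) L (totPt F E x₀ q) b =
      fibreDeriv L (totPt F E x₀ q) b := fun q hq b => legendre_apply hU hL hq.2 b
  have hsm : ContDiffOn ℝ ∞ (dualCoord (EM := EM) x₀ (legendre (EM := EM) L))
      (totPre EM x₀ U) :=
    ((hLc.fderiv_of_isOpen hO (m := ∞) (by simp)).clm_comp contDiffOn_const).congr
      fun q hq => dualCoord_eq_fderiv hO hOD hLc hG hq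
  refine isLocalDiffeomorphAt_toDualMap hO hOD hsm hqO fun w hw => ?_
  obtain ⟨hd, hd'⟩ := fderiv_dualCoord hO hOD hLc hG hqO
  have hfib : fibreCoord F E x₀ (totPt F E x₀ q).proj (ofFibreCoord F E x₀ _ w) = w :=
    fibreCoord_ofFibreCoord (EM := EM) hq.1.2 w
  have h1 := hreg _ ha (ofFibreCoord F E x₀ _ w) fun c => by
    rw [fibreHessian_totPt hO hOD hqO hLc, hfib, ← hd', hw]
    rfl
  rw [← hfib, h1, map_zero]

/-- A solution of the inverse problem on `W` yields, by its Legendre transformation, a local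
diffeomorphism for which `Θ` is closed and vanishes on `Ker ρ^τ`. -/
theorem exists_closed_of_solution {Γ : A.SODE} {W : Set (TotalSpace F E)} (hW : IsOpen W)
    {L : TotalSpace F E → ℝ} (hL : SolvesInverseProblem Γ W L) :
    ∃ Φ : FibredLocalDiffeo EM F E W,
      A.IsClosedOn (Theta Γ Φ) W ∧ A.VanishesOnKer (Theta Γ Φ) W :=
  ⟨⟨legendre (EM := EM) L, isLocalDiffeomorphOn_legendre hW hL.smooth hL.regular⟩,
    closed_of_solutions _ fun _ ha =>
      ⟨W, hW, ha, Subset.rfl, L, hL, fun _ ha' b => legendre_apply hW hL.smooth ha' b⟩⟩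

end LieAlgebroid

end Legendre

/-! ### Families of linear maps of constant rank -/

/-- A smooth family `ρ` of linear maps of constant rank has, near `p₀`, a fixed projection `P` onto
`S = range (ρ p₀)` which is injective on the range of each `ρ p`, and a smooth family `B` with
`P ρ(p) B(p) = 1`. -/
theorem exists_splitting_of_constant_rank {V F H : Type*} [NormedAddCommGroup V] [NormedSpace ℝ V]
    [NormedAddCommGroup F] [NormedSpace ℝ F] [FiniteDimensional ℝ F]
    [NormedAddCommGroup H] [NormedSpace ℝ H] [FiniteDimensional ℝ H]
    {ρ : V → F →L[ℝ] H} {D : Set V} (hD : IsOpen D) (hρ : ContDiffOn ℝ ∞ ρ D) {r : ℕ}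
    (hr : ∀ p ∈ D, Module.finrank ℝ (LinearMap.range (ρ p).toLinearMap) = r) {p₀ : V}
    (hp₀ : p₀ ∈ D) :
    ∃ (S : Submodule ℝ H) (P : H →L[ℝ] S) (B : V → S →L[ℝ] F) (D' : Set V),
      IsOpen D' ∧ p₀ ∈ D' ∧ D' ⊆ D ∧ ContDiffOn ℝ ∞ B D' ∧
      (∀ p ∈ D', ∀ σ, P (ρ p (B p σ)) = σ) ∧ ∀ p ∈ D', ∀ c, P (ρ p c) = 0 → ρ p c = 0 := by
  set S := LinearMap.range (ρ p₀).toLinearMap with hS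
  have : CompleteSpace S := FiniteDimensional.complete ℝ S
  obtain ⟨P, hP⟩ := S.subtype.exists_leftInverse_of_injective S.ker_subtype
  obtain ⟨B₀, hB₀⟩ := (ρ p₀).toLinearMap.rangeRestrict.exists_rightInverse_of_surjective
    (LinearMap.range_rangeRestrict _)
  let P' : H →L[ℝ] S := LinearMap.toContinuousLinearMap P
  let B' : S →L[ℝ] F := LinearMap.toContinuousLinearMap B₀
  let T : V → S →L[ℝ] S := fun p => P'.comp ((ρ p).comp B')
  have hT : ContDiffOn ℝ ∞ T D :=
    contDiffOn_const.clm_comp (hρ.clm_comp contDiffOn_const)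
  have hT₀ : T p₀ = 1 := by
    ext1 σ
    have h1 : ρ p₀ (B₀ σ) = (σ : H) := congrArg Subtype.val (LinearMap.congr_fun hB₀ σ)
    change P (ρ p₀ (B₀ σ)) = σ
    rw [h1]
    exact LinearMap.congr_fun hP σ
  have hinv : ∀ p, IsUnit (T p) → ∀ σ, T p (Ring.inverse (T p) σ) = σ := fun p hp σ =>
    DFunLike.congr_fun (Ring.mul_inverse_cancel _ hp) σ
  refine ⟨S, P', fun p => B'.comp (Ring.inverse (T p)), D ∩ T ⁻¹' {t | IsUnit t},
    hT.continuousOn.isOpen_inter_preimage hD (Units.isOpen (R := S →L[ℝ] S)), ⟨hp₀, ?_⟩, inter_subset_left, ?_, ?_, ?_⟩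
  · rw [mem_preimage, hT₀]
    exact isUnit_one
  · refine contDiffOn_const.clm_comp fun p hp => ?_
    obtain ⟨u, hu⟩ := hp.2
    have h1 : ContDiffAt ℝ ∞ Ring.inverse (T p) := by
      rw [← hu]
      exact contDiffAt_ringInverse ℝ (R := S →L[ℝ] S) u
    exact h1.comp_contDiffWithinAt p ((hT p hp.1).mono inter_subset_left)
  · exact fun p hp σ => hinv p hp.2 σ
  · intro p hp c hc
    -- `P` maps the range of `ρ p` onto `S`, and both have dimension `r`
    have hsurj : Function.Surjective (P ∘ₗ (LinearMap.range (ρ p).toLinearMap).subtype) := fun σ =>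
      ⟨⟨ρ p (B' (Ring.inverse (T p) σ)), LinearMap.mem_range_self _ _⟩, hinv p hp.2 σ⟩
    have hinj := (LinearMap.injective_iff_surjective_of_finrank_eq_finrank
      ((hr p hp.1).trans (hr p₀ hp₀).symm)).2 hsurj
    have h1 : (⟨ρ p c, LinearMap.mem_range_self (ρ p).toLinearMap c⟩ :
        LinearMap.range (ρ p).toLinearMap) = 0 := by
      apply hinj
      rw [map_zero]
      exact hc
    exact congrArg Subtype.val h1

/-! ### Sections of the prolongation in coordinates -/

section Sections

variable {EM : Type*} [NormedAddCommGroup EM] [NormedSpace ℝ EM] [FiniteDimensional ℝ EM]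
  {M : Type*} [TopologicalSpace M] [ChartedSpace EM M] [IsManifold 𝓘(ℝ, EM) ∞ M] [T2Space M]
  {F : Type*} [NormedAddCommGroup F] [NormedSpace ℝ F] [FiniteDimensional ℝ F]
  {E : M → Type*} [TopologicalSpace (TotalSpace F E)] [∀ x, TopologicalSpace (E x)]
  [∀ x, AddCommGroup (E x)] [∀ x, Module ℝ (E x)]
  [FiberBundle F E] [VectorBundle ℝ F E] [ContMDiffVectorBundle ∞ F E 𝓘(ℝ, EM)]

variable (E) in
/-- The set of points of `E` over `frameNhd` with coordinates in `D`. -/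
def totImg (x₀ : M) (D : Set (EM × F)) : Set (TotalSpace F E) :=
  ((TotalSpace.proj : TotalSpace F E → M) ⁻¹' frameNhd EM F E x₀) ∩ totChart EM F E x₀ ⁻¹' D

theorem isOpen_totImg (x₀ : M) {D : Set (EM × F)} (hD : IsOpen D) : IsOpen (totImg E x₀ D) :=
  (contMDiffOn_totChart x₀).continuousOn.isOpen_inter_preimage (isOpen_proj_preimage x₀) hD

theorem totPt_mem_totImg {x₀ : M} {D : Set (EM × F)} (hD : D ⊆ totDom EM F E x₀) {q : EM × F}
    (hq : q ∈ D) : totPt F E x₀ q ∈ totImg E x₀ D :=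
  ⟨(hD hq).1.2, by rw [mem_preimage, totChart_totPt (hD hq)]; exact hq⟩

theorem exists_of_mem_totImg {x₀ : M} {D : Set (EM × F)} {a : TotalSpace F E}
    (ha : a ∈ totImg E x₀ D) : ∃ q ∈ D, totPt F E x₀ q = a :=
  ⟨_, ha.2, (totPt_totChart ha.1).2⟩

theorem finrank_range_anchorCoord (A : LieAlgebroid EM F E) {x₀ : M} {p : EM}
    (hp : p ∈ frameDom EM F E x₀) :
    Module.finrank ℝ (LinearMap.range (A.anchorCoord x₀ p).toLinearMap) =
      Module.finrank ℝ (LinearMap.range (A.anchor ((extChartAt 𝓘(ℝ, EM) x₀).symm p))) := by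
  have h1 : LinearMap.range (A.anchorCoord x₀ p).toLinearMap =
      (LinearMap.range (A.anchor ((extChartAt 𝓘(ℝ, EM) x₀).symm p))).map
        (tangentCoord 𝓘(ℝ, EM) x₀ ((extChartAt 𝓘(ℝ, EM) x₀).symm p)).toLinearMap := by
    apply le_antisymm
    · rintro _ ⟨c, rfl⟩
      exact ⟨_, ⟨_, rfl⟩, rfl⟩
    · rintro _ ⟨_, ⟨b, rfl⟩, rfl⟩
      exact ⟨fibreCoord F E x₀ _ b, A.anchorCoord_fibreCoord hp b⟩
  rw [h1]
  exact ((LinearMap.range (A.anchor ((extChartAt 𝓘(ℝ, EM) x₀).symm p))).equivMapOfInjective _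
    (tangentCoord_injective (mem_source_of_mem_frameNhd hp.2))).finrank_eq.symm

namespace LieAlgebroid

variable {A : LieAlgebroid EM F E}

variable (A) in
/-- The smooth functions `c` and `w` on `D` are the components `(b, v)` of a section of `𝓛^τ E`. -/
structure IsSectionData (x₀ : M) (D : Set (EM × F)) (c : EM × F → F) (w : EM × F → EM × F) :
    Prop where
  contDiffOn_base : ContDiffOn ℝ ∞ c D
  contDiffOn_anchor : ContDiffOn ℝ ∞ w D
  compat : ∀ q ∈ D, A.anchorCoord x₀ q.1 (c q) = (w q).1

/-- The section `Z` has components `c` and `w` over `D`. -/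
def HasComponents (x₀ : M) (D : Set (EM × F)) (Z : ∀ a : TotalSpace F E, A.prolE a)
    (c : EM × F → F) (w : EM × F → EM × F) : Prop :=
  ∀ q ∈ D, fibreCoord F E x₀ _ (A.baseVec (Z (totPt F E x₀ q))) = c q ∧
    totCoord EM x₀ _ (A.prolAnchor (Z (totPt F E x₀ q))) = w q

theorem exists_hasComponents {x₀ : M} {D : Set (EM × F)} (hDD : D ⊆ totDom EM F E x₀)
    {c : EM × F → F} {w : EM × F → EM × F}
    (hcw : ∀ q ∈ D, A.anchorCoord x₀ q.1 (c q) = (w q).1) :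
    ∃ Z : ∀ a : TotalSpace F E, A.prolE a, HasComponents x₀ D Z c w := by
  have h : ∀ a : TotalSpace F E, ∃ z : A.prolE a, ∀ q ∈ D, totPt F E x₀ q = a →
      fibreCoord F E x₀ _ (A.baseVec z) = c q ∧ totCoord EM x₀ _ (A.prolAnchor z) = w q := by
    intro a
    by_cases ha : ∃ q ∈ D, totPt F E x₀ q = a
    · obtain ⟨q, hq, rfl⟩ := ha
      have h1 : fibreCoord F E x₀ (totPt F E x₀ q).proj (ofFibreCoord F E x₀ _ (c q)) = c q :=
        fibreCoord_ofFibreCoord (EM := EM) (hDD hq).1.2 _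
      have h2 : totCoord EM x₀ (totPt F E x₀ q) (ofTangentCoord (totModel EM F)
          (⟨x₀, 0⟩ : TotalSpace F E) _ (w q)) = w q :=
        tangentCoord_ofTangentCoord
          (mem_totChart_source (a := totPt F E x₀ q) (hDD hq).1.2) _
      refine ⟨⟨(ofFibreCoord F E x₀ _ (c q), ofTangentCoord (totModel EM F)
        (⟨x₀, 0⟩ : TotalSpace F E) _ (w q)), A.mem_prolE (hDD hq) _ _ ?_⟩, fun q' hq' h => ?_⟩
      · rw [h1, h2, hcw q hq]
      · have h3 : q' = q := by
          rw [← totChart_totPt (hDD hq'), h, totChart_totPt (hDD hq)]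
        subst h3
        exact ⟨h1, h2⟩
    · exact ⟨0, fun q hq h => absurd ⟨q, hq, h⟩ ha⟩
  choose Z hZ using h
  exact ⟨Z, fun q hq => hZ _ q hq rfl⟩

theorem HasComponents.smoothOn {x₀ : M} {D : Set (EM × F)} (hD : IsOpen D)
    (hDD : D ⊆ totDom EM F E x₀)
    {c : EM × F → F} {w : EM × F → EM × F} (hcw : A.IsSectionData x₀ D c w)
    {Z : ∀ a : TotalSpace F E, A.prolE a} (hZ : HasComponents x₀ D Z c w) :
    A.SmoothOn Z (totImg E x₀ D) := by
  have hχ := (contMDiffOn_totChart x₀ (EM := EM)).mono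
    (inter_subset_left : totImg E x₀ D ⊆ _)
  constructor
  · have h1 : ContMDiffOn 𝓘(ℝ, EM × F) 𝓘(ℝ, EM × F) ∞ (fun q : EM × F => (q.1, c q)) D :=
      (contDiff_fst.contDiffOn.prodMk hcw.contDiffOn_base).contMDiffOn
    refine ((contMDiffOn_totPt x₀).comp (h1.comp hχ fun a ha => ha.2) fun a ha =>
      ⟨(hDD ha.2).1, mem_univ _⟩).congr fun a ha => ?_
    obtain ⟨q, hq, rfl⟩ := exists_of_mem_totImg ha
    rw [Function.comp_apply, Function.comp_apply, totChart_totPt (hDD hq)]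
    change _ = (⟨(totPt F E x₀ q).proj, ofFibreCoord F E x₀ _ (c q)⟩ : TotalSpace F E)
    rw [← (hZ q hq).1, ofFibreCoord_fibreCoord (EM := EM) (x := (totPt F E x₀ q).proj)
      (hDD hq).1.2]
  · refine (contMDiffOn_vectorField_iff (p₀ := (⟨x₀, 0⟩ : TotalSpace F E)) (isOpen_totImg x₀ hD)
      (fun a ha => mem_totChart_source ha.1) _).2 ?_
    refine (hcw.contDiffOn_anchor.contMDiffOn.comp hχ fun a ha => ha.2).congr fun a ha => ?_
    obtain ⟨q, hq, rfl⟩ := exists_of_mem_totImg ha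
    rw [Function.comp_apply, totChart_totPt (hDD hq)]
    exact (hZ q hq).2

/-- The components of the base part of the bracket of the sections of `𝓛^τ E` with components
`(c₁, w₁)` and `(c₂, w₂)`; those of the other part are `VectorField.lieBracket ℝ w₁ w₂`. -/
def bracketBase (A : LieAlgebroid EM F E) (x₀ : M) (c₁ c₂ : EM × F → F) (w₁ w₂ : EM × F → EM × F)
    (q : EM × F) : F :=
  A.bracketCoord x₀ q.1 (c₁ q) (c₂ q) + fderiv ℝ c₂ q (w₁ q) - fderiv ℝ c₁ q (w₂ q)

/-- The components of a bracket are those of a section: the anchor is compatible with brackets. -/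
theorem IsSectionData.bracket_compat {x₀ : M} {D : Set (EM × F)} (hD : IsOpen D)
    (hDD : D ⊆ totDom EM F E x₀) {c₁ c₂ : EM × F → F} {w₁ w₂ : EM × F → EM × F}
    (h₁ : A.IsSectionData x₀ D c₁ w₁) (h₂ : A.IsSectionData x₀ D c₂ w₂) {q : EM × F} (hq : q ∈ D) :
    A.anchorCoord x₀ q.1 (bracketBase A x₀ c₁ c₂ w₁ w₂ q) =
      (VectorField.lieBracket ℝ w₁ w₂ q).1 := by
  have key : ∀ {c w}, A.IsSectionData x₀ D c w → ∀ v : EM × F,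
      (fderiv ℝ w q v).1 = fderiv ℝ (A.anchorCoord x₀) q.1 v.1 (c q) +
        A.anchorCoord x₀ q.1 (fderiv ℝ c q v) := by
    intro c w h v
    have hc := ((h.contDiffOn_base.contDiffAt (hD.mem_nhds hq)).differentiableAt
      (by simp)).hasFDerivAt
    have hw := ((h.contDiffOn_anchor.contDiffAt (hD.mem_nhds hq)).differentiableAt
      (by simp)).hasFDerivAt
    have hρ := (((A.contDiffOn_anchorCoord x₀).contDiffAt
      ((isOpen_frameDom x₀).mem_nhds (hDD hq).1)).differentiableAt (by simp)).hasFDerivAt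
    have h1 : HasFDerivAt (fun q : EM × F => A.anchorCoord x₀ q.1)
        ((fderiv ℝ (A.anchorCoord x₀) q.1).comp (ContinuousLinearMap.fst ℝ EM F)) q :=
      HasFDerivAt.comp (g := A.anchorCoord x₀) (f := Prod.fst) q hρ hasFDerivAt_fst
    have h2 := h1.clm_apply hc
    have h3 : HasFDerivAt (fun q : EM × F => (w q).1)
        ((ContinuousLinearMap.fst ℝ EM F).comp (fderiv ℝ w q)) q := hw.fst
    have h4 := h3.unique (h2.congr_of_eventuallyEq (by
      filter_upwards [hD.mem_nhds hq] with q' hq' using (h.compat q' hq').symm))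
    have h5 := DFunLike.congr_fun h4 v
    rw [add_comm]
    exact h5
  rw [VectorField.lieBracket, Prod.fst_sub, key h₁, key h₂, bracketBase, map_sub, map_add,
    A.anchorCoord_bracketCoord (hDD hq).1, h₁.compat q hq, h₂.compat q hq]
  abel

/-- The bracket of `𝓛^τ E` in components, from the expansion of the base parts in a local frame. -/
theorem isProlBracket_of_hasComponents {x₀ : M} {D : Set (EM × F)} (hD : IsOpen D)
    (hDD : D ⊆ totDom EM F E x₀) {c₁ c₂ : EM × F → F} {w₁ w₂ : EM × F → EM × F}
    (h₁ : A.IsSectionData x₀ D c₁ w₁) (h₂ : A.IsSectionData x₀ D c₂ w₂)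
    {Z₁ Z₂ Z₃ : ∀ a : TotalSpace F E, A.prolE a} (hZ₁ : HasComponents x₀ D Z₁ c₁ w₁)
    (hZ₂ : HasComponents x₀ D Z₂ c₂ w₂)
    (hZ₃ : HasComponents x₀ D Z₃ (bracketBase A x₀ c₁ c₂ w₁ w₂) (VectorField.lieBracket ℝ w₁ w₂)) :
    A.IsProlBracket (totImg E x₀ D) Z₁ Z₂ Z₃ := by
  let b := Module.finBasis ℝ F
  have hχ := (contMDiffOn_totChart x₀ (EM := EM)).mono
    (inter_subset_left : totImg E x₀ D ⊆ _)
  have hsmooth : ∀ {c : EM × F → F}, ContDiffOn ℝ ∞ c D → ∀ i,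
      ContMDiffOn (totModel EM F) 𝓘(ℝ, ℝ) ∞ (fun a => b.coord i (c (totChart EM F E x₀ a)))
        (totImg E x₀ D) := fun {c} hc i =>
    ((((LinearMap.toContinuousLinearMap (b.coord i)).contDiff.comp_contDiffOn hc).contMDiffOn).comp
      hχ fun a ha => ha.2)
  have hinj : ∀ {q}, q ∈ D → ∀ u v : E (totPt F E x₀ q).proj,
      fibreCoord F E x₀ _ u = fibreCoord F E x₀ _ v → u = v := fun {q} hq u v huv => by
    rw [← ofFibreCoord_fibreCoord (EM := EM) (x := (totPt F E x₀ q).proj) (hDD hq).1.2 u, huv,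
      ofFibreCoord_fibreCoord (EM := EM) (x := (totPt F E x₀ q).proj) (hDD hq).1.2 v]
  have hframe : ∀ {q}, q ∈ D → ∀ d, fibreCoord F E x₀ _ (frameSec EM F E x₀ d
      (totPt F E x₀ q).proj) = d := fun {q} hq d => secCoord_frameSec (hDD hq).1 d
  have hsum : ∀ v : F, ∑ i, b.coord i v • b i = v := fun v => b.sum_repr v
  have hbase : ∀ {c : EM × F → F} {w} {Z : ∀ a : TotalSpace F E, A.prolE a},
      HasComponents x₀ D Z c w → ∀ a ∈ totImg E x₀ D, A.baseVec (Z a) =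
        ∑ i, b.coord i (c (totChart EM F E x₀ a)) • frameSec EM F E x₀ (b i) a.proj := by
    intro c w Z hZ a ha
    obtain ⟨q, hq, rfl⟩ := exists_of_mem_totImg ha
    apply hinj hq
    rw [(hZ q hq).1, totChart_totPt (hDD hq), map_sum]
    simp only [map_smul, hframe hq, hsum]
  have hder : ∀ {c : EM × F → F}, ContDiffOn ℝ ∞ c D → ∀ {q}, q ∈ D → ∀ i
      (v : TangentSpace (totModel EM F) (totPt F E x₀ q)),
      dirDeriv (totModel EM F) (fun a => b.coord i (c (totChart EM F E x₀ a))) (totPt F E x₀ q) v =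
        b.coord i (fderiv ℝ c q (totCoord EM x₀ _ v)) := by
    intro c hc q hq i v
    have h1 := (LinearMap.toContinuousLinearMap (b.coord i)).hasFDerivAt.comp q
      ((hc.contDiffAt (hD.mem_nhds hq)).differentiableAt (by simp)).hasFDerivAt
    rw [dirDeriv_totPt (hDD hq) h1.differentiableAt, h1.fderiv]
    · rfl
    · filter_upwards [hD.mem_nhds hq] with q' hq'
      rw [totChart_totPt (hDD hq')]
      rfl
  refine ⟨_, _, fun i a => b.coord i (c₁ (totChart EM F E x₀ a)),
    fun i => frameSec EM F E x₀ (b i), fun i a => b.coord i (c₂ (totChart EM F E x₀ a)),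
    fun i => frameSec EM F E x₀ (b i), hsmooth h₁.contDiffOn_base, hsmooth h₂.contDiffOn_base,
    hbase hZ₁, hbase hZ₂, fun a ha => ⟨?_, ?_⟩⟩
  · obtain ⟨q, hq, rfl⟩ := exists_of_mem_totImg ha
    apply hinj hq
    have hC : ∀ i j, fibreCoord F E x₀ (totPt F E x₀ q).proj (A.bracket (frameSec EM F E x₀ (b i))
        (frameSec EM F E x₀ (b j)) (totPt F E x₀ q).proj) = A.bracketCoord x₀ q.1 (b i) (b j) :=
      fun i j => rfl
    rw [(hZ₃ q hq).1, bracketBase]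
    simp only [map_sum, map_smul, map_add, map_sub, hframe hq, hC, hder h₁.contDiffOn_base hq,
      hder h₂.contDiffOn_base hq, (hZ₁ q hq).2, (hZ₂ q hq).2, hsum, totChart_totPt (hDD hq)]
    congr 2
    conv_lhs => rw [← hsum (c₁ q), ← hsum (c₂ q)]
    simp only [map_sum, map_smul, sum_apply, smul_apply,
      smul_smul, Finset.smul_sum]
    rw [Finset.sum_comm]
    exact Finset.sum_congr rfl fun i _ => Finset.sum_congr rfl fun j _ => by rw [mul_comm]
  · obtain ⟨q, hq, rfl⟩ := exists_of_mem_totImg ha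
    have hO := (isOpen_totImg x₀ hD (E := E)).mem_nhds ha
    have hs := mem_totChart_source (a := totPt F E x₀ q) (hDD hq).1.2
    apply tangentCoord_injective (J := totModel EM F) hs
    have hbr := tangentCoord_mlieBracket (J := totModel EM F) hs
      (V := fun a' => A.prolAnchor (Z₁ a')) (W := fun a' => A.prolAnchor (Z₂ a'))
      (((hZ₁.smoothOn hD hDD h₁).2.contMDiffAt hO).mdifferentiableAt (by simp))
      (((hZ₂.smoothOn hD hDD h₂).2.contMDiffAt hO).mdifferentiableAt (by simp))
    refine ((hZ₃ q hq).2.trans ?_).trans hbr.symm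
    rw [show extChartAt (totModel EM F) (⟨x₀, 0⟩ : TotalSpace F E) (totPt F E x₀ q) = q from
      totChart_totPt (hDD hq)]
    have hev : ∀ {c : EM × F → F} {w} {Z : ∀ a : TotalSpace F E, A.prolE a},
        HasComponents x₀ D Z c w → w =ᶠ[𝓝 q] fun y => tangentCoord (totModel EM F)
          (⟨x₀, 0⟩ : TotalSpace F E) _ (A.prolAnchor (Z ((totChart EM F E x₀).symm y))) := by
      intro c w Z hZ
      filter_upwards [hD.mem_nhds hq] with q' hq'
      rw [totChart_symm (hDD hq')]
      exact (hZ q' hq').2.symm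
    exact Filter.EventuallyEq.lieBracket_vectorField_eq (hev hZ₁) (hev hZ₂)

end LieAlgebroid

end Sections

/-! ### From closed forms to solutions of the inverse problem -/

section Primitive

variable {EM : Type*} [NormedAddCommGroup EM] [NormedSpace ℝ EM] [FiniteDimensional ℝ EM]
  {M : Type*} [TopologicalSpace M] [ChartedSpace EM M] [IsManifold 𝓘(ℝ, EM) ∞ M] [T2Space M]
  {F : Type*} [NormedAddCommGroup F] [NormedSpace ℝ F] [FiniteDimensional ℝ F]
  {E : M → Type*} [TopologicalSpace (TotalSpace F E)] [∀ x, TopologicalSpace (E x)]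
  [∀ x, AddCommGroup (E x)] [∀ x, Module ℝ (E x)]
  [FiberBundle F E] [VectorBundle ℝ F E] [ContMDiffVectorBundle ∞ F E 𝓘(ℝ, EM)]

namespace LieAlgebroid

variable {A : LieAlgebroid EM F E}

/-- The components of the SODE field. -/
def SODE.fieldCoord (Γ : A.SODE) (x₀ : M) (q : EM × F) : EM × F :=
  totCoord EM x₀ _ (Γ.field (totPt F E x₀ q))

theorem SODE.contDiffOn_fieldCoord (Γ : A.SODE) (x₀ : M) :
    ContDiffOn ℝ ∞ (Γ.fieldCoord x₀) (totDom EM F E x₀) := by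
  have h1 := (contMDiffOn_vectorField_iff (p₀ := (⟨x₀, 0⟩ : TotalSpace F E))
    (isOpen_proj_preimage (EM := EM) x₀) (fun a ha => mem_totChart_source ha) _).1
      (Γ.smooth.2.mono (subset_univ _))
  exact (contDiffOn_comp_totPt x₀ h1).mono fun q hq => ⟨hq, hq.1.2⟩

/-- The components of `Θ_{Γ,F}` along the frame of `𝓛^τ E` given by a local frame of `E`. -/
def thetaCoord (Γ : A.SODE) (G : ∀ a : TotalSpace F E, DualFib E a.proj) (x₀ : M) (q : EM × F) :
    F →L[ℝ] ℝ :=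
  fderiv ℝ (dualCoord x₀ G) q (Γ.fieldCoord x₀ q) +
    (dualCoord (EM := EM) x₀ G q).comp ((A.bracketCoord x₀ q.1).flip q.2)

section

variable {Γ : A.SODE} {W : Set (TotalSpace F E)} {Φ : FibredLocalDiffeo EM F E W} {x₀ : M}

theorem FibredLocalDiffeo.contDiffOn_dualCoord (Φ : FibredLocalDiffeo EM F E W) (x₀ : M) :
    ContDiffOn ℝ ∞ (dualCoord (EM := EM) x₀ Φ.toFun) (totPre EM x₀ W) :=
  _root_.contDiffOn_dualCoord x₀ fun a ha =>
    (Φ.isLocalDiffeo ⟨a, ha⟩).contMDiffAt.contMDiffWithinAt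

theorem contDiffOn_thetaCoord (hW : IsOpen W) :
    ContDiffOn ℝ ∞ (thetaCoord Γ Φ.toFun x₀) (totPre EM x₀ W) := by
  have hG := Φ.contDiffOn_dualCoord x₀
  have hO := isOpen_totPre x₀ hW (EM := EM)
  have h1 := (hG.fderiv_of_isOpen hO (m := ∞) (by simp)).clm_apply
    ((Γ.contDiffOn_fieldCoord x₀).mono inter_subset_left)
  have h2 : ContDiffOn ℝ ∞ (fun q : EM × F => A.bracketCoord x₀ q.1) (totPre EM x₀ W) :=
    (A.contDiffOn_bracketCoord x₀).comp contDiff_fst.contDiffOn fun q hq => hq.1.1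
  refine h1.add (hG.clm_comp (contDiffOn_clm_apply.2 fun c => ?_))
  exact (h2.clm_apply contDiffOn_const).clm_apply contDiff_snd.contDiffOn

theorem Theta_eq_thetaCoord (hW : IsOpen W) {q : EM × F} (hq : q ∈ totPre EM x₀ W)
    (z : A.prolE (totPt F E x₀ q)) : Theta Γ Φ (totPt F E x₀ q) z =
      thetaCoord Γ Φ.toFun x₀ q (fibreCoord F E x₀ _ (A.baseVec z)) +
        dualCoord x₀ Φ.toFun q (totCoord EM x₀ _ (A.prolAnchor z)).2 :=
  Theta_totPt Γ Φ hq.1 hq.2 (((Φ.contDiffOn_dualCoord x₀).contDiffAt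
    ((isOpen_totPre x₀ hW).mem_nhds hq)).differentiableAt (by simp)) z

/-- The closedness of `Θ` in coordinates. -/
theorem closed_coord (hW : IsOpen W) (hcl : A.IsClosedOn (Theta Γ Φ) W) {D : Set (EM × F)}
    (hD : IsOpen D) (hDW : D ⊆ totPre EM x₀ W) {c₁ c₂ : EM × F → F} {w₁ w₂ : EM × F → EM × F}
    (h₁ : A.IsSectionData x₀ D c₁ w₁) (h₂ : A.IsSectionData x₀ D c₂ w₂) {q : EM × F} (hq : q ∈ D) :
    fderiv ℝ (fun q => thetaCoord Γ Φ.toFun x₀ q (c₂ q) + dualCoord x₀ Φ.toFun q (w₂ q).2) q (w₁ q) -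
      fderiv ℝ (fun q => thetaCoord Γ Φ.toFun x₀ q (c₁ q) + dualCoord x₀ Φ.toFun q (w₁ q).2) q
        (w₂ q) =
      thetaCoord Γ Φ.toFun x₀ q (bracketBase A x₀ c₁ c₂ w₁ w₂ q) +
        dualCoord x₀ Φ.toFun q (VectorField.lieBracket ℝ w₁ w₂ q).2 := by
  have hDD : D ⊆ totDom EM F E x₀ := fun q hq => (hDW hq).1
  obtain ⟨Z₁, hZ₁⟩ := exists_hasComponents hDD h₁.compat
  obtain ⟨Z₂, hZ₂⟩ := exists_hasComponents hDD h₂.compat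
  obtain ⟨Z₃, hZ₃⟩ := exists_hasComponents hDD fun q hq => h₁.bracket_compat hD hDD h₂ hq
  have hval : ∀ {c : EM × F → F} {w : EM × F → EM × F} {Z : ∀ a : TotalSpace F E, A.prolE a},
      HasComponents x₀ D Z c w → ∀ q ∈ D, Theta Γ Φ (totPt F E x₀ q) (Z (totPt F E x₀ q)) =
        thetaCoord Γ Φ.toFun x₀ q (c q) + dualCoord x₀ Φ.toFun q (w q).2 := by
    intro c w Z hZ q hq
    rw [Theta_eq_thetaCoord hW (hDW hq), (hZ q hq).1, (hZ q hq).2]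
  have hder : ∀ {c : EM × F → F} {w : EM × F → EM × F} {Z : ∀ a : TotalSpace F E, A.prolE a},
      A.IsSectionData x₀ D c w → HasComponents x₀ D Z c w →
      ∀ v : TangentSpace (totModel EM F) (totPt F E x₀ q),
      dirDeriv (totModel EM F) (fun a' => Theta Γ Φ a' (Z a')) (totPt F E x₀ q) v =
        fderiv ℝ (fun q => thetaCoord Γ Φ.toFun x₀ q (c q) + dualCoord x₀ Φ.toFun q (w q).2) q
          (totCoord EM x₀ _ v) := by
    intro c w Z h hZ v
    have hsm : ContDiffOn ℝ ∞ (fun q => thetaCoord Γ Φ.toFun x₀ q (c q) +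
        dualCoord x₀ Φ.toFun q (w q).2) D :=
      (((contDiffOn_thetaCoord hW).mono hDW).clm_apply h.contDiffOn_base).add
        (((Φ.contDiffOn_dualCoord x₀).mono hDW).clm_apply h.contDiffOn_anchor.snd)
    refine dirDeriv_totPt (hDD hq) ((hsm.contDiffAt (hD.mem_nhds hq)).differentiableAt (by simp))
      ?_ v
    filter_upwards [hD.mem_nhds hq] with q' hq' using hval hZ q' hq'
  have hVW : totImg E x₀ D ⊆ W := fun a ha => by
    obtain ⟨q, hq, rfl⟩ := exists_of_mem_totImg ha
    exact (hDW hq).2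
  have key := hcl _ (isOpen_totImg x₀ hD) hVW Z₁ Z₂ Z₃ (hZ₁.smoothOn hD hDD h₁)
    (hZ₂.smoothOn hD hDD h₂) (isProlBracket_of_hasComponents hD hDD h₁ h₂ hZ₁ hZ₂ hZ₃) _
    (totPt_mem_totImg hDD hq)
  rw [hder h₂ hZ₂, hder h₁ hZ₁, hval hZ₃ q hq, (hZ₁ q hq).2, (hZ₂ q hq).2, sub_eq_zero] at key
  exact key

/-- If `Θ` vanishes on the sections of `Ker ρ^τ`, its components vanish on the kernel of the
anchor: a vector of the kernel extends to a section of the kernel, as the rank is constant. -/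
theorem thetaCoord_eq_zero (hW : IsOpen W) (hker : A.VanishesOnKer (Theta Γ Φ) W) {S : Submodule ℝ EM}
    {P : EM →L[ℝ] S} {B : EM → S →L[ℝ] F} {D' : Set EM} (hD' : IsOpen D')
    (hB : ContDiffOn ℝ ∞ B D') (hPB : ∀ p ∈ D', ∀ σ, P (A.anchorCoord x₀ p (B p σ)) = σ)
    (hP : ∀ p ∈ D', ∀ c, P (A.anchorCoord x₀ p c) = 0 → A.anchorCoord x₀ p c = 0) {q : EM × F}
    (hq : q ∈ totPre EM x₀ W) (hqD : q.1 ∈ D') {c : F} (hc : A.anchorCoord x₀ q.1 c = 0) :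
    thetaCoord Γ Φ.toFun x₀ q c = 0 := by
  set D : Set (EM × F) := totPre EM x₀ W ∩ Prod.fst ⁻¹' D' with hDdef
  have hD : IsOpen D := (isOpen_totPre x₀ hW).inter (hD'.preimage continuous_fst)
  have hDD : D ⊆ totDom EM F E x₀ := fun q hq => hq.1.1
  let k : EM × F → F := fun q => c - B q.1 (P (A.anchorCoord x₀ q.1 c))
  have hkρ : ∀ q ∈ D, A.anchorCoord x₀ q.1 (k q) = 0 := fun q hq => by
    refine hP _ hq.2 _ ?_
    simp only [k]
    rw [map_sub, map_sub, hPB _ hq.2, sub_self]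
  have hρs : ContDiffOn ℝ ∞ (fun q : EM × F => A.anchorCoord x₀ q.1) D :=
    (A.contDiffOn_anchorCoord x₀).comp contDiff_fst.contDiffOn fun q hq => (hDD hq).1
  have hBs : ContDiffOn ℝ ∞ (fun q : EM × F => B q.1) D :=
    hB.comp contDiff_fst.contDiffOn fun q hq => hq.2
  have hk : A.IsSectionData x₀ D k (fun _ => 0) :=
    ⟨contDiffOn_const.sub (hBs.clm_apply (P.contDiff.comp_contDiffOn
      (hρs.clm_apply contDiffOn_const))), contDiffOn_const, hkρ⟩
  obtain ⟨Z, hZ⟩ := exists_hasComponents hDD hk.compat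
  have hVW : totImg E x₀ D ⊆ W := fun a ha => by
    obtain ⟨q, hq, rfl⟩ := exists_of_mem_totImg ha
    exact hq.1.2
  have hqDD : q ∈ D := ⟨hq, hqD⟩
  have key := hker _ (isOpen_totImg x₀ hD) hVW Z (hZ.smoothOn hD hDD hk) (fun a ha => by
    obtain ⟨q, hq, rfl⟩ := exists_of_mem_totImg ha
    apply tangentCoord_injective (J := totModel EM F) (p₀ := (⟨x₀, 0⟩ : TotalSpace F E))
      (mem_totChart_source (a := totPt F E x₀ q) (hDD hq).1.2)
    exact (hZ q hq).2.trans (map_zero (totCoord EM x₀ (totPt F E x₀ q))).symm) _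
    (totPt_mem_totImg hDD hqDD)
  rw [Theta_eq_thetaCoord hW hq, (hZ q hqDD).1, (hZ q hqDD).2] at key
  simp only [k, hc, map_zero, sub_zero, Prod.snd_zero, add_zero] at key
  exact key

/-- A local primitive of `Θ`, in coordinates. The image of the anchor of `𝓛^τ E` is involutive, and
`Θ`, vanishing on the kernel, descends to a form on it which is closed along its leaves. -/
theorem exists_primitive_coord (hA : A.IsRegular) (hW : IsOpen W)
    (hcl : A.IsClosedOn (Theta Γ Φ) W) (hker : A.VanishesOnKer (Theta Γ Φ) W) {q₀ : EM × F}
    (hq₀ : q₀ ∈ totPre EM x₀ W) :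
    ∃ (V : Set (EM × F)) (f : EM × F → ℝ), IsOpen V ∧ q₀ ∈ V ∧ V ⊆ totPre EM x₀ W ∧
      ContDiffOn ℝ ∞ f V ∧ ∀ q ∈ V, ∀ (c u : F),
        fderiv ℝ f q (A.anchorCoord x₀ q.1 c, u) =
          thetaCoord Γ Φ.toFun x₀ q c + dualCoord x₀ Φ.toFun q u := by
  obtain ⟨r, hr⟩ := hA
  obtain ⟨S, P, B, D', hD', hq₀D, hD'D, hB, hPB, hP⟩ := exists_splitting_of_constant_rank
    (isOpen_frameDom x₀) (A.contDiffOn_anchorCoord x₀)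
    (fun p hp => (finrank_range_anchorCoord A hp).trans (hr _)) hq₀.1.1
  have : CompleteSpace (S × F) := FiniteDimensional.complete ℝ _
  set D : Set (EM × F) := totPre EM x₀ W ∩ Prod.fst ⁻¹' D' with hDdef
  have hD : IsOpen D := (isOpen_totPre x₀ hW).inter (hD'.preimage continuous_fst)
  have hDW : D ⊆ totPre EM x₀ W := inter_subset_left
  have hDD : D ⊆ totDom EM F E x₀ := fun q hq => hq.1.1
  have hρs : ContDiffOn ℝ ∞ (fun q : EM × F => A.anchorCoord x₀ q.1) D :=
    (A.contDiffOn_anchorCoord x₀).comp contDiff_fst.contDiffOn fun q hq => (hDD hq).1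
  have hBs : ContDiffOn ℝ ∞ (fun q : EM × F => B q.1) D :=
    hB.comp contDiff_fst.contDiffOn fun q hq => hq.2
  -- the sections with base part `B σ` and constant fibre part `φ` span the image of the anchor
  let R : EM × F → S × F →L[ℝ] F := fun q => (B q.1).comp (ContinuousLinearMap.fst ℝ S F)
  let T : EM × F → S × F →L[ℝ] EM × F := fun q =>
    ContinuousLinearMap.prod ((A.anchorCoord x₀ q.1).comp (R q)) (ContinuousLinearMap.snd ℝ S F)
  let θ : EM × F → S × F →L[ℝ] ℝ := fun q => (thetaCoord Γ Φ.toFun x₀ q).comp (R q) +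
    (dualCoord x₀ Φ.toFun q).comp (ContinuousLinearMap.snd ℝ S F)
  have hR : ContDiffOn ℝ ∞ R D := hBs.clm_comp contDiffOn_const
  have hT : ContDiffOn ℝ ∞ T D := by
    refine contDiffOn_clm_apply.2 fun ξ => ?_
    exact ((hρs.clm_apply (hR.clm_apply contDiffOn_const)).prodMk contDiffOn_const)
  have hα : ContDiffOn ℝ ∞ (thetaCoord Γ Φ.toFun x₀) D := (contDiffOn_thetaCoord hW).mono hDW
  have hθ : ContDiffOn ℝ ∞ θ D :=
    (hα.clm_comp hR).add (((Φ.contDiffOn_dualCoord x₀).mono hDW).clm_comp contDiffOn_const)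
  let pr : EM × F →L[ℝ] S × F := P.prodMap (ContinuousLinearMap.id ℝ F)
  have hpr : ∀ q ∈ D, ∀ ξ, pr (T q ξ) = ξ := fun q hq ξ => Prod.ext (hPB _ hq.2 _) rfl
  have hdata : ∀ ξ, A.IsSectionData x₀ D (fun q => R q ξ) (fun q => T q ξ) := fun ξ =>
    ⟨hR.clm_apply contDiffOn_const, hT.clm_apply contDiffOn_const, fun q hq => rfl⟩
  have hTd : ∀ {q}, q ∈ D → ∀ ξ v, fderiv ℝ (fun q => T q ξ) q v = fderiv ℝ T q v ξ := by
    intro q hq ξ v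
    have h1 := ((hT.contDiffAt (hD.mem_nhds hq)).differentiableAt (by simp)).hasFDerivAt.clm_apply
      (hasFDerivAt_const ξ q)
    rw [h1.fderiv]
    simp
  have hθd : ∀ {q}, q ∈ D → ∀ ξ v, fderiv ℝ (fun q => θ q ξ) q v = fderiv ℝ θ q v ξ := by
    intro q hq ξ v
    have h1 := ((hθ.contDiffAt (hD.mem_nhds hq)).differentiableAt (by simp)).hasFDerivAt.clm_apply
      (hasFDerivAt_const ξ q)
    rw [h1.fderiv]
    simp
  have hprd : ∀ {q}, q ∈ D → ∀ ξ v, pr (fderiv ℝ (fun q => T q ξ) q v) = 0 := by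
    intro q hq ξ v
    have h1 : HasFDerivAt (fun q => pr (T q ξ)) (pr.comp (fderiv ℝ (fun q => T q ξ) q)) q :=
      HasFDerivAt.comp (g := pr) q pr.hasFDerivAt (((hdata ξ).contDiffOn_anchor.contDiffAt
        (hD.mem_nhds hq)).differentiableAt (by simp)).hasFDerivAt
    have h2 : HasFDerivAt (fun q => pr (T q ξ)) (0 : EM × F →L[ℝ] S × F) q :=
      (hasFDerivAt_const ξ q).congr_of_eventuallyEq (by
        filter_upwards [hD.mem_nhds hq] with q' hq' using hpr q' hq' ξ)
    exact DFunLike.congr_fun (h1.unique h2) v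
  -- the bracket of two such sections lies in the kernel of the anchor
  have hbr : ∀ q ∈ D, ∀ ξ τ, A.anchorCoord x₀ q.1 (bracketBase A x₀ (fun q => R q ξ)
      (fun q => R q τ) (fun q => T q ξ) (fun q => T q τ) q) = 0 ∧
      VectorField.lieBracket ℝ (fun q => T q ξ) (fun q => T q τ) q = 0 := by
    intro q hq ξ τ
    have h1 := (hdata ξ).bracket_compat hD hDD (hdata τ) hq
    have h2 : pr (VectorField.lieBracket ℝ (fun q => T q ξ) (fun q => T q τ) q) = 0 := by
      rw [VectorField.lieBracket, map_sub, hprd hq, hprd hq, sub_self]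
    have h3 : A.anchorCoord x₀ q.1 (bracketBase A x₀ (fun q => R q ξ)
        (fun q => R q τ) (fun q => T q ξ) (fun q => T q τ) q) = 0 := by
      refine hP _ hq.2 _ ?_
      rw [h1]
      exact congrArg Prod.fst h2
    have h4 : (VectorField.lieBracket ℝ (fun q => T q ξ) (fun q => T q τ) q).1 = 0 := h1.symm.trans h3
    have h5 : (VectorField.lieBracket ℝ (fun q => T q ξ) (fun q => T q τ) q).2 = 0 :=
      congrArg Prod.snd h2
    exact ⟨h3, Prod.ext h4 h5⟩
  have hTc : ∀ q ∈ D, ∀ ξ τ, fderiv ℝ T q (T q ξ) τ = fderiv ℝ T q (T q τ) ξ := by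
    intro q hq ξ τ
    have h := (hbr q hq ξ τ).2
    rw [VectorField.lieBracket, sub_eq_zero, hTd hq, hTd hq] at h
    exact h
  have hθc : ∀ q ∈ D, ∀ ξ τ, fderiv ℝ θ q (T q ξ) τ = fderiv ℝ θ q (T q τ) ξ := by
    intro q hq ξ τ
    obtain ⟨h1, h2⟩ := hbr q hq ξ τ
    have h3 := closed_coord hW hcl hD hDW (hdata ξ) (hdata τ) hq
    rw [h2, thetaCoord_eq_zero hW hker hD' hB hPB hP hq.1 hq.2 h1, Prod.snd_zero, map_zero,
      add_zero, sub_eq_zero] at h3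
    rw [← hθd hq, ← hθd hq]
    exact h3
  obtain ⟨V, f, hV, hq₀V, hVD, hf, hfθ⟩ := exists_primitive_along hD ⟨hq₀, hq₀D⟩ hT hθ pr
    (hpr q₀ ⟨hq₀, hq₀D⟩) hTc hθc
  refine ⟨V, f, hV, hq₀V, hVD.trans hDW, hf, fun q hq c u => ?_⟩
  have hqD := hVD hq
  -- `c` and `B P ρ(c)` have the same image under the anchor
  set σ := P (A.anchorCoord x₀ q.1 c) with hσ
  have h1 : A.anchorCoord x₀ q.1 (c - B q.1 σ) = 0 := by
    refine hP _ hqD.2 _ ?_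
    rw [map_sub, map_sub, hPB _ hqD.2, sub_self]
  have h2 := thetaCoord_eq_zero hW hker hD' hB hPB hP hqD.1 hqD.2 h1
  rw [map_sub, sub_eq_zero] at h1 h2
  rw [h1, h2]
  exact hfθ q hq (σ, u)

/-- The fibre derivative of a local diffeomorphism `E → E*` over `M` is injective. -/
theorem FibredLocalDiffeo.fderiv_dualCoord_injective (Φ : FibredLocalDiffeo EM F E W)
    (hW : IsOpen W) {q : EM × F} (hq : q ∈ totPre EM x₀ W) {w : F}
    (hw : fderiv ℝ (dualCoord (EM := EM) x₀ Φ.toFun) q (0, w) = 0) : w = 0 := by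
  have hΦ := Φ.isLocalDiffeo ⟨_, hq.2⟩
  have hmd : MDifferentiableAt (totModel EM F) (totModel EM (F →L[ℝ] ℝ))
      (toDualMap (F := F) Φ.toFun) (totPt F E x₀ q) := hΦ.mdifferentiableAt (by simp)
  have hinj : Function.Injective (mfderiv (totModel EM F) (totModel EM (F →L[ℝ] ℝ))
      (toDualMap (F := F) Φ.toFun) (totPt F E x₀ q)) :=
    (hΦ.mfderivToContinuousLinearEquiv (by simp)).injective
  have hsd : toDualMap (F := F) Φ.toFun (totPt F E x₀ q) ∈ (dualChart EM F E x₀).source :=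
    mem_dualChart_source (β := toDualMap (F := F) Φ.toFun (totPt F E x₀ q)) hq.1.1.2
  have hs := mem_totChart_source (a := totPt F E x₀ q) hq.1.1.2
  have h1 := (hasMFDerivAt_extChartAt_tangentCoord hsd).comp _ hmd.hasMFDerivAt
  have hd : HasFDerivAt (fun q : EM × F => (q.1, dualCoord (EM := EM) x₀ Φ.toFun q))
      ((ContinuousLinearMap.fst ℝ EM F).prod (fderiv ℝ (dualCoord (EM := EM) x₀ Φ.toFun) q))
      (totChart EM F E x₀ (totPt F E x₀ q)) := by
    rw [totChart_totPt hq.1]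
    exact hasFDerivAt_fst.prodMk (((Φ.contDiffOn_dualCoord x₀).contDiffAt
      ((isOpen_totPre x₀ hW).mem_nhds hq)).differentiableAt (by simp)).hasFDerivAt
  have h2 := hd.hasMFDerivAt.comp _ (hasMFDerivAt_extChartAt_tangentCoord hs)
  have h3 := h2.congr_of_eventuallyEq
    (f₁ := dualChart EM F E x₀ ∘ toDualMap (F := F) Φ.toFun) (by
      filter_upwards [mem_nhds_proj_preimage (a := totPt F E x₀ q) hq.1.1.2] with a ha
      obtain ⟨q', hq', rfl⟩ := exists_totDom (F := F) (a := a) ha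
      rw [Function.comp_apply, Function.comp_apply, dualChart_toDualMap hq', totChart_totPt hq'])
  have h4 := DFunLike.congr_fun (hasMFDerivAt_unique h1 h3)
    (vertLift (totPt F E x₀ q) (ofFibreCoord F E x₀ _ w))
  have h5 := (totCoord_vertLift (a := totPt F E x₀ q) hq.1.1.2 (ofFibreCoord F E x₀ _ w)).trans
    (congrArg (Prod.mk (0 : EM))
      (fibreCoord_ofFibreCoord (EM := EM) (x := (totPt F E x₀ q).proj) hq.1.1.2 w))
  have h6 : tangentCoord (totModel EM (F →L[ℝ] ℝ)) (⟨x₀, 0⟩ : DualTot F E)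
      (toDualMap (F := F) Φ.toFun (totPt F E x₀ q)) (mfderiv (totModel EM F)
        (totModel EM (F →L[ℝ] ℝ)) (toDualMap (F := F) Φ.toFun) (totPt F E x₀ q)
          (vertLift (totPt F E x₀ q) (ofFibreCoord F E x₀ _ w))) = 0 := by
    refine h4.trans ?_
    refine (congrArg ((ContinuousLinearMap.fst ℝ EM F).prod
      (fderiv ℝ (dualCoord (EM := EM) x₀ Φ.toFun) q)) h5).trans ?_
    exact Prod.ext rfl hw
  have h7 := hinj ((tangentCoord_injective hsd (h6.trans (ContinuousLinearMap.map_zero _).symm)).trans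
    (ContinuousLinearMap.map_zero _).symm)
  have h8 := h5.symm.trans ((congrArg (totCoord EM x₀ (totPt F E x₀ q)) h7).trans
    (ContinuousLinearMap.map_zero _))
  exact congrArg Prod.snd h8

/-- If `Θ_{Γ,F}` is closed and vanishes on `Ker ρ^τ`, then `F` is, locally, the Legendre
transformation of a solution of the inverse problem. -/
theorem exists_solution_of_closed (hA : A.IsRegular) (hW : IsOpen W)
    (hcl : A.IsClosedOn (Theta Γ Φ) W) (hker : A.VanishesOnKer (Theta Γ Φ) W)
    {a : TotalSpace F E} (ha : a ∈ W) :
    ∃ U : Set (TotalSpace F E), IsOpen U ∧ a ∈ U ∧ U ⊆ W ∧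
      ∃ L : TotalSpace F E → ℝ, SolvesInverseProblem Γ U L ∧
        ∀ a' ∈ U, ∀ b : E a'.proj, Φ.toFun a' b = fibreDeriv L a' b := by
  obtain ⟨x₀, q₀, hq₀, rfl⟩ : ∃ x₀, ∃ q ∈ totDom EM F E x₀, totPt F E x₀ q = a :=
    ⟨a.proj, exists_totDom (mem_frameNhd _)⟩
  obtain ⟨V, f, hV, hq₀V, hVW, hf, hfθ⟩ :=
    exists_primitive_coord hA hW hcl hker (q₀ := q₀) ⟨hq₀, ha⟩
  have hVD : V ⊆ totDom EM F E x₀ := fun q hq => (hVW hq).1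
  let L : TotalSpace F E → ℝ := fun a => f (totChart EM F E x₀ a)
  have hLf : EqOn (fun q => L (totPt F E x₀ q)) f V := fun q hq =>
    congrArg f (totChart_totPt (hVD hq))
  have hLV : ContDiffOn ℝ ∞ (fun q => L (totPt F E x₀ q)) V := hf.congr hLf
  have hd : ∀ q ∈ V, fderiv ℝ (fun q => L (totPt F E x₀ q)) q = fderiv ℝ f q := fun q hq =>
    (hLf.eventuallyEq_of_mem (hV.mem_nhds hq)).fderiv_eq
  have hLθ : ∀ q ∈ V, ∀ c u : F, fderiv ℝ (fun q => L (totPt F E x₀ q)) q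
      (A.anchorCoord x₀ q.1 c, u) = thetaCoord Γ Φ.toFun x₀ q c + dualCoord x₀ Φ.toFun q u :=
    fun q hq c u => by rw [hd q hq, hfθ q hq]
  have hleg : ∀ q ∈ V, ∀ b, Φ.toFun (totPt F E x₀ q) b = fibreDeriv L (totPt F E x₀ q) b := by
    intro q hq b
    have h1 := hLθ q hq 0 (fibreCoord F E x₀ _ b)
    rw [map_zero, map_zero, zero_add, dualCoord_fibreCoord (hVD hq)] at h1
    rw [fibreDeriv_totPt (hVD hq) ((hLV.contDiffAt (hV.mem_nhds hq)).differentiableAt (by simp))]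
    exact h1.symm
  have hhess : ∀ q ∈ V, ∀ w c, fderiv ℝ (dualCoord (EM := EM) x₀ Φ.toFun) q w c =
      fderiv ℝ (fderiv ℝ (fun q => L (totPt F E x₀ q))) q w (0, c) := fun q hq =>
    (fderiv_dualCoord hV hVD hLV hleg hq).2
  have hsymm : ∀ q ∈ V, IsSymmSndFDerivAt ℝ (fun q => L (totPt F E x₀ q)) q := fun q hq =>
    (hLV.contDiffAt (hV.mem_nhds hq)).isSymmSndFDerivAt (by
      rw [minSmoothness_of_isRCLikeNormedField]; exact ENat.LEInfty.out)
  -- the fibre Hessian is nondegenerate since `F` is a local diffeomorphism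
  have hnd : ∀ q ∈ V, ∀ b : E (totPt F E x₀ q).proj,
      (∀ c : E (totPt F E x₀ q).proj, fderiv ℝ (fderiv ℝ (fun q => L (totPt F E x₀ q))) q
        (0, fibreCoord F E x₀ _ b) (0, fibreCoord F E x₀ _ c) = 0) → b = 0 := by
    intro q hq b hb
    have h1 : fibreCoord F E x₀ _ b = 0 := by
      refine Φ.fderiv_dualCoord_injective hW (hVW hq) ?_
      ext c
      rw [hhess q hq]
      have h2 := hb (ofFibreCoord F E x₀ _ c)
      rw [fibreCoord_ofFibreCoord (EM := EM) (x := (totPt F E x₀ q).proj) (hVD hq).1.2] at h2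
      exact h2
    rw [← ofFibreCoord_fibreCoord (EM := EM) (x := (totPt F E x₀ q).proj) (hVD hq).1.2 b, h1,
      map_zero]
  let g : ∀ a : TotalSpace F E, LinearMap.BilinForm ℝ (E a.proj) := fun a =>
    LinearMap.mk₂ ℝ (fun b c => fderiv ℝ (fderiv ℝ (fun q => L (totPt F E x₀ q)))
        (totChart EM F E x₀ a) ((0 : EM), fibreCoord F E x₀ _ b) ((0 : EM), fibreCoord F E x₀ _ c))
      (fun b b' c => by
        rw [← add_apply, ← map_add, Prod.mk_add_mk, add_zero, ← map_add])
      (fun r b c => by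
        rw [← smul_apply, ← map_smul, Prod.smul_mk, smul_zero, ← map_smul])
      (fun b c c' => by rw [← map_add, Prod.mk_add_mk, add_zero, ← map_add])
      (fun r b c => by rw [← map_smul, Prod.smul_mk, smul_zero, ← map_smul])
  have hg : ∀ q ∈ V, ∀ b c, g (totPt F E x₀ q) b c =
      fderiv ℝ (fderiv ℝ (fun q => L (totPt F E x₀ q))) q
        (0, fibreCoord F E x₀ _ b) (0, fibreCoord F E x₀ _ c) := fun q hq b c => by
    have h1 : g (totPt F E x₀ q) b c = fderiv ℝ (fderiv ℝ (fun q => L (totPt F E x₀ q)))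
      (totChart EM F E x₀ (totPt F E x₀ q)) ((0 : EM), fibreCoord F E x₀ _ b)
        ((0 : EM), fibreCoord F E x₀ _ c) := rfl
    rw [h1, totChart_totPt (hVD hq)]
  refine ⟨totImg E x₀ V, isOpen_totImg x₀ hV, totPt_mem_totImg hVD hq₀V, fun a ha => ?_, L,
    ⟨?_, fun a ha => ?_, g, fun a ha => ?_, fun a ha => ?_⟩, fun a ha => ?_⟩
  · obtain ⟨q, hq, rfl⟩ := exists_of_mem_totImg ha
    exact (hVW hq).2
  · exact hf.contMDiffOn.comp ((contMDiffOn_totChart x₀).mono inter_subset_left) fun a ha => ha.2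
  · obtain ⟨q, hq, rfl⟩ := exists_of_mem_totImg ha
    intro b hb
    refine hnd q hq b fun c => ?_
    rw [← fibreHessian_totPt hV hVD hq hLV]
    exact hb c
  · obtain ⟨q, hq, rfl⟩ := exists_of_mem_totImg ha
    refine ⟨fun b hb => hnd q hq b fun c => ?_, fun c hc => hnd q hq c fun b => ?_⟩
    · rw [← hg q hq]
      exact hb c
    · rw [(hsymm q hq).eq, ← hg q hq]
      exact hc b
  · obtain ⟨q, hq, rfl⟩ := exists_of_mem_totImg ha
    intro v u hvu X Y hY
    -- the Euler-Lagrange expression vanishes at `Γ`, and is affine in `ẏ` with the Hessian as slope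
    have hvc : totCoord EM x₀ _ v = Γ.fieldCoord x₀ q +
        ((0 : EM), fibreCoord F E x₀ (totPt F E x₀ q).proj u) := by
      rw [← totCoord_vertLift (a := totPt F E x₀ q) (hVD hq).1.2, ← hvu]
      exact ((congrArg _ (map_sub (totCoord EM x₀ (totPt F E x₀ q)) _ _)).trans
        (add_sub_cancel _ _)).symm
    have hΓ : (Γ.fieldCoord x₀ q).1 = A.anchorCoord x₀ q.1 q.2 := Γ.totCoord_field_fst (hVD hq)
    rw [eulerLagrange_totPt L hV hVD hLV hq v (by rw [hvc, Prod.fst_add, hΓ, add_zero]) X Y hY,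
      hg q hq]
    have h1 := hLθ q hq (secCoord x₀ X q.1) 0
    have h2 := hLθ q hq 0 (A.bracketCoord x₀ q.1 (secCoord x₀ X q.1) q.2)
    rw [map_zero, add_zero] at h1
    rw [map_zero, map_zero, zero_add] at h2
    have h3 : thetaCoord Γ Φ.toFun x₀ q (secCoord x₀ X q.1) =
        fderiv ℝ (fderiv ℝ (fun q => L (totPt F E x₀ q))) q (Γ.fieldCoord x₀ q)
          (0, secCoord x₀ X q.1) +
        dualCoord x₀ Φ.toFun q (A.bracketCoord x₀ q.1 (secCoord x₀ X q.1) q.2) := by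
      rw [← hhess q hq]
      rfl
    have h4 : fibreCoord F E x₀ (totPt F E x₀ q).proj (X (totPt F E x₀ q).proj) =
      secCoord x₀ X q.1 := rfl
    rw [h1, h2, h3, h4, hvc, map_add, add_apply]
    ring
  · obtain ⟨q, hq, rfl⟩ := exists_of_mem_totImg ha
    exact hleg q hq

end

end LieAlgebroid

end Primitive

end

theorem mainTheorem1
    {EM : Type*} [NormedAddCommGroup EM] [NormedSpace ℝ EM] [FiniteDimensional ℝ EM]
    {M : Type*} [TopologicalSpace M] [T2Space M] [ChartedSpace EM M] [IsManifold 𝓘(ℝ, EM) ∞ M]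
    {F : Type*} [NormedAddCommGroup F] [NormedSpace ℝ F] [FiniteDimensional ℝ F]
    {E : M → Type*} [TopologicalSpace (TotalSpace F E)] [∀ x, TopologicalSpace (E x)]
    [∀ x, AddCommGroup (E x)] [∀ x, Module ℝ (E x)]
    [FiberBundle F E] [VectorBundle ℝ F E] [ContMDiffVectorBundle ∞ F E 𝓘(ℝ, EM)]
    (A : LieAlgebroid EM F E) (hA : A.IsRegular) (Γ : A.SODE) :
    (Γ.IsVariational ↔
      ∀ a : TotalSpace F E, ∃ W : Set (TotalSpace F E), IsOpen W ∧ a ∈ W ∧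
        ∃ Φ : LieAlgebroid.FibredLocalDiffeo EM F E W,
          A.IsClosedOn (LieAlgebroid.Theta Γ Φ) W ∧ A.VanishesOnKer (LieAlgebroid.Theta Γ Φ) W) ∧
    (∀ W : Set (TotalSpace F E), IsOpen W →
      (∃ L : TotalSpace F E → ℝ, LieAlgebroid.SolvesInverseProblem Γ W L) →
        ∃ Φ : LieAlgebroid.FibredLocalDiffeo EM F E W,
          A.IsClosedOn (LieAlgebroid.Theta Γ Φ) W ∧ A.VanishesOnKer (LieAlgebroid.Theta Γ Φ) W) ∧
    (∀ W : Set (TotalSpace F E), IsOpen W → ∀ Φ : LieAlgebroid.FibredLocalDiffeo EM F E W,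
      (A.IsClosedOn (LieAlgebroid.Theta Γ Φ) W ∧ A.VanishesOnKer (LieAlgebroid.Theta Γ Φ) W) ↔
        ∀ a ∈ W, ∃ U : Set (TotalSpace F E), IsOpen U ∧ a ∈ U ∧ U ⊆ W ∧
          ∃ L : TotalSpace F E → ℝ, LieAlgebroid.SolvesInverseProblem Γ U L ∧
            ∀ a' ∈ U, ∀ b : E a'.proj, Φ.toFun a' b = fibreDeriv L a' b) := by
  refine ⟨⟨fun h a => ?_, fun h a => ?_⟩, fun W hW ⟨L, hL⟩ =>
    LieAlgebroid.exists_closed_of_solution hW hL, fun W hW Φ =>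
    ⟨fun h a ha => LieAlgebroid.exists_solution_of_closed hA hW h.1 h.2 ha,
      fun h => LieAlgebroid.closed_of_solutions Φ h⟩⟩
  · obtain ⟨U, hU, ha, L, hL⟩ := h a
    exact ⟨U, hU, ha, LieAlgebroid.exists_closed_of_solution hU hL⟩
  · obtain ⟨W, hW, ha, Φ, hcl, hker⟩ := h a
    obtain ⟨U, hU, haU, -, L, hL, -⟩ :=
      LieAlgebroid.exists_solution_of_closed hA hW hcl hker ha
    exact ⟨U, hU, haU, L, hL⟩
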